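/- Let $d\ge 1$, $\epsilon>0$ and $c>0$. For $\hbar>0$ let $\widehat H_\hbar=-\frac{\hbar^2}{2}\Delta+\frac{\|x\|^2}{2}$ on $L^2(\mathbb R^d)$, with eigenvalues $E_N(\hbar)=\hbar(N+\frac d2)$, $N=0,1,2,\dots$. Let $\Pi_{\hbar,E_N(\hbar)}(x,y)$ be the continuous integral kernel of the orthogonal projection of $L^2(\mathbb R^d)$ onto the eigenspace $\{\psi\in L^2(\mathbb R^d):\widehat H_\hbar\psi=E_N(\hbar)\psi\}$, and put \[ W_{\hbar,E_N(\hbar)}(x,\xi)=\int_{\mathbb R^d}\Pi_{\hbar,E_N(\hbar)}\Big(x+\frac v2,x-\frac v2\Big)e^{-\frac i\hbar v\cdot\xi}\frac{dv}{(2\pi\hbar)^d},\qquad W_{\hbar,[0,E]}(x,\xi)=\sum_{N:\,E_N(\hbar)\in[0,E]}W_{\hbar,E_N(\hbar)}(x,\xi). \] Let $H(x,\xi)=(\|x\|^2+\|\xi\|^2)/2$, and let $\mathrm{Ai}$ be the Airy function. There is a constant $C$, depending only on $d$, $\epsilon$ and $c$, such that for all $0<\hbar\le 1$, all $E\ge c$,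 all $u\in\mathbb R$ with $|u|<\hbar^{-2/3}$, and all $(x,\xi)\in\mathbb R^d\times\mathbb R^d$ with \[ H(x,\xi)=E+u\Big(\frac{\hbar}{2E}\Big)^{2/3}\qquad\text{and}\qquad H(x,\xi)\ge c, \] we have \[ \left|W_{\hbar,[0,E]}(x,\xi)-(2\pi\hbar)^{-d}\int_0^\infty\mathrm{Ai}\Big(\frac uE+\lambda\Big)d\lambda\right| \le C\,(2\pi\hbar)^{-d}\left[\hbar^{1/3-\epsilon}(1+|u|)^{1/2}+|u|^{5/2}\hbar^{2/3-\epsilon}\right]. \] -/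

import Mathlib

open MeasureTheory
open scoped SchwartzMap

noncomputable section

namespace WignerOscillator

/-- Configuration space `ℝ^d` with its Euclidean norm and Lebesgue measure. -/
abbrev Conf (d : ℕ) : Type := EuclideanSpace ℝ (Fin d)

/-- The Hilbert space `L²(ℝ^d, dx)` of complex-valued functions. -/
abbrev L2 (d : ℕ) : Type := Lp ℂ 2 (volume : Measure (Conf d))

/-- The classical Hamiltonian `H(x, ξ) = (‖x‖² + ‖ξ‖²) / 2`. -/
def classicalH {d : ℕ} (x ξ : Conf d) : ℝ := (‖x‖ ^ 2 + ‖ξ‖ ^ 2) / 2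

/-- The isotropic harmonic oscillator `-(ħ²/2) Δ + ‖x‖²/2` acting on Schwartz functions
(see `oscillator_apply` for the pointwise formula). -/
def oscillator (d : ℕ) (ħ : ℝ) (φ : 𝓢(Conf d, ℂ)) : 𝓢(Conf d, ℂ) :=
  (-((ħ : ℂ) ^ 2 / 2)) • Laplacian.laplacian φ
    + ((1 : ℂ) / 2) • SchwartzMap.smulLeftCLM ℂ (fun x : Conf d => ‖x‖ ^ 2) φ

theorem oscillator_apply (d : ℕ) (ħ : ℝ) (φ : 𝓢(Conf d, ℂ)) (x : Conf d) :
    oscillator d ħ φ x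
      = -((ħ : ℂ) ^ 2 / 2) * Laplacian.laplacian (φ : Conf d → ℂ) x
        + ((‖x‖ ^ 2 / 2 : ℝ) : ℂ) * φ x := by
  have h := SchwartzMap.smulLeftCLM_apply_apply (F := ℂ)
    (Function.hasTemperateGrowth_norm_sq (H := Conf d)) φ x
  simp only [oscillator, add_apply, smul_apply,
    SchwartzMap.laplacian_apply, h, smul_eq_mul, Complex.real_smul]
  push_cast
  ring

/-- The eigenvalues `E_N(ħ) = ħ (N + d/2)`. -/
def eigenvalue (d : ℕ) (ħ : ℝ) (N : ℕ) : ℝ := ħ * (N + d / 2)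

/-- The space of `ψ ∈ L²(ℝ^d)` with `Ĥ ψ = E ψ`. The equation is understood in the sense of
tempered distributions, that is, `⟨Ĥ φ, ψ⟩ = E ⟨φ, ψ⟩` for every Schwartz function `φ`. -/
def eigenspace (d : ℕ) (ħ E : ℝ) : Submodule ℂ (L2 d) where
  carrier := {ψ | ∀ φ : 𝓢(Conf d, ℂ),
    inner ℂ ((oscillator d ħ φ).toLp 2) ψ = (E : ℂ) * inner ℂ (φ.toLp 2) ψ}
  zero_mem' := by
    intro φ
    simp
  add_mem' := by
    intro ψ₁ ψ₂ h₁ h₂ φ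
    rw [inner_add_right, inner_add_right, h₁ φ, h₂ φ, mul_add]
  smul_mem' := by
    intro a ψ h φ
    rw [inner_smul_right, inner_smul_right, h φ]
    ring

theorem isClosed_eigenspace (d : ℕ) (ħ E : ℝ) :
    IsClosed (eigenspace d ħ E : Set (L2 d)) := by
  have : (eigenspace d ħ E : Set (L2 d)) = ⋂ φ : 𝓢(Conf d, ℂ),
      {ψ : L2 d | inner ℂ ((oscillator d ħ φ).toLp 2) ψ
        = (E : ℂ) * inner ℂ (φ.toLp 2) ψ} := by
    ext ψ
    simp [eigenspace]
  rw [this]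
  exact isClosed_iInter fun φ => isClosed_eq (by fun_prop) (by fun_prop)

instance (d : ℕ) (ħ E : ℝ) : CompleteSpace (eigenspace d ħ E) :=
  (isClosed_eigenspace d ħ E).completeSpace_coe

/-- The orthogonal projection of `L²(ℝ^d)` onto the eigenspace, as an operator on `L²(ℝ^d)`. -/
def eigenprojection (d : ℕ) (ħ E : ℝ) : L2 d →L[ℂ] L2 d :=
  (eigenspace d ħ E).starProjection

/-- `K` is a continuous integral kernel of the operator `T`:
`(T f)(x) = ∫ K(x, y) f(y) dy` for almost every `x`, for every `f ∈ L²`. -/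
def IsContinuousKernel {d : ℕ} (T : L2 d →L[ℂ] L2 d) (K : Conf d → Conf d → ℂ) : Prop :=
  Continuous (fun p : Conf d × Conf d => K p.1 p.2) ∧
    ∀ f : L2 d, (T f : Conf d → ℂ) =ᵐ[volume] fun x => ∫ y, K x y * f y

open Classical in
/-- The continuous integral kernel of `T`. An operator has at most one continuous kernel, so that
the choice is no choice; the value is `0` for an operator that has none, which does not occur for
the projections used below. -/
def kernel {d : ℕ} (T : L2 d →L[ℂ] L2 d) : Conf d → Conf d → ℂ :=
  if h : ∃ K, IsContinuousKernel T K then h.choose else fun _ _ => 0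

/-- The semiclassical Wigner transform of a kernel `K`,
`∫ K(x + v/2, x - v/2) exp(-(i/ħ) v·ξ) dv / (2πħ)^d`. -/
def wignerTransform {d : ℕ} (ħ : ℝ) (K : Conf d → Conf d → ℂ) (x ξ : Conf d) : ℂ :=
  (∫ v : Conf d, K (x + (1 / 2 : ℝ) • v) (x - (1 / 2 : ℝ) • v)
      * Complex.exp (-(Complex.I / ħ) * (inner ℝ v ξ : ℝ))) / ((2 * Real.pi * ħ) ^ d : ℝ)

/-- The Wigner distribution `W_{ħ, E_N(ħ)}` of the projection onto the `N`-th eigenspace. -/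
def eigenWigner (d : ℕ) (ħ : ℝ) (N : ℕ) (x ξ : Conf d) : ℂ :=
  wignerTransform ħ (kernel (eigenprojection d ħ (eigenvalue d ħ N))) x ξ

/-- The bulk Wigner distribution `W_{ħ, [E₁, E₂]}`: the sum of `W_{ħ, E_N(ħ)}` over all `N` with
`E_N(ħ) ∈ [E₁, E₂]`, a finite set of `N` when `ħ > 0`. -/
def bulkWigner (d : ℕ) (ħ E₁ E₂ : ℝ) (x ξ : Conf d) : ℂ :=
  ∑ᶠ N ∈ {N : ℕ | eigenvalue d ħ N ∈ Set.Icc E₁ E₂}, eigenWigner d ħ N x ξ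

/-- The Airy function on the real line,
`Ai(z) = (1 / 2πi) ∫_L exp(v³/3 - z v) dv`, with the contour `L = {1 + i s : s ∈ ℝ}`, on which
the integral converges absolutely. It is real-valued, so that the real part loses nothing. -/
def airyAi (z : ℝ) : ℝ :=
  ((1 / (2 * Real.pi) : ℂ) *
    ∫ s : ℝ, Complex.exp ((1 + s * Complex.I) ^ 3 / 3 - z * (1 + s * Complex.I))).re

end WignerOscillator

end

noncomputable section

namespace WignerOscillator

/-! ### Schwartz functions of the form exp F -/

section

/-! The projections onto the eigenspaces have a generating function, the Mehler kernel `mehler`,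
whose N-th Taylor coefficient in z is the kernel of the N-th projection. Its Wigner transform is
elementary: with X = 2H/ħ it is 2^d (1+z)^(-d) exp(-X (1-z)/(1+z)). Summing the coefficients with
E_N ≤ E is a geometric sum under Cauchy's integral, and z = exp(-2w) turns the result into a contour
integral of exp(-X tanh w + Y w) / (sinh w cosh^d w) over a vertical segment of length π, where Y
differs from 2E/ħ by at most d + 1 (`exists_bulkWigner_eq`).

Put q³ = 2E/ħ and s = u/E. The hypothesis on H says exactly X = q³ + s q. Since tanh w = w - w³/3 +
O(w⁵), the phase near 0 is q³w³/3 - s q w up to small terms, and the amplitude is 1/w + O(1). With v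
= q w this is exp(v³/3 - s v)/v, the contour integrand of the Airy function integrated over [s, ∞)
(`integral_airyAi`). The contour is Re w = 1/(q (1+|s|)): close enough to the pole that the
exponential stays bounded uniformly in s, far enough that it decays like a Gaussian of rate
comparable to q²/(1+|s|) in Im w. The two integrands differ by O(1 + (1+|s|)²/q) times such a
Gaussian, because the phase difference carries a factor w that cancels the pole. Integration gives
the error (1 + (1+|s|)²/q) √(1+|s|)/q, and q ≥ q₀ ħ^(-1/3) with |s| ≤ |u|/c turns it into the bound,
even without the loss ħ^(-ε).

The identification of the projections avoids Hermite functions. Pairing with coherent states, which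
form a generating function of the eigenfunctions, turns f into an entire function Q of ζ and the
oscillator into ħ(ζ∂_ζ + d/2). Eigenvectors correspond to homogeneous Q, and the Mehler kernel acts
by ζ ↦ zζ. Its N-th Taylor coefficient therefore extracts the part of Q of degree N. Coherent states
are total by injectivity of the Fourier transform, so this operator maps into the eigenspace and
fixes it; being real and symmetric, it is the orthogonal projection (`eigenprojection_ae_eq`). -/

open Complex in
/-- All real derivatives of the complex exponential are controlled by its modulus. -/
theorem exists_norm_iteratedFDeriv_cexp_le (n : ℕ) :
    ∃ C : ℝ, 0 ≤ C ∧ ∀ i ≤ n, ∀ z : ℂ, ‖iteratedFDeriv ℝ i cexp z‖ ≤ C * Real.exp z.re := by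
  have key : ∀ i (z : ℂ), ‖iteratedFDeriv ℝ i cexp z‖
      = ‖iteratedFDeriv ℝ i cexp 0‖ * Real.exp z.re := by
    intro i z
    -- Translation of the exponential is multiplication by exp z, so every derivative at z is exp z
    -- times the one at 0.
    have h1 : (fun h : ℂ => cexp (z + h)) = cexp z • cexp := by
      ext h; simp [Complex.exp_add]
    have h2 : iteratedFDeriv ℝ i (fun h : ℂ => cexp (z + h)) 0 = iteratedFDeriv ℝ i cexp z := by
      rw [iteratedFDeriv_comp_add_left]; simp
    rw [← h2, h1, iteratedFDeriv_const_smul_apply, norm_smul, Complex.norm_exp, mul_comm]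
    exact Complex.contDiff_exp.contDiffAt
  refine ⟨∑ i ∈ Finset.range (n + 1), ‖iteratedFDeriv ℝ i cexp 0‖, by positivity, ?_⟩
  intro i hi z
  rw [key]
  gcongr
  exact Finset.single_le_sum (f := fun i => ‖iteratedFDeriv ℝ i cexp 0‖)
    (fun _ _ => norm_nonneg _) (by simp; omega)

theorem one_add_pow_le_exp (m : ℕ) {t : ℝ} (ht : 0 ≤ t) :
    (1 + t) ^ m ≤ m.factorial * Real.exp (1 + t) := by
  have := Real.pow_div_factorial_le_exp (x := 1 + t) (by linarith) m
  rwa [div_le_iff₀ (by positivity), mul_comm] at this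

/-- A polynomial and a linear exponential are absorbed by a Gaussian. -/
theorem one_add_pow_mul_exp_le (m : ℕ) {δ : ℝ} (hδ : 0 < δ) (a : ℝ) :
    ∃ C : ℝ, 0 ≤ C ∧ ∀ t : ℝ, 0 ≤ t →
      (1 + t) ^ m * Real.exp (a * t - 2 * δ * t ^ 2) ≤ C * Real.exp (-δ * t ^ 2) := by
  -- The polynomial costs m! exp(1 + t); completing the square in (a + 1) t - δ t² gives the rest.
  refine ⟨m.factorial * Real.exp (1 + (a + 1) ^ 2 / (4 * δ)), by positivity, fun t ht => ?_⟩
  calc (1 + t) ^ m * Real.exp (a * t - 2 * δ * t ^ 2)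
      ≤ m.factorial * Real.exp (1 + t) * Real.exp (a * t - 2 * δ * t ^ 2) := by
        gcongr; exact one_add_pow_le_exp m ht
    _ = m.factorial * Real.exp (1 + t + (a * t - 2 * δ * t ^ 2)) := by
        rw [mul_assoc, ← Real.exp_add]
    _ ≤ m.factorial * Real.exp (1 + (a + 1) ^ 2 / (4 * δ) + -δ * t ^ 2) := by
        refine mul_le_mul_of_nonneg_left (Real.exp_le_exp.2 ?_) (by positivity)
        have : 0 ≤ δ * (t - (a + 1) / (2 * δ)) ^ 2 := by positivity
        have e : δ * (t - (a + 1) / (2 * δ)) ^ 2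
            = δ * t ^ 2 - (a + 1) * t + (a + 1) ^ 2 / (4 * δ) := by
          field_simp; ring
        linarith
    _ = _ := by rw [Real.exp_add, mul_assoc]

/-- The exponential of a function of temperate growth whose real part is dominated by a negative
definite quadratic form is a Schwartz function. -/
def expSchwartz {V : Type*} [NormedAddCommGroup V] [NormedSpace ℝ V] (F : V → ℂ)
    (hF : F.HasTemperateGrowth) (C δ : ℝ) (hδ : 0 < δ)
    (hre : ∀ x, (F x).re ≤ C + (-2 * δ) * ‖x‖ ^ 2) : 𝓢(V, ℂ) where
  toFun x := Complex.exp (F x)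
  smooth' := Complex.contDiff_exp.comp hF.1
  decay' := by
    intro k n
    obtain ⟨l, D, hD, hDF⟩ := hF.norm_iteratedFDeriv_le_uniform n
    obtain ⟨A, hA, hAexp⟩ := exists_norm_iteratedFDeriv_cexp_le n
    obtain ⟨B, hB, hBle⟩ := one_add_pow_mul_exp_le (k + l * n) hδ 0
    refine ⟨n.factorial * A * Real.exp C * (D + 1) ^ n * B, fun x => ?_⟩
    have h1 : ‖iteratedFDeriv ℝ n (Complex.exp ∘ F) x‖
        ≤ n.factorial * (A * Real.exp (F x).re) * ((D + 1) * (1 + ‖x‖) ^ l) ^ n := by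
      refine norm_iteratedFDeriv_comp_le (N := ((⊤ : ℕ∞) : WithTop ℕ∞)) (Complex.contDiff_exp) (hF.1)
        (by exact_mod_cast le_top) x (fun i hi => hAexp i hi _) (fun i hi hin => ?_)
      refine (hDF i hin x).trans ?_
      -- The chain rule bound asks for the i-th power of one base; a base at least 1 is dominated by
      -- its powers with i ≥ 1.
      have h3 : 1 ≤ (D + 1) * (1 + ‖x‖) ^ l :=
        one_le_mul_of_one_le_of_one_le (by linarith)
          (one_le_pow₀ (by linarith [norm_nonneg x]))
      calc D * (1 + ‖x‖) ^ l ≤ (D + 1) * (1 + ‖x‖) ^ l := by gcongr; linarith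
        _ ≤ _ := le_self_pow₀ h3 (by omega)
    calc ‖x‖ ^ k * ‖iteratedFDeriv ℝ n (fun x => Complex.exp (F x)) x‖
        ≤ (1 + ‖x‖) ^ k * (n.factorial * (A * Real.exp (C + (-2 * δ) * ‖x‖ ^ 2))
            * ((D + 1) * (1 + ‖x‖) ^ l) ^ n) := by
          gcongr
          · linarith
          · exact h1.trans (by gcongr; exact hre x)
      _ = n.factorial * A * Real.exp C * (D + 1) ^ n *
            ((1 + ‖x‖) ^ (k + l * n) * Real.exp (0 * ‖x‖ - 2 * δ * ‖x‖ ^ 2)) := by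
          rw [Real.exp_add, pow_add, pow_mul, mul_pow]
          ring_nf
      _ ≤ n.factorial * A * Real.exp C * (D + 1) ^ n * B := by
          gcongr
          refine (hBle _ (norm_nonneg x)).trans ?_
          refine mul_le_of_le_one_right hB (Real.exp_le_one_iff.2 ?_)
          have : 0 ≤ δ * ‖x‖ ^ 2 := by positivity
          linarith

/-! ### Coherent states and the oscillator -/

variable {d : ℕ}

/-- The exponent of a coherent state. -/
def coherentExponent (ħ : ℝ) (ζ : ℂ) (w x : Conf d) : ℂ :=
  -(‖x‖ ^ 2 / (2 * ħ) : ℝ) + ζ * (inner ℝ w x : ℝ) - ħ * ζ ^ 2 * (‖w‖ ^ 2 : ℝ) / 4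

theorem coherentExponent_re (ħ : ℝ) (ζ : ℂ) (w x : Conf d) :
    (coherentExponent ħ ζ w x).re
      = -(‖x‖ ^ 2 / (2 * ħ)) + ζ.re * inner ℝ w x - (ħ * ζ ^ 2 * (‖w‖ ^ 2 : ℝ) / 4).re := by
  simp only [coherentExponent, Complex.sub_re, Complex.add_re, Complex.neg_re, Complex.ofReal_re,
    Complex.re_mul_ofReal]

theorem coherentExponent_hasTemperateGrowth (ħ : ℝ) (ζ : ℂ) (w : Conf d) :
    (coherentExponent ħ ζ w).HasTemperateGrowth := by
  have h1 : (fun x : Conf d => ((‖x‖ ^ 2 : ℝ) : ℂ)).HasTemperateGrowth :=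
    Function.Complex.hasTemperateGrowth_ofReal.comp (Function.hasTemperateGrowth_norm_sq (H := Conf d))
  have h2 : (fun x : Conf d => ((inner ℝ w x : ℝ) : ℂ)).HasTemperateGrowth :=
    Function.Complex.hasTemperateGrowth_ofReal.comp (Function.hasTemperateGrowth_inner_right w)
  have h3 := (((Function.HasTemperateGrowth.const (E := Conf d) (-(1 / (2 * ħ) : ℝ) : ℂ)).mul
    h1).add ((Function.HasTemperateGrowth.const (E := Conf d) ζ).mul h2)).add
      (Function.HasTemperateGrowth.const (E := Conf d) (-(ħ * ζ ^ 2 * (‖w‖ ^ 2 : ℝ) / 4)))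
  convert! h3 using 1
  ext x
  simp only [coherentExponent, Pi.add_apply, Pi.mul_apply]
  push_cast
  ring

/-- Uniform Gaussian decay of coherent states with parameter in a disc. -/
theorem exists_coherentExponent_re_le {ħ : ℝ} (hħ : 0 < ħ) (R : ℝ) (w : Conf d) :
    ∃ C : ℝ, ∀ ζ : ℂ, ‖ζ‖ ≤ R → ∀ x : Conf d,
      (coherentExponent ħ ζ w x).re ≤ C + R * ‖w‖ * ‖x‖ - 1 / (2 * ħ) * ‖x‖ ^ 2 := by
  refine ⟨ħ * R ^ 2 * ‖w‖ ^ 2 / 4, fun ζ hζ x => ?_⟩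
  have h0 : 0 ≤ R := (norm_nonneg _).trans hζ
  rw [coherentExponent_re]
  have h1 : ζ.re * inner ℝ w x ≤ R * ‖w‖ * ‖x‖ := by
    refine (le_abs_self _).trans ?_
    rw [abs_mul, mul_assoc]
    exact mul_le_mul ((Complex.abs_re_le_norm ζ).trans hζ) (abs_real_inner_le_norm w x)
      (abs_nonneg _) h0
  have h2 : -(ħ * ζ ^ 2 * (‖w‖ ^ 2 : ℝ) / 4 : ℂ).re ≤ ħ * R ^ 2 * ‖w‖ ^ 2 / 4 := by
    rw [← Complex.neg_re]
    refine (Complex.re_le_norm _).trans ?_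
    rw [norm_neg]
    simp only [norm_mul, norm_div, norm_pow, Complex.norm_real, norm_norm, Complex.norm_ofNat,
      Real.norm_of_nonneg hħ.le]
    gcongr
  have : ‖x‖ ^ 2 / (2 * ħ) = 1 / (2 * ħ) * ‖x‖ ^ 2 := by ring
  linarith

/-- Half of the Gaussian pays for the linear term by completing the square; the other half is the
quadratic bound that `expSchwartz` needs. -/
theorem exists_coherentExponent_re_le' {ħ : ℝ} (hħ : 0 < ħ) (ζ : ℂ) (w : Conf d) :
    ∃ C : ℝ, ∀ x : Conf d,
      (coherentExponent ħ ζ w x).re ≤ C + (-2 * (1 / (8 * ħ))) * ‖x‖ ^ 2 := by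
  obtain ⟨C, hC⟩ := exists_coherentExponent_re_le hħ ‖ζ‖ w
  refine ⟨C + ħ * (‖ζ‖ * ‖w‖) ^ 2, fun x => (hC ζ le_rfl x).trans ?_⟩
  have : 0 ≤ (‖x‖ - 2 * ħ * (‖ζ‖ * ‖w‖)) ^ 2 / (4 * ħ) := by positivity
  have e : (‖x‖ - 2 * ħ * (‖ζ‖ * ‖w‖)) ^ 2 / (4 * ħ)
      = 1 / (4 * ħ) * ‖x‖ ^ 2 - ‖ζ‖ * ‖w‖ * ‖x‖ + ħ * (‖ζ‖ * ‖w‖) ^ 2 := by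
    field_simp; ring
  have e2 : 1 / (2 * ħ) * ‖x‖ ^ 2 = 1 / (4 * ħ) * ‖x‖ ^ 2 + 1 / (4 * ħ) * ‖x‖ ^ 2 := by
    field_simp; ring
  have e3 : (-2 * (1 / (8 * ħ))) * ‖x‖ ^ 2 = - (1 / (4 * ħ) * ‖x‖ ^ 2) := by
    field_simp; ring
  linarith

/-- The coherent states `exp(-‖x‖²/(2ħ) + ζ w·x - ħ ζ² ‖w‖²/4)`. -/
def coherent {ħ : ℝ} (hħ : 0 < ħ) (ζ : ℂ) (w : Conf d) : 𝓢(Conf d, ℂ) :=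
  expSchwartz (coherentExponent ħ ζ w) (coherentExponent_hasTemperateGrowth ħ ζ w)
    (exists_coherentExponent_re_le' hħ ζ w).choose (1 / (8 * ħ)) (by positivity)
    (exists_coherentExponent_re_le' hħ ζ w).choose_spec

theorem coherent_apply {ħ : ℝ} (hħ : 0 < ħ) (ζ : ℂ) (w x : Conf d) :
    coherent hħ ζ w x = Complex.exp (coherentExponent ħ ζ w x) := rfl

theorem coherent_conj {ħ : ℝ} (hħ : 0 < ħ) (ζ : ℂ) (w x : Conf d) :
    (starRingEnd ℂ) (coherent hħ ζ w x) = coherent hħ ((starRingEnd ℂ) ζ) w x := by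
  rw [coherent_apply, coherent_apply, ← Complex.exp_conj]
  congr 1
  simp [coherentExponent, Complex.conj_ofReal, Complex.conj_ofNat]

theorem hasDerivAt_coherentExponent_line (ħ : ℝ) (ζ : ℂ) (w x m : Conf d) :
    HasDerivAt (fun t : ℝ => coherentExponent ħ ζ w (x + t • m))
      (-((inner ℝ x m / ħ : ℝ) : ℂ) + ζ * (inner ℝ w m : ℝ)) 0 := by
  have h1 : HasDerivAt (fun t : ℝ => x + t • m) m 0 := by
    simpa using ((hasDerivAt_id (0 : ℝ)).smul_const m).const_add x
  have h2 : HasDerivAt (fun t : ℝ => ‖x + t • m‖ ^ 2) (2 * inner ℝ x m) 0 := by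
    simpa using h1.norm_sq
  have h3 : HasDerivAt (fun t : ℝ => (inner ℝ w (x + t • m) : ℝ)) (inner ℝ w m) 0 := by
    simpa using (hasDerivAt_const (0 : ℝ) w).inner ℝ h1
  have h4 := (((h2.div_const (2 * ħ)).ofReal_comp.neg).add (h3.ofReal_comp.const_mul ζ)).sub_const
    (ħ * ζ ^ 2 * (‖w‖ ^ 2 : ℝ) / 4 : ℂ)
  refine h4.congr_deriv ?_
  rw [mul_div_mul_left _ _ two_ne_zero]

open LineDeriv in
theorem lineDerivOp_coherent {ħ : ℝ} (hħ : 0 < ħ) (ζ : ℂ) (w m x : Conf d) :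
    (∂_{m} (coherent hħ ζ w)) x
      = (-((inner ℝ x m / ħ : ℝ) : ℂ) + ζ * (inner ℝ w m : ℝ)) * coherent hħ ζ w x := by
  rw [SchwartzMap.lineDerivOp_apply]
  refine HasDerivAt.deriv ?_
  have h := (hasDerivAt_coherentExponent_line ħ ζ w x m).cexp
  simp only [zero_smul, add_zero] at h
  exact h.congr_deriv (by rw [coherent_apply, mul_comm])

open LineDeriv in
theorem lineDerivOp_lineDerivOp_coherent {ħ : ℝ} (hħ : 0 < ħ) (ζ : ℂ) (w m x : Conf d) :
    (∂_{m} (∂_{m} (coherent hħ ζ w))) x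
      = ((-((inner ℝ x m / ħ : ℝ) : ℂ) + ζ * (inner ℝ w m : ℝ)) ^ 2 - ((‖m‖ ^ 2 / ħ : ℝ) : ℂ))
          * coherent hħ ζ w x := by
  have e : ⇑(∂_{m} (coherent hħ ζ w) : 𝓢(Conf d, ℂ)) = fun x =>
      (-((inner ℝ x m / ħ : ℝ) : ℂ) + ζ * (inner ℝ w m : ℝ)) * coherent hħ ζ w x :=
    funext fun x => lineDerivOp_coherent hħ ζ w m x
  rw [SchwartzMap.lineDerivOp_apply, e]
  refine HasDerivAt.deriv ?_
  have h1 : HasDerivAt (fun t : ℝ => x + t • m) m 0 := by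
    simpa using ((hasDerivAt_id (0 : ℝ)).smul_const m).const_add x
  have h2 : HasDerivAt (fun t : ℝ => (inner ℝ (x + t • m) m : ℝ)) (inner ℝ m m) 0 := by
    simpa using h1.inner ℝ (hasDerivAt_const (0 : ℝ) m)
  have h3 := ((h2.div_const ħ).ofReal_comp.neg).add_const (ζ * (inner ℝ w m : ℝ))
  have h4 := h3.mul (hasDerivAt_coherentExponent_line ħ ζ w x m).cexp
  simp only [zero_smul, add_zero] at h4
  refine h4.congr_deriv ?_
  simp only [coherent_apply, real_inner_self_eq_norm_sq, Pi.neg_apply, zero_smul, add_zero]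
  ring

/-- The oscillator acts on coherent states as `ħ (ζ ∂_ζ + d/2)`. -/
theorem oscillator_coherent {ħ : ℝ} (hħ : 0 < ħ) (ζ : ℂ) (w x : Conf d) :
    oscillator d ħ (coherent hħ ζ w) x
      = ħ * (ζ * ((inner ℝ w x : ℝ) - ħ * ζ * (‖w‖ ^ 2 : ℝ) / 2) + d / 2)
          * coherent hħ ζ w x := by
  have hne : (ħ : ℂ) ≠ 0 := by exact_mod_cast hħ.ne'
  set b := EuclideanSpace.basisFun (Fin d) ℝ
  have hx : ∑ i, ((inner ℝ x (b i) : ℝ) : ℂ) ^ 2 = ((‖x‖ ^ 2 : ℝ) : ℂ) := by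
    rw [← b.sum_sq_inner_right x]; push_cast; simp [real_inner_comm]
  have hw : ∑ i, ((inner ℝ w (b i) : ℝ) : ℂ) ^ 2 = ((‖w‖ ^ 2 : ℝ) : ℂ) := by
    rw [← b.sum_sq_inner_right w]; push_cast; simp [real_inner_comm]
  have hxw : ∑ i, ((inner ℝ w (b i) : ℝ) : ℂ) * ((inner ℝ x (b i) : ℝ) : ℂ)
      = ((inner ℝ w x : ℝ) : ℂ) := by
    rw [← b.sum_inner_mul_inner w x]; push_cast; simp [real_inner_comm]
  have hlap : Laplacian.laplacian (coherent hħ ζ w : Conf d → ℂ) x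
      = (((‖x‖ ^ 2 : ℝ) : ℂ) / ħ ^ 2 - 2 * ζ / ħ * ((inner ℝ w x : ℝ) : ℂ)
          + ζ ^ 2 * ((‖w‖ ^ 2 : ℝ) : ℂ) - d / ħ) * coherent hħ ζ w x := by
    rw [← SchwartzMap.laplacian_apply, SchwartzMap.laplacian_eq_sum b]
    simp only [sum_apply, lineDerivOp_lineDerivOp_coherent]
    rw [← Finset.sum_mul]
    congr 1
    rw [← hx, ← hw, ← hxw, Finset.sum_div, Finset.mul_sum, Finset.mul_sum,
      ← Finset.sum_sub_distrib, ← Finset.sum_add_distrib]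
    have hd : (d : ℂ) / ħ = ∑ i : Fin d, (1 : ℂ) / ħ := by simp [div_eq_mul_inv]
    rw [hd, ← Finset.sum_sub_distrib]
    refine Finset.sum_congr rfl fun i _ => ?_
    have : ‖b i‖ = 1 := b.norm_eq_one i
    rw [this]
    push_cast
    field_simp
    ring
  rw [oscillator_apply, hlap]
  push_cast
  field_simp
  ring

/-- The Gaussian is the modulus of the coherent state with ζ = 0 and ħ = 1/(2δ), hence of a Schwartz
function. -/
theorem memLp_gaussian {δ : ℝ} (hδ : 0 < δ) (p : ENNReal) :
    MemLp (fun x : Conf d => Real.exp (-δ * ‖x‖ ^ 2)) p := by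
  have h := ((coherent (d := d) (ħ := 1 / (2 * δ)) (by positivity) 0 0).memLp p volume).norm
  refine h.ae_eq (Filter.Eventually.of_forall fun x => ?_)
  simp only [coherent_apply, Complex.norm_exp, coherentExponent_re]
  congr 1
  simp
  field_simp

theorem integrable_gaussian {δ : ℝ} (hδ : 0 < δ) :
    Integrable (fun x : Conf d => Real.exp (-δ * ‖x‖ ^ 2)) :=
  memLp_one_iff_integrable.1 (memLp_gaussian hδ 1)

theorem integrable_gaussian_mul_norm {δ : ℝ} (hδ : 0 < δ) {f : Conf d → ℂ} (hf : MemLp f 2) :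
    Integrable (fun x : Conf d => Real.exp (-δ * ‖x‖ ^ 2) * ‖f x‖) :=
  (memLp_gaussian hδ 2).integrable_mul hf.norm

theorem integrable_coherent_mul {ħ : ℝ} (hħ : 0 < ħ) (ζ : ℂ) (w : Conf d) {f : Conf d → ℂ}
    (hf : MemLp f 2) : Integrable (fun x => coherent hħ ζ w x * f x) :=
  ((coherent hħ ζ w).memLp 2).integrable_mul hf

/-- Uniform Gaussian bound for the coherent states with parameter in a disc, with a linear factor
to spare. -/
theorem exists_norm_coherent_le {ħ : ℝ} (hħ : 0 < ħ) (R : ℝ) (w : Conf d) :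
    ∃ C : ℝ, 0 ≤ C ∧ ∀ ζ : ℂ, ‖ζ‖ ≤ R → ∀ x : Conf d,
      (1 + ‖x‖) * ‖coherent hħ ζ w x‖ ≤ C * Real.exp (-(1 / (4 * ħ)) * ‖x‖ ^ 2) := by
  obtain ⟨C₁, hC₁⟩ := exists_coherentExponent_re_le hħ R w
  obtain ⟨C₂, hC₂, h₂⟩ := one_add_pow_mul_exp_le 1 (δ := 1 / (4 * ħ)) (by positivity) (R * ‖w‖)
  refine ⟨Real.exp C₁ * C₂, by positivity, fun ζ hζ x => ?_⟩
  have h := h₂ ‖x‖ (norm_nonneg x)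
  rw [coherent_apply, Complex.norm_exp]
  calc (1 + ‖x‖) * Real.exp (coherentExponent ħ ζ w x).re
      ≤ (1 + ‖x‖) * Real.exp (C₁ + R * ‖w‖ * ‖x‖ - 1 / (2 * ħ) * ‖x‖ ^ 2) := by
        gcongr; exact hC₁ ζ hζ x
    _ = Real.exp C₁ * ((1 + ‖x‖) ^ 1
          * Real.exp (R * ‖w‖ * ‖x‖ - 2 * (1 / (4 * ħ)) * ‖x‖ ^ 2)) := by
        rw [add_sub_assoc, Real.exp_add, pow_one]
        have : 2 * (1 / (4 * ħ)) = 1 / (2 * ħ) := by field_simp; norm_num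
        rw [this]; ring
    _ ≤ Real.exp C₁ * (C₂ * Real.exp (-(1 / (4 * ħ)) * ‖x‖ ^ 2)) := by gcongr
    _ = _ := by ring

/-! ### The coherent state transform and Euler's equation -/

/-- The coherent state transform of `f`. -/
def coherentPairing {ħ : ℝ} (hħ : 0 < ħ) (w : Conf d) (f : Conf d → ℂ) (ζ : ℂ) : ℂ :=
  ∫ x, coherent hħ ζ w x * f x

/-- The derivative of the coherent state transform. -/
def coherentPairingDeriv {ħ : ℝ} (hħ : 0 < ħ) (w : Conf d) (f : Conf d → ℂ) (ζ : ℂ) : ℂ :=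
  ∫ x, ((inner ℝ w x : ℝ) - ħ * ζ * (‖w‖ ^ 2 : ℝ) / 2) * coherent hħ ζ w x * f x

theorem hasDerivAt_coherentExponent (ħ : ℝ) (ζ : ℂ) (w x : Conf d) :
    HasDerivAt (fun ζ => coherentExponent ħ ζ w x)
      ((inner ℝ w x : ℝ) - ħ * ζ * (‖w‖ ^ 2 : ℝ) / 2) ζ := by
  have h1 := ((hasDerivAt_id ζ).mul_const ((inner ℝ w x : ℝ) : ℂ)).const_add
    (-(‖x‖ ^ 2 / (2 * ħ) : ℝ) : ℂ)
  have h2 := (((hasDerivAt_id ζ).pow 2).const_mul (ħ : ℂ)).mul_const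
    (((‖w‖ ^ 2 : ℝ) : ℂ) / 4)
  have h3 := h1.sub h2
  convert! h3 using 1
  · ext ζ
    simp [coherentExponent]
    ring
  · simp
    ring

/-- Differentiation under the integral sign: on the unit disc about ζ the derivative is O(1 + ‖x‖)
times a coherent state, which a fixed Gaussian absorbs, and a Gaussian times `f` is integrable by
Cauchy–Schwarz. -/
theorem integrable_deriv_and_hasDerivAt_coherentPairing {ħ : ℝ} (hħ : 0 < ħ) (w : Conf d)
    {f : Conf d → ℂ} (hf : MemLp f 2) (ζ : ℂ) :
    Integrable (fun x => ((inner ℝ w x : ℝ) - ħ * ζ * (‖w‖ ^ 2 : ℝ) / 2)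
        * coherent hħ ζ w x * f x) ∧
      HasDerivAt (coherentPairing hħ w f) (coherentPairingDeriv hħ w f ζ) ζ := by
  obtain ⟨C, hC, hCle⟩ := exists_norm_coherent_le hħ (‖ζ‖ + 1) w
  set A : ℝ := ‖w‖ + ħ * (‖ζ‖ + 1) * ‖w‖ ^ 2 / 2
  have hA : 0 ≤ A := by positivity
  refine hasDerivAt_integral_of_dominated_loc_of_deriv_le (s := Metric.ball ζ 1)
    (F := fun ζ x => coherent hħ ζ w x * f x)
    (F' := fun ζ x => ((inner ℝ w x : ℝ) - ħ * ζ * (‖w‖ ^ 2 : ℝ) / 2) * coherent hħ ζ w x * f x)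
    (bound := fun x => A * C * (Real.exp (-(1 / (4 * ħ)) * ‖x‖ ^ 2) * ‖f x‖))
    (Metric.ball_mem_nhds ζ one_pos)
    (Filter.Eventually.of_forall fun ζ => (integrable_coherent_mul hħ ζ w hf).1)
    (integrable_coherent_mul hħ ζ w hf) ?_ ?_
    ((integrable_gaussian_mul_norm (by positivity) hf).const_mul _) ?_
  · refine AEStronglyMeasurable.mul ?_ hf.1
    refine Continuous.aestronglyMeasurable ?_
    have := (coherent hħ ζ w).continuous
    fun_prop
  · refine Filter.Eventually.of_forall fun x ζ' hζ' => ?_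
    have hn : ‖ζ'‖ ≤ ‖ζ‖ + 1 := by
      have := norm_sub_norm_le ζ' ζ
      rw [Metric.mem_ball, dist_eq_norm] at hζ'
      linarith
    have h1 : ‖((inner ℝ w x : ℝ) - ħ * ζ' * (‖w‖ ^ 2 : ℝ) / 2 : ℂ)‖ ≤ A * (1 + ‖x‖) := by
      have h2 : ‖((inner ℝ w x : ℝ) : ℂ)‖ ≤ ‖w‖ * ‖x‖ := by
        rw [Complex.norm_real]; exact norm_inner_le_norm w x
      have h3 : ‖(ħ * ζ' * (‖w‖ ^ 2 : ℝ) / 2 : ℂ)‖ ≤ ħ * (‖ζ‖ + 1) * ‖w‖ ^ 2 / 2 := by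
        simp only [norm_mul, norm_div, Complex.norm_real, norm_pow, norm_norm, Complex.norm_ofNat,
          Real.norm_of_nonneg hħ.le]
        gcongr
      have h4 : A * (1 + ‖x‖) = ‖w‖ * ‖x‖ + ħ * (‖ζ‖ + 1) * ‖w‖ ^ 2 / 2
          + (‖w‖ + ħ * (‖ζ‖ + 1) * ‖w‖ ^ 2 / 2 * ‖x‖) := by simp only [A]; ring
      have h5 : 0 ≤ ‖w‖ + ħ * (‖ζ‖ + 1) * ‖w‖ ^ 2 / 2 * ‖x‖ := by positivity
      have := norm_sub_le ((inner ℝ w x : ℝ) : ℂ) (ħ * ζ' * (‖w‖ ^ 2 : ℝ) / 2 : ℂ)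
      linarith
    rw [norm_mul, norm_mul]
    calc _ ≤ A * (1 + ‖x‖) * ‖coherent hħ ζ' w x‖ * ‖f x‖ := by gcongr
      _ = A * ((1 + ‖x‖) * ‖coherent hħ ζ' w x‖) * ‖f x‖ := by ring
      _ ≤ A * (C * Real.exp (-(1 / (4 * ħ)) * ‖x‖ ^ 2)) * ‖f x‖ := by
        have := hCle ζ' hn x
        refine mul_le_mul_of_nonneg_right (mul_le_mul_of_nonneg_left this hA) (norm_nonneg _)
      _ = _ := by ring
  · refine Filter.Eventually.of_forall fun x ζ' _ => ?_
    refine HasDerivAt.mul_const ?_ (f x)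
    exact ((hasDerivAt_coherentExponent ħ ζ' w x).cexp).congr_deriv
      (by rw [coherent_apply, mul_comm])

theorem hasDerivAt_coherentPairing {ħ : ℝ} (hħ : 0 < ħ) (w : Conf d)
    {f : Conf d → ℂ} (hf : MemLp f 2) (ζ : ℂ) :
    HasDerivAt (coherentPairing hħ w f) (coherentPairingDeriv hħ w f ζ) ζ :=
  (integrable_deriv_and_hasDerivAt_coherentPairing hħ w hf ζ).2

theorem integral_oscillator_coherent_mul {ħ : ℝ} (hħ : 0 < ħ) (w : Conf d)
    {f : Conf d → ℂ} (hf : MemLp f 2) (ζ : ℂ) :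
    ∫ x, oscillator d ħ (coherent hħ ζ w) x * f x
      = ħ * (ζ * coherentPairingDeriv hħ w f ζ + d / 2 * coherentPairing hħ w f ζ) := by
  have h := (integrable_deriv_and_hasDerivAt_coherentPairing hħ w hf ζ).1
  rw [coherentPairingDeriv, coherentPairing, ← integral_const_mul, ← integral_const_mul,
    ← integral_add (h.const_mul _) ((integrable_coherent_mul hħ ζ w hf).const_mul _),
    ← integral_const_mul]
  refine integral_congr_ae (Filter.Eventually.of_forall fun x => ?_)
  simp only [oscillator_coherent]
  ring

theorem inner_toLp_eq (φ : 𝓢(Conf d, ℂ)) (f : L2 d) :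
    inner ℂ (φ.toLp 2) f = ∫ x, (starRingEnd ℂ) (φ x) * f x := by
  rw [L2.inner_def]
  refine integral_congr_ae ?_
  filter_upwards [φ.coeFn_toLp 2] with x hx
  rw [hx, RCLike.inner_apply, mul_comm]

theorem oscillator_conj {ħ : ℝ} (hħ : 0 < ħ) (ζ : ℂ) (w x : Conf d) :
    (starRingEnd ℂ) (oscillator d ħ (coherent hħ ((starRingEnd ℂ) ζ) w) x)
      = oscillator d ħ (coherent hħ ζ w) x := by
  rw [oscillator_coherent, oscillator_coherent, map_mul, coherent_conj]
  simp [Complex.conj_ofReal, Complex.conj_ofNat]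

/-- On an eigenspace, the coherent state transform satisfies Euler's equation. -/
theorem euler_of_mem_eigenspace {ħ : ℝ} (hħ : 0 < ħ) {N : ℕ} {ψ : L2 d}
    (hψ : ψ ∈ eigenspace d ħ (eigenvalue d ħ N)) (w : Conf d) (ζ : ℂ) :
    ζ * coherentPairingDeriv hħ w ψ ζ = N * coherentPairing hħ w ψ ζ := by
  -- The inner product conjugates its first slot, so testing at the conjugate of ζ yields the
  -- bilinear pairing at ζ.
  have h := hψ (coherent hħ ((starRingEnd ℂ) ζ) w)
  rw [inner_toLp_eq, inner_toLp_eq] at h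
  simp only [oscillator_conj, coherent_conj, starRingEnd_self_apply] at h
  rw [integral_oscillator_coherent_mul hħ w (Lp.memLp ψ)] at h
  have hne : (ħ : ℂ) ≠ 0 := by exact_mod_cast hħ.ne'
  have h2 : (ħ : ℂ) * (ζ * coherentPairingDeriv hħ w ψ ζ)
      = ħ * (N * coherentPairing hħ w ψ ζ) := by
    have : (eigenvalue d ħ N : ℂ) * ∫ x, coherent hħ ζ w x * ψ x
      = ħ * (N + d / 2) * coherentPairing hħ w ψ ζ := by
      simp [eigenvalue, coherentPairing]
    rw [this] at h
    linear_combination h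
  exact mul_left_cancel₀ hne h2

/-- A solution of Euler's equation away from the origin is homogeneous. -/
theorem eq_pow_mul_of_euler {Q Q' : ℂ → ℂ} (hQ : ∀ z, HasDerivAt Q (Q' z) z) (N : ℕ)
    (h : ∀ z, z * Q' z = N * Q z) {z ζ : ℂ} (hz : z ≠ 0) (hζ : ζ ≠ 0) :
    Q (z * ζ) = z ^ N * Q ζ := by
  have hopen : IsOpen ({0}ᶜ : Set ℂ) := isOpen_compl_singleton
  -- Q z / z^N has derivative zero on the punctured plane, which is connected, so it is constant
  -- there.
  have hconn : IsPreconnected ({0}ᶜ : Set ℂ) := by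
    refine (isConnected_compl_singleton_of_one_lt_rank ?_ (0 : ℂ)).isPreconnected
    simp [Complex.rank_real_complex]
  have hd : ∀ z ∈ ({0}ᶜ : Set ℂ), HasDerivAt (fun z => Q z / z ^ N) 0 z := by
    intro z hz
    have hz' : z ≠ 0 := hz
    refine ((hQ z).div (hasDerivAt_pow N z) (pow_ne_zero N hz')).congr_deriv ?_
    -- The derivative of z^N involves the truncated exponent N - 1, so N = 0 is separate.
    rcases N with _ | n
    · have := h z
      simp only [Nat.cast_zero, zero_mul, mul_eq_zero, hz', false_or] at this
      simp [this]
    · have := h z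
      rw [div_eq_zero_iff]
      left
      simp only [Nat.add_sub_cancel]
      rw [pow_succ]
      linear_combination z ^ n * this
  have hconst := hopen.is_const_of_deriv_eq_zero hconn
    (fun z hz => (hd z hz).differentiableAt.differentiableWithinAt)
    (fun z hz => (hd z hz).deriv) (x := z * ζ) (y := ζ) (mul_ne_zero hz hζ) hζ
  rw [div_eq_div_iff (pow_ne_zero N (mul_ne_zero hz hζ)) (pow_ne_zero N hζ), mul_pow] at hconst
  have : ζ ^ N ≠ 0 := pow_ne_zero N hζ
  apply mul_right_cancel₀ this
  linear_combination hconst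

/-! ### Symmetry of the oscillator and totality of coherent states -/

/-- The oscillator is symmetric for the bilinear pairing of Schwartz functions. -/
theorem integral_mul_oscillator (ħ : ℝ) (φ χ : 𝓢(Conf d, ℂ)) :
    ∫ x, φ x * oscillator d ħ χ x = ∫ x, oscillator d ħ φ x * χ x := by
  have hΔ : ∫ x, φ x * (Laplacian.laplacian χ : 𝓢(Conf d, ℂ)) x
      = ∫ x, (Laplacian.laplacian φ : 𝓢(Conf d, ℂ)) x * χ x :=
    SchwartzMap.integral_mul_laplacian_right_eq_left φ χ
  have hint : ∀ φ χ : 𝓢(Conf d, ℂ), Integrable (fun x => φ x * χ x) := fun φ χ =>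
    (φ.memLp 2).integrable_mul (χ.memLp 2)
  set Wφ := SchwartzMap.smulLeftCLM ℂ (fun x : Conf d => ‖x‖ ^ 2) φ
  set Wχ := SchwartzMap.smulLeftCLM ℂ (fun x : Conf d => ‖x‖ ^ 2) χ
  have hW : ∀ x, φ x * Wχ x = Wφ x * χ x := by
    intro x
    simp only [Wφ, Wχ, SchwartzMap.smulLeftCLM_apply_apply (F := ℂ)
      (Function.hasTemperateGrowth_norm_sq (H := Conf d)), Complex.real_smul]
    ring
  have h1 : ∫ x, φ x * oscillator d ħ χ x
      = -((ħ : ℂ) ^ 2 / 2) * (∫ x, φ x * (Laplacian.laplacian χ : 𝓢(Conf d, ℂ)) x)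
        + 1 / 2 * ∫ x, φ x * Wχ x := by
    rw [← integral_const_mul, ← integral_const_mul,
      ← integral_add ((hint _ _).const_mul _) ((hint _ _).const_mul _)]
    refine integral_congr_ae (Filter.Eventually.of_forall fun x => ?_)
    simp only [oscillator, add_apply, smul_apply, smul_eq_mul, Wχ]
    ring
  have h2 : ∫ x, oscillator d ħ φ x * χ x
      = -((ħ : ℂ) ^ 2 / 2) * (∫ x, (Laplacian.laplacian φ : 𝓢(Conf d, ℂ)) x * χ x)
        + 1 / 2 * ∫ x, Wφ x * χ x := by
    rw [← integral_const_mul, ← integral_const_mul,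
      ← integral_add ((hint _ _).const_mul _) ((hint _ _).const_mul _)]
    refine integral_congr_ae (Filter.Eventually.of_forall fun x => ?_)
    simp only [oscillator, add_apply, smul_apply, smul_eq_mul, Wφ]
    ring
  rw [h1, h2, hΔ]
  simp only [hW]

open FourierTransform in
/-- An integrable function with vanishing Fourier transform is zero. -/
theorem ae_eq_zero_of_fourier_eq_zero {h : Conf d → ℂ} (hh : Integrable h)
    (hF : ∀ ξ, 𝓕 h ξ = 0) : h =ᵐ[volume] 0 := by
  refine ae_eq_zero_of_integral_contDiff_smul_eq_zero hh.locallyIntegrable fun g hg hgs => ?_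
  have hgs' : HasCompactSupport (fun x => (g x : ℂ)) := hgs.comp_left (g := Complex.ofReal) (by simp)
  set χ : 𝓢(Conf d, ℂ) := hgs'.toSchwartzMap (Complex.ofRealCLM.contDiff.comp hg)
  have hχ : ∀ x, χ x = g x := fun x => rfl
  -- The test function is the Fourier transform of a Schwartz function; moving that transform onto
  -- `h` makes the pairing vanish.
  have h1 := VectorFourier.integral_fourierIntegral_smul_eq_flip (L := innerₗ (Conf d))
    (μ := volume) (ν := volume) Real.continuous_fourierChar continuous_inner hh
    (𝓕⁻ χ : 𝓢(Conf d, ℂ)).integrable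
  have h2 : ∀ x, VectorFourier.fourierIntegral Real.fourierChar volume (innerₗ (Conf d)).flip
      (𝓕⁻ χ : 𝓢(Conf d, ℂ)) x = g x := by
    intro x
    rw [flip_innerₗ, ← hχ]
    have : (𝓕 (𝓕⁻ χ : 𝓢(Conf d, ℂ)) : 𝓢(Conf d, ℂ)) = χ := FourierTransform.fourier_fourierInv_eq χ
    calc _ = 𝓕 ((𝓕⁻ χ : 𝓢(Conf d, ℂ)) : Conf d → ℂ) x := rfl
      _ = (𝓕 (𝓕⁻ χ : 𝓢(Conf d, ℂ)) : 𝓢(Conf d, ℂ)) x := by rw [SchwartzMap.fourier_coe]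
      _ = _ := by rw [this]
  have h3 : ∀ ξ, VectorFourier.fourierIntegral Real.fourierChar volume (innerₗ (Conf d)) h ξ = 0 :=
    hF
  simp only [h2, h3, zero_smul, integral_zero] at h1
  rw [h1]
  refine integral_congr_ae (Filter.Eventually.of_forall fun x => ?_)
  simp [mul_comm]

/-- The coherent states with parameter `i` are total in `L²`. -/
theorem ae_eq_zero_of_coherentPairing_eq_zero {ħ : ℝ} (hħ : 0 < ħ) {f : Conf d → ℂ}
    (hf : MemLp f 2) (h0 : ∀ w, coherentPairing hħ w f Complex.I = 0) : f =ᵐ[volume] 0 := by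
  set h : Conf d → ℂ := fun x => coherent hħ 0 0 x * f x
  have hF : ∀ ξ, FourierTransform.fourier h ξ = 0 := by
    intro ξ
    -- At ζ = i and w = -2πξ the coherent state is, up to a constant, the fixed Gaussian times the
    -- Fourier character at ξ.
    have h1 := h0 (-(2 * Real.pi) • ξ)
    rw [Real.fourier_eq']
    have : ∀ x, Complex.exp (((-2 * Real.pi * inner ℝ x ξ : ℝ) : ℂ) * Complex.I) • h x
        = Complex.exp (-(ħ * (‖(-(2 * Real.pi) • ξ : Conf d)‖ ^ 2 : ℝ) / 4))
          * (coherent hħ Complex.I (-(2 * Real.pi) • ξ) x * f x) := by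
      intro x
      simp only [h, coherent_apply, smul_eq_mul, ← mul_assoc, ← Complex.exp_add]
      congr 2
      simp only [coherentExponent, inner_smul_left, Complex.I_sq, norm_zero, inner_zero_left]
      rw [real_inner_comm]
      push_cast
      simp
      ring
    simp only [this]
    rw [integral_const_mul]
    rw [coherentPairing] at h1
    rw [h1, mul_zero]
  have hz := ae_eq_zero_of_fourier_eq_zero (integrable_coherent_mul hħ 0 0 hf) hF
  filter_upwards [hz] with x hx
  have : coherent hħ 0 0 x * f x = 0 := hx
  rcases mul_eq_zero.1 this with h | h
  · exact absurd h (Complex.exp_ne_zero _)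
  · exact h

/-! ### Taylor coefficients as means over a circle -/

/-- The `N`-th Taylor coefficient of `Q`, as a mean over the circle of radius `r`. -/
def taylorCoeff (r : ℝ) (N : ℕ) (Q : ℂ → ℂ) : ℂ :=
  (2 * Real.pi : ℂ)⁻¹ * ∫ θ in (0 : ℝ)..2 * Real.pi, Q (circleMap 0 r θ) / circleMap 0 r θ ^ N

theorem norm_circleMap_zero' {r : ℝ} (hr : 0 < r) (θ : ℝ) : ‖circleMap 0 r θ‖ = r := by
  rw [norm_circleMap_zero, abs_of_pos hr]

theorem circleMap_ne_zero' {r : ℝ} (hr : 0 < r) (θ : ℝ) : circleMap 0 r θ ≠ 0 := by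
  rw [← norm_pos_iff, norm_circleMap_zero' hr]; exact hr

theorem taylorCoeff_congr {r : ℝ} (hr : 0 < r) (N : ℕ) {Q₁ Q₂ : ℂ → ℂ}
    (h : ∀ z, ‖z‖ = r → Q₁ z = Q₂ z) : taylorCoeff r N Q₁ = taylorCoeff r N Q₂ := by
  simp only [taylorCoeff, h _ (norm_circleMap_zero' hr _)]

theorem taylorCoeff_const_mul (r : ℝ) (N : ℕ) (Q : ℂ → ℂ) (c : ℂ) :
    taylorCoeff r N (fun z => c * Q z) = c * taylorCoeff r N Q := by
  simp only [taylorCoeff, mul_div_assoc, intervalIntegral.integral_const_mul]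
  ring

theorem continuous_circle_div {r : ℝ} (hr : 0 < r) (N : ℕ) {Q : ℂ → ℂ}
    (hQ : Continuous fun θ => Q (circleMap 0 r θ)) :
    Continuous fun θ => Q (circleMap 0 r θ) / circleMap 0 r θ ^ N :=
  hQ.div ((continuous_circleMap 0 r).pow N) fun θ => pow_ne_zero N (circleMap_ne_zero' hr θ)

theorem taylorCoeff_add {r : ℝ} (hr : 0 < r) (N : ℕ) {Q₁ Q₂ : ℂ → ℂ}
    (h₁ : Continuous fun θ => Q₁ (circleMap 0 r θ))
    (h₂ : Continuous fun θ => Q₂ (circleMap 0 r θ)) :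
    taylorCoeff r N (fun z => Q₁ z + Q₂ z) = taylorCoeff r N Q₁ + taylorCoeff r N Q₂ := by
  simp only [taylorCoeff, add_div]
  rw [intervalIntegral.integral_add
    ((continuous_circle_div hr N h₁).intervalIntegrable _ _)
    ((continuous_circle_div hr N h₂).intervalIntegrable _ _), mul_add]

theorem taylorCoeff_const_mul_pow {r : ℝ} (hr : 0 < r) (N : ℕ) (c : ℂ) :
    taylorCoeff r N (fun z => z ^ N * c) = c := by
  have : ∀ θ, circleMap 0 r θ ^ N * c / circleMap 0 r θ ^ N = c := fun θ =>
    mul_div_cancel_left₀ _ (pow_ne_zero N (circleMap_ne_zero' hr θ))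
  simp only [taylorCoeff, this, intervalIntegral.integral_const]
  simp
  field_simp

/-- The Euler operator multiplies the `N`-th Taylor coefficient by `N`. -/
theorem taylorCoeff_euler {r : ℝ} (hr : 0 < r) (N : ℕ) {Q Q' : ℂ → ℂ}
    (hQ : ∀ z, HasDerivAt Q (Q' z) z) (hQ' : Continuous Q') :
    taylorCoeff r N (fun z => z * Q' z) = N * taylorCoeff r N Q := by
  have hc : ∀ θ, circleMap 0 r θ ≠ 0 := circleMap_ne_zero' hr
  have hQc : Continuous Q := continuous_iff_continuousAt.2 fun z => (hQ z).continuousAt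
  have h1 : Continuous fun θ => circleMap 0 r θ * Q' (circleMap 0 r θ) / circleMap 0 r θ ^ N :=
    continuous_circle_div hr N (Q := fun z => z * Q' z)
      ((continuous_circleMap 0 r).mul (hQ'.comp (continuous_circleMap 0 r)))
  have h2 : Continuous fun θ => Q (circleMap 0 r θ) / circleMap 0 r θ ^ N :=
    continuous_circle_div hr N (hQc.comp (continuous_circleMap 0 r))
  have h6 : Continuous fun θ => (N : ℂ) * (Q (circleMap 0 r θ) / circleMap 0 r θ ^ N) :=
    continuous_const.mul h2
  -- This derivative integrates to zero by periodicity, which is the identity to be shown.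
  have hder : ∀ θ : ℝ, HasDerivAt (fun θ => Q (circleMap 0 r θ) / circleMap 0 r θ ^ N)
      (Complex.I * (circleMap 0 r θ * Q' (circleMap 0 r θ) / circleMap 0 r θ ^ N
        - N * (Q (circleMap 0 r θ) / circleMap 0 r θ ^ N))) θ := by
    intro θ
    have h3 := (hasDerivAt_circleMap 0 r θ)
    have h4 := ((hQ (circleMap 0 r θ)).comp θ h3).div (h3.pow N) (pow_ne_zero N (hc θ))
    refine h4.congr_deriv ?_
    have := hc θ
    simp only [Pi.pow_apply, Function.comp_apply]
    rcases N with _ | n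
    · simp; ring
    · simp only [Nat.add_sub_cancel]
      field_simp
      ring
  have h5 := intervalIntegral.integral_eq_sub_of_hasDerivAt (a := 0) (b := 2 * Real.pi)
    (fun θ _ => hder θ)
    ((continuous_const.mul (h1.sub h6)).intervalIntegrable _ _)
  have hper : circleMap 0 r (2 * Real.pi) = circleMap 0 r 0 := by
    simpa using (periodic_circleMap 0 r) 0
  rw [hper, sub_self, intervalIntegral.integral_const_mul,
    intervalIntegral.integral_sub (h1.intervalIntegrable _ _)
      (h6.intervalIntegrable _ _),
    intervalIntegral.integral_const_mul, mul_eq_zero, or_iff_right Complex.I_ne_zero,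
    sub_eq_zero] at h5
  simp only [taylorCoeff, h5]
  ring

/-- Taylor coefficients commute with dominated integrals. -/
theorem integral_taylorCoeff {X : Type*} [MeasurableSpace X] {ν : Measure X} [SFinite ν]
    {r : ℝ} (hr : 0 < r) (N : ℕ) {F : ℂ → X → ℂ} {B : X → ℝ}
    (hmeas : AEStronglyMeasurable (fun p : X × ℝ => F (circleMap 0 r p.2) p.1)
      (ν.prod (volume.restrict (Set.Ioc 0 (2 * Real.pi)))))
    (hB : Integrable B ν) (hbound : ∀ z, ‖z‖ = r → ∀ x, ‖F z x‖ ≤ B x) :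
    ∫ x, taylorCoeff r N (fun z => F z x) ∂ν = taylorCoeff r N (fun z => ∫ x, F z x ∂ν) := by
  have h2 : (0 : ℝ) ≤ 2 * Real.pi := by positivity
  simp only [taylorCoeff, intervalIntegral.integral_of_le h2]
  rw [integral_const_mul, integral_integral_swap]
  · congr 1
    refine integral_congr_ae (Filter.Eventually.of_forall fun θ => ?_)
    simp only
    rw [integral_div]
  · have hb : Integrable (fun p : X × ℝ => B p.1 * (r ^ N)⁻¹)
        (ν.prod (volume.restrict (Set.Ioc 0 (2 * Real.pi)))) :=
      hB.mul_prod (integrable_const _)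
    refine hb.mono' ?_ (Filter.Eventually.of_forall fun p => ?_)
    · have : Continuous fun p : ℝ => (circleMap 0 r p ^ N)⁻¹ :=
        ((continuous_circleMap 0 r).pow N).inv₀ fun θ => pow_ne_zero N (circleMap_ne_zero' hr θ)
      have h3 : AEStronglyMeasurable (fun p : X × ℝ => (circleMap 0 r p.2 ^ N)⁻¹)
          (ν.prod (volume.restrict (Set.Ioc 0 (2 * Real.pi)))) :=
        (this.measurable.comp measurable_snd).aestronglyMeasurable
      exact hmeas.mul h3
    · simp only [Function.uncurry, div_eq_mul_inv, norm_mul, norm_inv, norm_pow,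
        norm_circleMap_zero' hr]
      gcongr
      exact hbound _ (norm_circleMap_zero' hr _) _

/-! ### The Mehler kernel -/

/-- The prefactor of the Mehler kernel. -/
def mehlerFactor (d : ℕ) (ħ : ℝ) (z : ℂ) : ℂ := (Real.pi * ħ * (1 - z ^ 2)) ^ (-(d / 2 : ℂ))

/-- The Mehler kernel. -/
def mehler {d : ℕ} (ħ : ℝ) (z : ℂ) (x y : Conf d) : ℂ :=
  mehlerFactor d ħ z * Complex.exp (-(1 / (4 * ħ)) *
    ((1 - z) / (1 + z) * (‖x + y‖ ^ 2 : ℝ) + (1 + z) / (1 - z) * (‖x - y‖ ^ 2 : ℝ)))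

theorem one_add_ne_zero_of_norm_lt_one {z : ℂ} (hz : ‖z‖ < 1) : 1 + z ≠ 0 := by
  intro h
  have : z = -1 := by linear_combination h
  simp [this] at hz

theorem one_sub_ne_zero_of_norm_lt_one {z : ℂ} (hz : ‖z‖ < 1) : 1 - z ≠ 0 := by
  intro h
  have : z = 1 := by linear_combination -h
  simp [this] at hz

theorem one_sub_sq_re_pos {z : ℂ} (hz : ‖z‖ < 1) : 0 < (1 - z ^ 2).re := by
  have h1 : (z ^ 2).re ≤ ‖z ^ 2‖ := Complex.re_le_norm _
  rw [norm_pow] at h1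
  have h2 : ‖z‖ ^ 2 < 1 := by nlinarith [norm_nonneg z]
  simp only [Complex.sub_re, Complex.one_re]
  linarith

/-- On the unit disc 1 - z² has positive real part, so the principal branch in `mehlerFactor` is
continuous and commutes with conjugation. -/
theorem mehlerBase_mem_slitPlane {ħ : ℝ} (hħ : 0 < ħ) {z : ℂ} (hz : ‖z‖ < 1) :
    (Real.pi * ħ * (1 - z ^ 2) : ℂ) ∈ Complex.slitPlane := by
  left
  rw [← Complex.ofReal_mul, Complex.re_ofReal_mul]
  exact mul_pos (mul_pos Real.pi_pos hħ) (one_sub_sq_re_pos hz)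

/-- The real part equals (1 - r²)/|1 + z|², and |1 + z| ≤ 1 + r on the circle. -/
theorem le_re_cayley {r : ℝ} {z : ℂ} (hz : ‖z‖ = r) (hr1 : r < 1) :
    (1 - r) / (1 + r) ≤ ((1 - z) / (1 + z)).re := by
  have hr : 0 ≤ r := hz ▸ norm_nonneg z
  have hsq : z.re ^ 2 + z.im ^ 2 = r ^ 2 := by
    rw [← hz, ← Complex.normSq_eq_norm_sq, Complex.normSq_apply]; ring
  have hre : z.re ≤ r := hz ▸ Complex.re_le_norm z
  have hne := one_add_ne_zero_of_norm_lt_one (hz ▸ hr1)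
  have hpos : 0 < Complex.normSq (1 + z) := Complex.normSq_pos.2 hne
  have hn : Complex.normSq (1 + z) = 1 + 2 * z.re + r ^ 2 := by
    rw [Complex.normSq_apply, ← hsq]; simp; ring
  rw [Complex.div_re, ← add_div, hn, div_le_div_iff₀ (by linarith) (hn ▸ hpos)]
  simp only [Complex.sub_re, Complex.one_re, Complex.add_re, Complex.sub_im, Complex.one_im,
    Complex.add_im, zero_sub, zero_add]
  have e : (1 - z.re) * (1 + z.re) + -z.im * z.im = 1 - r ^ 2 := by rw [← hsq]; ring
  rw [e]
  nlinarith [mul_nonneg (sub_nonneg.2 hre) (sub_nonneg.2 hr1.le)]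

theorem le_re_cayley' {r : ℝ} {z : ℂ} (hz : ‖z‖ = r) (hr1 : r < 1) :
    (1 - r) / (1 + r) ≤ ((1 + z) / (1 - z)).re := by
  have := le_re_cayley (z := -z) (by rwa [norm_neg]) hr1
  simpa [sub_eq_add_neg] using this

theorem exists_norm_mehlerFactor_le {ħ : ℝ} (hħ : 0 < ħ) {r : ℝ} (hr1 : r < 1) (d : ℕ) :
    ∃ C : ℝ, 0 ≤ C ∧ ∀ z : ℂ, ‖z‖ = r → ‖mehlerFactor d ħ z‖ ≤ C := by
  have hc : ContinuousOn (mehlerFactor d ħ) (Metric.sphere 0 r) := by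
    intro z hz
    have hz' : ‖z‖ < 1 := by rw [mem_sphere_zero_iff_norm] at hz; linarith
    refine ContinuousAt.continuousWithinAt ?_
    refine ContinuousAt.cpow (by fun_prop) continuousAt_const (mehlerBase_mem_slitPlane hħ hz')
  obtain ⟨C, hC⟩ := (isCompact_sphere (0 : ℂ) r).exists_bound_of_continuousOn hc
  exact ⟨|C|, abs_nonneg C, fun z hz =>
    (hC z (mem_sphere_zero_iff_norm.2 hz)).trans (le_abs_self C)⟩

/-- Both Cayley factors have real part at least (1 - r)/(1 + r), so the parallelogram law turns the
exponent into a separate Gaussian in each of `x` and `y`. -/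
theorem exists_norm_mehler_le {ħ : ℝ} (hħ : 0 < ħ) {r : ℝ} (hr : 0 < r) (hr1 : r < 1) (d : ℕ) :
    ∃ C δ : ℝ, 0 ≤ C ∧ 0 < δ ∧ ∀ z : ℂ, ‖z‖ = r → ∀ x y : Conf d,
      ‖mehler ħ z x y‖ ≤ C * (Real.exp (-δ * ‖x‖ ^ 2) * Real.exp (-δ * ‖y‖ ^ 2)) := by
  obtain ⟨C, hC, hCle⟩ := exists_norm_mehlerFactor_le hħ hr1 d
  refine ⟨C, (1 - r) / (1 + r) / (2 * ħ), hC, ?_, fun z hz x y => ?_⟩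
  · have : 0 < 1 - r := by linarith
    positivity
  set ρ := (1 - r) / (1 + r)
  rw [mehler, norm_mul, Complex.norm_exp, ← Real.exp_add]
  gcongr
  · exact hCle z hz
  · have h1 := le_re_cayley hz hr1
    have h2 := le_re_cayley' hz hr1
    have e : (-(1 / (4 * ħ)) * ((1 - z) / (1 + z) * (‖x + y‖ ^ 2 : ℝ)
          + (1 + z) / (1 - z) * (‖x - y‖ ^ 2 : ℝ)) : ℂ).re
        = -((1 / (4 * ħ)) * (((1 - z) / (1 + z)).re * ‖x + y‖ ^ 2
          + ((1 + z) / (1 - z)).re * ‖x - y‖ ^ 2)) := by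
      have : (-(1 / (4 * ħ)) : ℂ) = ((-(1 / (4 * ħ)) : ℝ) : ℂ) := by push_cast; rfl
      rw [this, Complex.re_ofReal_mul, Complex.add_re, Complex.re_mul_ofReal,
        Complex.re_mul_ofReal]
      ring
    rw [e]
    have hpar : ‖x + y‖ ^ 2 + ‖x - y‖ ^ 2 = 2 * (‖x‖ ^ 2 + ‖y‖ ^ 2) := by
      have := parallelogram_law_with_norm ℝ x y
      nlinarith
    have h3 : ρ * (2 * (‖x‖ ^ 2 + ‖y‖ ^ 2))
        ≤ ((1 - z) / (1 + z)).re * ‖x + y‖ ^ 2 + ((1 + z) / (1 - z)).re * ‖x - y‖ ^ 2 := by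
      rw [← hpar, mul_add]
      gcongr
    have h4 : (1 / (4 * ħ)) * (ρ * (2 * (‖x‖ ^ 2 + ‖y‖ ^ 2)))
        ≤ (1 / (4 * ħ)) * (((1 - z) / (1 + z)).re * ‖x + y‖ ^ 2
          + ((1 + z) / (1 - z)).re * ‖x - y‖ ^ 2) := by gcongr
    have h5 : (1 / (4 * ħ)) * (ρ * (2 * (‖x‖ ^ 2 + ‖y‖ ^ 2)))
        = ρ / (2 * ħ) * ‖x‖ ^ 2 + ρ / (2 * ħ) * ‖y‖ ^ 2 := by field_simp; ring
    linarith

theorem continuous_mehler_circle {ħ : ℝ} (hħ : 0 < ħ) {r : ℝ} (hr : 0 < r) (hr1 : r < 1) (d : ℕ) :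
    Continuous fun p : (Conf d × Conf d) × ℝ => mehler ħ (circleMap 0 r p.2) p.1.1 p.1.2 := by
  have hlt : ∀ θ, ‖circleMap 0 r θ‖ < 1 := fun θ => by rw [norm_circleMap_zero' hr]; exact hr1
  have hc : Continuous fun p : (Conf d × Conf d) × ℝ => circleMap 0 r p.2 :=
    (continuous_circleMap 0 r).comp continuous_snd
  refine Continuous.mul ?_ ?_
  · refine Continuous.cpow (by fun_prop) continuous_const fun p =>
      mehlerBase_mem_slitPlane hħ (hlt p.2)
  · refine Complex.continuous_exp.comp (continuous_const.mul (Continuous.add ?_ ?_))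
    · refine Continuous.mul (Continuous.div (by fun_prop) (by fun_prop) fun p =>
        one_add_ne_zero_of_norm_lt_one (hlt p.2)) (by fun_prop)
    · refine Continuous.mul (Continuous.div (by fun_prop) (by fun_prop) fun p =>
        one_sub_ne_zero_of_norm_lt_one (hlt p.2)) (by fun_prop)

/-- A Gaussian integral with a complex linear term. -/
theorem integral_cexp_quadratic_two {b : ℂ} (hb : 0 < b.re) (α β : ℂ) (x w : Conf d) :
    ∫ y : Conf d, Complex.exp (-b * (‖y‖ ^ 2 : ℝ) + α * (inner ℝ x y : ℝ) + β * (inner ℝ w y : ℝ))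
      = (Real.pi / b) ^ (d / 2 : ℂ) * Complex.exp ((α ^ 2 * (‖x‖ ^ 2 : ℝ)
          + 2 * α * β * (inner ℝ x w : ℝ) + β ^ 2 * (‖w‖ ^ 2 : ℝ)) / (4 * b)) := by
  have h := GaussianFourier.integral_cexp_neg_mul_sum_add (ι := Fin d) hb
    (fun i => α * x i + β * w i)
  rw [Fintype.card_fin] at h
  have hsum : ∑ i, (α * (x i : ℂ) + β * (w i : ℂ)) ^ 2 = α ^ 2 * (‖x‖ ^ 2 : ℝ)
      + 2 * α * β * (inner ℝ x w : ℝ) + β ^ 2 * (‖w‖ ^ 2 : ℝ) := by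
    rw [EuclideanSpace.real_norm_sq_eq, EuclideanSpace.real_norm_sq_eq, PiLp.inner_apply]
    push_cast
    simp only [Finset.mul_sum, ← Finset.sum_add_distrib]
    refine Finset.sum_congr rfl fun i _ => ?_
    simp
    ring
  rw [hsum] at h
  rw [← h, ← (PiLp.volume_preserving_toLp (Fin d)).integral_comp
    (MeasurableEquiv.toLp 2 _).measurableEmbedding]
  refine integral_congr_ae (Filter.Eventually.of_forall fun v => ?_)
  simp only
  congr 1
  rw [EuclideanSpace.real_norm_sq_eq, PiLp.inner_apply, PiLp.inner_apply]
  push_cast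
  simp only [Finset.mul_sum, add_mul, Finset.sum_add_distrib]
  rw [add_assoc]
  congr 1
  congr 1 <;>
  · refine Finset.sum_congr rfl fun i _ => ?_
    simp
    ring

/-- The Mehler kernel maps the coherent state with parameter `ζ` to that with parameter `zζ`. -/
theorem integral_mehler_mul_coherent {ħ : ℝ} (hħ : 0 < ħ) {z : ℂ} (hz : ‖z‖ < 1) (ζ : ℂ)
    (w x : Conf d) :
    ∫ y, mehler ħ z x y * coherent hħ ζ w y = coherent hħ (z * ζ) w x := by
  have hne : (ħ : ℂ) ≠ 0 := by exact_mod_cast hħ.ne'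
  have h1 := one_add_ne_zero_of_norm_lt_one hz
  have h2 := one_sub_ne_zero_of_norm_lt_one hz
  have h3 : (1 - z ^ 2 : ℂ) ≠ 0 := by
    have : (1 - z ^ 2 : ℂ) = (1 + z) * (1 - z) := by ring
    rw [this]; exact mul_ne_zero h1 h2
  set b : ℂ := (ħ * (1 - z ^ 2))⁻¹ with hbdef
  have hb : 0 < b.re := by
    rw [hbdef, Complex.inv_re, Complex.re_ofReal_mul]
    refine div_pos (mul_pos hħ (one_sub_sq_re_pos hz)) (Complex.normSq_pos.2 (mul_ne_zero hne h3))
  have hsplit : ∀ y, mehler ħ z x y * coherent hħ ζ w y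
      = mehlerFactor d ħ z * Complex.exp (-((1 + z ^ 2) / (2 * ħ * (1 - z ^ 2))) * (‖x‖ ^ 2 : ℝ)
          - ħ * ζ ^ 2 * (‖w‖ ^ 2 : ℝ) / 4)
        * Complex.exp (-b * (‖y‖ ^ 2 : ℝ) + (2 * z * b) * (inner ℝ x y : ℝ)
          + ζ * (inner ℝ w y : ℝ)) := by
    intro y
    rw [mehler, coherent_apply, mul_assoc, mul_assoc, ← Complex.exp_add, ← Complex.exp_add]
    congr 2
    rw [coherentExponent, norm_add_sq_real, norm_sub_sq_real]
    have : (1 - z ^ 2 : ℂ) = (1 + z) * (1 - z) := by ring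
    rw [hbdef, this]
    push_cast
    field_simp
    ring
  simp only [hsplit]
  rw [integral_const_mul, integral_cexp_quadratic_two hb]
  -- The Gaussian normalisation π/b has the same base as the Mehler prefactor and the opposite
  -- exponent, so they cancel with no question of branch.
  have hbase : (Real.pi / b : ℂ) = Real.pi * ħ * (1 - z ^ 2) := by
    rw [hbdef, div_inv_eq_mul]; ring
  have hbase0 : (Real.pi * ħ * (1 - z ^ 2) : ℂ) ≠ 0 :=
    Complex.slitPlane_ne_zero (mehlerBase_mem_slitPlane hħ hz)
  have hcancel : mehlerFactor d ħ z * (Real.pi * ħ * (1 - z ^ 2) : ℂ) ^ (d / 2 : ℂ) = 1 := by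
    rw [mehlerFactor, ← Complex.cpow_add _ _ hbase0]; simp
  rw [hbase, mul_mul_mul_comm, hcancel, one_mul, ← Complex.exp_add, coherent_apply]
  congr 1
  rw [coherentExponent, hbdef, real_inner_comm]
  push_cast
  field_simp
  ring

theorem mehler_symm (ħ : ℝ) (z : ℂ) (x y : Conf d) : mehler ħ z x y = mehler ħ z y x := by
  rw [mehler, mehler, add_comm x y, norm_sub_rev x y]

theorem mehler_conj {ħ : ℝ} (hħ : 0 < ħ) {z : ℂ} (hz : ‖z‖ < 1) (x y : Conf d) :
    (starRingEnd ℂ) (mehler ħ z x y) = mehler ħ ((starRingEnd ℂ) z) x y := by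
  have harg : (Real.pi * ħ * (1 - z ^ 2) : ℂ).arg ≠ Real.pi :=
    (Complex.mem_slitPlane_iff_arg.1 (mehlerBase_mem_slitPlane hħ hz)).1
  have h1 : (starRingEnd ℂ) (mehlerFactor d ħ z) = mehlerFactor d ħ ((starRingEnd ℂ) z) := by
    rw [mehlerFactor, mehlerFactor]
    have h := Complex.cpow_conj (Real.pi * ħ * (1 - z ^ 2) : ℂ) (-(d / 2 : ℂ)) harg
    have e1 : (starRingEnd ℂ) (-(d / 2 : ℂ)) = -(d / 2 : ℂ) := by simp [Complex.conj_ofNat]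
    have e2 : (starRingEnd ℂ) (Real.pi * ħ * (1 - z ^ 2) : ℂ)
        = Real.pi * ħ * (1 - (starRingEnd ℂ) z ^ 2) := by simp [Complex.conj_ofReal]
    rw [e1, e2] at h
    rw [h, starRingEnd_self_apply]
  rw [mehler, map_mul, h1, ← Complex.exp_conj, mehler]
  simp [Complex.conj_ofReal, Complex.conj_ofNat]

/-! ### The eigenprojections as integral operators -/

/-- The `N`-th Taylor coefficient of the Mehler kernel: the kernel of the eigenprojection. -/
def mehlerCoeff {d : ℕ} (ħ r : ℝ) (N : ℕ) (x y : Conf d) : ℂ :=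
  taylorCoeff r N fun z => mehler ħ z x y

theorem mehlerCoeff_symm (ħ r : ℝ) (N : ℕ) (x y : Conf d) :
    mehlerCoeff ħ r N x y = mehlerCoeff ħ r N y x := by
  simp only [mehlerCoeff, mehler_symm ħ _ x y]

theorem circleMap_conj (r θ : ℝ) :
    (starRingEnd ℂ) (circleMap 0 r θ) = circleMap 0 r (2 * Real.pi - θ) := by
  have h : circleMap 0 r (2 * Real.pi - θ) = circleMap 0 r (-θ) := by
    have := periodic_circleMap 0 r (-θ)
    rw [← this]; congr 1; ring
  rw [h]
  simp [circleMap, ← Complex.exp_conj, Complex.conj_ofReal]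

/-- The substitution θ ↦ 2π - θ realises conjugation on the circle. -/
theorem conj_taylorCoeff (r : ℝ) (N : ℕ) (Q : ℂ → ℂ) :
    (starRingEnd ℂ) (taylorCoeff r N Q)
      = taylorCoeff r N fun z => (starRingEnd ℂ) (Q ((starRingEnd ℂ) z)) := by
  have h := intervalIntegral.integral_comp_sub_left (a := 0) (b := 2 * Real.pi)
    (fun θ => (starRingEnd ℂ) (Q (circleMap 0 r θ) / circleMap 0 r θ ^ N)) (2 * Real.pi)
  simp only [sub_self, sub_zero] at h
  have hpi : (0 : ℝ) ≤ 2 * Real.pi := by positivity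
  have hc : (starRingEnd ℂ) (∫ θ in (0 : ℝ)..2 * Real.pi, Q (circleMap 0 r θ) / circleMap 0 r θ ^ N)
      = ∫ θ in (0 : ℝ)..2 * Real.pi,
        (starRingEnd ℂ) (Q (circleMap 0 r θ) / circleMap 0 r θ ^ N) := by
    rw [intervalIntegral.integral_of_le hpi, intervalIntegral.integral_of_le hpi, integral_conj]
  rw [taylorCoeff, map_mul, hc, ← h, taylorCoeff]
  simp [← circleMap_conj, Complex.conj_ofReal, Complex.conj_ofNat]

/-- Reality of the kernel, together with its symmetry in `x` and `y`, makes the integral operator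
self-adjoint. -/
theorem mehlerCoeff_conj {ħ : ℝ} (hħ : 0 < ħ) {r : ℝ} (hr : 0 < r) (hr1 : r < 1) (N : ℕ)
    (x y : Conf d) : (starRingEnd ℂ) (mehlerCoeff ħ r N x y) = mehlerCoeff ħ r N x y := by
  rw [mehlerCoeff, conj_taylorCoeff]
  refine taylorCoeff_congr hr N fun z hz => ?_
  rw [mehler_conj hħ (by rw [Complex.norm_conj]; linarith), starRingEnd_self_apply]

theorem norm_taylorCoeff_le {r : ℝ} (hr : 0 < r) (N : ℕ) {Q : ℂ → ℂ} {B : ℝ}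
    (hB : ∀ z, ‖z‖ = r → ‖Q z‖ ≤ B) : ‖taylorCoeff r N Q‖ ≤ B * (r ^ N)⁻¹ := by
  have h := intervalIntegral.norm_integral_le_of_norm_le_const (a := 0) (b := 2 * Real.pi)
    (C := B * (r ^ N)⁻¹) (f := fun θ => Q (circleMap 0 r θ) / circleMap 0 r θ ^ N)
    fun θ _ => by
      rw [div_eq_mul_inv, norm_mul, norm_inv, norm_pow, norm_circleMap_zero' hr]
      gcongr
      exact hB _ (norm_circleMap_zero' hr θ)
  have hpi : (0 : ℝ) < 2 * Real.pi := by positivity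
  rw [sub_zero, abs_of_pos hpi] at h
  have hn : ‖(2 * Real.pi : ℂ)⁻¹‖ = (2 * Real.pi)⁻¹ := by
    rw [norm_inv]; simp [abs_of_pos Real.pi_pos]
  rw [taylorCoeff, norm_mul, hn, inv_mul_le_iff₀ hpi]
  linarith

theorem continuous_mehlerCoeff {ħ : ℝ} (hħ : 0 < ħ) {r : ℝ} (hr : 0 < r) (hr1 : r < 1) (N : ℕ) :
    Continuous fun p : Conf d × Conf d => mehlerCoeff ħ r N p.1 p.2 := by
  refine continuous_const.mul ?_
  refine intervalIntegral.continuous_parametric_intervalIntegral_of_continuous'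
    (f := fun (p : Conf d × Conf d) θ => mehler ħ (circleMap 0 r θ) p.1 p.2 / circleMap 0 r θ ^ N)
    ?_ _ _
  exact (continuous_mehler_circle hħ hr hr1 d).div
    (((continuous_circleMap 0 r).comp continuous_snd).pow N)
    fun p => pow_ne_zero N (circleMap_ne_zero' hr p.2)

theorem exists_norm_mehlerCoeff_le {ħ : ℝ} (hħ : 0 < ħ) {r : ℝ} (hr : 0 < r) (hr1 : r < 1)
    (d N : ℕ) :
    ∃ C δ : ℝ, 0 ≤ C ∧ 0 < δ ∧ ∀ x y : Conf d,
      ‖mehlerCoeff ħ r N x y‖ ≤ C * (Real.exp (-δ * ‖x‖ ^ 2) * Real.exp (-δ * ‖y‖ ^ 2)) := by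
  obtain ⟨C, δ, hC, hδ, h⟩ := exists_norm_mehler_le hħ hr hr1 d
  refine ⟨C * (r ^ N)⁻¹, δ, by positivity, hδ, fun x y => ?_⟩
  refine (norm_taylorCoeff_le hr N fun z hz => h z hz x y).trans (le_of_eq (by ring))

/-- The integral operator with kernel `mehlerCoeff`. -/
def mehlerOp {d : ℕ} (ħ r : ℝ) (N : ℕ) (f : Conf d → ℂ) (x : Conf d) : ℂ :=
  ∫ y, mehlerCoeff ħ r N x y * f y

theorem memLp_mehlerOp {ħ : ℝ} (hħ : 0 < ħ) {r : ℝ} (hr : 0 < r) (hr1 : r < 1) (N : ℕ)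
    {f : Conf d → ℂ} (hf : MemLp f 2) : MemLp (mehlerOp ħ r N f) 2 := by
  obtain ⟨C, δ, hC, hδ, h⟩ := exists_norm_mehlerCoeff_le hħ hr hr1 d N
  set A := ∫ y : Conf d, Real.exp (-δ * ‖y‖ ^ 2) * ‖f y‖
  have hg : MemLp (fun x : Conf d => C * A * Real.exp (-δ * ‖x‖ ^ 2)) 2 :=
    (memLp_gaussian hδ 2).const_mul _
  refine hg.of_le ?_ (Filter.Eventually.of_forall fun x => ?_)
  · have : AEStronglyMeasurable (fun p : Conf d × Conf d => mehlerCoeff ħ r N p.1 p.2 * f p.2)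
        (volume.prod volume) :=
      (continuous_mehlerCoeff hħ hr hr1 N).aestronglyMeasurable.mul hf.1.comp_snd
    exact this.integral_prod_right'
  · refine le_trans ?_ (le_abs_self _)
    have h2 : ‖mehlerOp ħ r N f x‖
        ≤ ∫ y, C * Real.exp (-δ * ‖x‖ ^ 2) * (Real.exp (-δ * ‖y‖ ^ 2) * ‖f y‖) := by
      refine norm_integral_le_of_norm_le ((integrable_gaussian_mul_norm hδ hf).const_mul _)
        (Filter.Eventually.of_forall fun y => ?_)
      rw [norm_mul]
      calc _ ≤ C * (Real.exp (-δ * ‖x‖ ^ 2) * Real.exp (-δ * ‖y‖ ^ 2)) * ‖f y‖ := by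
            gcongr; exact h x y
        _ = _ := by ring
    rw [integral_const_mul] at h2
    exact h2.trans (le_of_eq (by ring))

/-- The operator with kernel `mehlerCoeff` is symmetric for the bilinear pairing. -/
theorem integral_mul_mehlerOp {ħ : ℝ} (hħ : 0 < ħ) {r : ℝ} (hr : 0 < r) (hr1 : r < 1) (N : ℕ)
    {u v : Conf d → ℂ} (hu : MemLp u 2) (hv : MemLp v 2) :
    ∫ x, u x * mehlerOp ħ r N v x = ∫ x, mehlerOp ħ r N u x * v x := by
  obtain ⟨C, δ, hC, hδ, h⟩ := exists_norm_mehlerCoeff_le hħ hr hr1 d N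
  have e1 : ∀ x, u x * mehlerOp ħ r N v x = ∫ y, u x * (mehlerCoeff ħ r N x y * v y) :=
    fun x => (integral_const_mul _ _).symm
  have e2 : ∀ y, mehlerOp ħ r N u y * v y = ∫ x, u x * (mehlerCoeff ħ r N x y * v y) := by
    intro y
    rw [mehlerOp, ← integral_mul_const]
    refine integral_congr_ae (Filter.Eventually.of_forall fun x => ?_)
    simp only
    rw [mehlerCoeff_symm]; ring
  simp only [e1, e2]
  refine integral_integral_swap ?_
  have hb : Integrable (fun p : Conf d × Conf d => (Real.exp (-δ * ‖p.1‖ ^ 2) * ‖u p.1‖)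
      * (C * (Real.exp (-δ * ‖p.2‖ ^ 2) * ‖v p.2‖))) (volume.prod volume) :=
    (integrable_gaussian_mul_norm hδ hu).mul_prod ((integrable_gaussian_mul_norm hδ hv).const_mul C)
  refine hb.mono' ?_ (Filter.Eventually.of_forall fun p => ?_)
  · exact hu.1.comp_fst.mul
      ((continuous_mehlerCoeff hħ hr hr1 N).aestronglyMeasurable.mul hv.1.comp_snd)
  · simp only [Function.uncurry, norm_mul]
    calc _ ≤ ‖u p.1‖ * (C * (Real.exp (-δ * ‖p.1‖ ^ 2) * Real.exp (-δ * ‖p.2‖ ^ 2))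
          * ‖v p.2‖) := by gcongr; exact h _ _
      _ = _ := by ring

theorem conj_mehlerOp {ħ : ℝ} (hħ : 0 < ħ) {r : ℝ} (hr : 0 < r) (hr1 : r < 1) (N : ℕ)
    (f : Conf d → ℂ) (x : Conf d) :
    (starRingEnd ℂ) (mehlerOp ħ r N f x) = mehlerOp ħ r N (fun y => (starRingEnd ℂ) (f y)) x := by
  rw [mehlerOp, ← integral_conj]
  simp only [map_mul, mehlerCoeff_conj hħ hr hr1, mehlerOp]

/-- By Fubini the Taylor coefficient in z may be taken after integrating, and there the Mehler
kernel merely rescales ζ to zζ. -/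
theorem mehlerOp_coherent {ħ : ℝ} (hħ : 0 < ħ) {r : ℝ} (hr : 0 < r) (hr1 : r < 1) (N : ℕ)
    (ζ : ℂ) (w x : Conf d) :
    mehlerOp ħ r N (coherent hħ ζ w) x = taylorCoeff r N fun z => coherent hħ (z * ζ) w x := by
  obtain ⟨C, δ, hC, hδ, h⟩ := exists_norm_mehler_le hħ hr hr1 d
  have e : ∀ y, mehlerCoeff ħ r N x y * coherent hħ ζ w y
      = taylorCoeff r N fun z => mehler ħ z x y * coherent hħ ζ w y := by
    intro y
    rw [mehlerCoeff, mul_comm, ← taylorCoeff_const_mul]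
    simp only [mul_comm]
  simp only [mehlerOp, e]
  rw [integral_taylorCoeff hr N (B := fun y => C * Real.exp (-δ * ‖x‖ ^ 2)
    * (Real.exp (-δ * ‖y‖ ^ 2) * ‖coherent hħ ζ w y‖))]
  · refine taylorCoeff_congr hr N fun z hz => ?_
    exact integral_mehler_mul_coherent hħ (hz ▸ hr1) ζ w x
  · refine Continuous.aestronglyMeasurable ?_
    refine Continuous.mul ?_ ((coherent hħ ζ w).continuous.comp continuous_fst)
    exact (continuous_mehler_circle hħ hr hr1 d).comp
      (f := fun p : Conf d × ℝ => ((x, p.1), p.2)) (by fun_prop)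
  · exact (integrable_gaussian_mul_norm hδ ((coherent hħ ζ w).memLp 2)).const_mul _
  · intro z hz y
    rw [norm_mul]
    calc _ ≤ C * (Real.exp (-δ * ‖x‖ ^ 2) * Real.exp (-δ * ‖y‖ ^ 2)) * ‖coherent hħ ζ w y‖ := by
          gcongr; exact h z hz x y
      _ = _ := by ring

/-- Pairing with coherent states turns the integral operator into a Taylor coefficient. -/
theorem coherentPairing_mehlerOp {ħ : ℝ} (hħ : 0 < ħ) {r : ℝ} (hr : 0 < r) (hr1 : r < 1) (N : ℕ)
    (w : Conf d) {f : Conf d → ℂ} (hf : MemLp f 2) (ζ : ℂ) :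
    coherentPairing hħ w (mehlerOp ħ r N f) ζ
      = taylorCoeff r N fun z => coherentPairing hħ w f (z * ζ) := by
  rw [coherentPairing, integral_mul_mehlerOp hħ hr hr1 N ((coherent hħ ζ w).memLp 2) hf]
  obtain ⟨C, hC, h⟩ := exists_norm_coherent_le hħ (r * ‖ζ‖) w
  have e : ∀ y, mehlerOp ħ r N (coherent hħ ζ w) y * f y
      = taylorCoeff r N fun z => coherent hħ (z * ζ) w y * f y := by
    intro y
    rw [mehlerOp_coherent hħ hr hr1, mul_comm, ← taylorCoeff_const_mul]
    simp only [mul_comm]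
  simp only [e]
  rw [integral_taylorCoeff hr N
    (B := fun y => C * (Real.exp (-(1 / (4 * ħ)) * ‖y‖ ^ 2) * ‖f y‖))]
  · rfl
  · refine AEStronglyMeasurable.mul ?_ hf.1.comp_fst
    refine Continuous.aestronglyMeasurable ?_
    simp only [coherent_apply, coherentExponent]
    have := (continuous_circleMap 0 r)
    fun_prop
  · exact (integrable_gaussian_mul_norm (by positivity) hf).const_mul _
  · intro z hz y
    have h1 := h (z * ζ) (by rw [norm_mul, hz]) y
    rw [norm_mul]
    calc _ ≤ (1 + ‖y‖) * ‖coherent hħ (z * ζ) w y‖ * ‖f y‖ := by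
          gcongr
          exact le_mul_of_one_le_left (norm_nonneg _) (by linarith [norm_nonneg y])
      _ ≤ C * Real.exp (-(1 / (4 * ħ)) * ‖y‖ ^ 2) * ‖f y‖ := by gcongr
      _ = _ := by ring

theorem coherentPairing_sub {ħ : ℝ} (hħ : 0 < ħ) (w : Conf d) {f g : Conf d → ℂ}
    (hf : MemLp f 2) (hg : MemLp g 2) (ζ : ℂ) :
    coherentPairing hħ w (f - g) ζ = coherentPairing hħ w f ζ - coherentPairing hħ w g ζ := by
  rw [coherentPairing, coherentPairing, coherentPairing,
    ← integral_sub (integrable_coherent_mul hħ ζ w hf) (integrable_coherent_mul hħ ζ w hg)]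
  simp only [Pi.sub_apply, mul_sub]

theorem ae_eq_of_coherentPairing_eq {ħ : ℝ} (hħ : 0 < ħ) {f g : Conf d → ℂ}
    (hf : MemLp f 2) (hg : MemLp g 2)
    (h : ∀ w, coherentPairing hħ w f Complex.I = coherentPairing hħ w g Complex.I) :
    f =ᵐ[volume] g := by
  have := ae_eq_zero_of_coherentPairing_eq_zero hħ (hf.sub hg) fun w => by
    rw [coherentPairing_sub hħ w hf hg, h w, sub_self]
  filter_upwards [this] with x hx
  exact sub_eq_zero.1 hx

/-- The integral operator fixes the eigenspace. -/
theorem mehlerOp_of_mem_eigenspace {ħ : ℝ} (hħ : 0 < ħ) {r : ℝ} (hr : 0 < r) (hr1 : r < 1)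
    (N : ℕ) {ψ : L2 d} (hψ : ψ ∈ eigenspace d ħ (eigenvalue d ħ N)) :
    mehlerOp ħ r N ψ =ᵐ[volume] ψ := by
  refine ae_eq_of_coherentPairing_eq hħ (memLp_mehlerOp hħ hr hr1 N (Lp.memLp ψ)) (Lp.memLp ψ)
    fun w => ?_
  rw [coherentPairing_mehlerOp hħ hr hr1 N w (Lp.memLp ψ)]
  -- The transform of an eigenvector is homogeneous of degree N, so extracting the N-th coefficient
  -- returns it unchanged.
  rw [← taylorCoeff_const_mul_pow hr N (coherentPairing hħ w ψ Complex.I)]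
  refine taylorCoeff_congr hr N fun z hz => ?_
  refine eq_pow_mul_of_euler (fun z => hasDerivAt_coherentPairing hħ w (Lp.memLp ψ) z) N
    (fun z => euler_of_mem_eigenspace hħ hψ w z) ?_ Complex.I_ne_zero
  rintro rfl
  simp at hz
  exact hr.ne hz

theorem coherentPairing_oscillator {ħ : ℝ} (hħ : 0 < ħ) (w : Conf d) (φ : 𝓢(Conf d, ℂ)) (ζ : ℂ) :
    coherentPairing hħ w (oscillator d ħ φ) ζ
      = ħ * (ζ * coherentPairingDeriv hħ w φ ζ + d / 2 * coherentPairing hħ w φ ζ) := by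
  rw [coherentPairing, integral_mul_oscillator, integral_oscillator_coherent_mul hħ w (φ.memLp 2)]

/-- On transforms the oscillator is ħ times Euler's operator plus ħd/2, and Euler's operator
multiplies the N-th Taylor coefficient by N. By symmetry this places the range of the integral
operator in the eigenspace. -/
theorem mehlerOp_oscillator {ħ : ℝ} (hħ : 0 < ħ) {r : ℝ} (hr : 0 < r) (hr1 : r < 1)
    (N : ℕ) (φ : 𝓢(Conf d, ℂ)) :
    mehlerOp ħ r N (oscillator d ħ φ)
      =ᵐ[volume] fun x => (eigenvalue d ħ N : ℂ) * mehlerOp ħ r N φ x := by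
  have hφ := φ.memLp 2 volume
  refine ae_eq_of_coherentPairing_eq hħ
    (memLp_mehlerOp hħ hr hr1 N ((oscillator d ħ φ).memLp 2))
    ((memLp_mehlerOp hħ hr hr1 N hφ).const_mul _) fun w => ?_
  have e : coherentPairing hħ w (fun x => (eigenvalue d ħ N : ℂ) * mehlerOp ħ r N φ x) Complex.I
      = eigenvalue d ħ N * coherentPairing hħ w (mehlerOp ħ r N φ) Complex.I := by
    rw [coherentPairing, coherentPairing, ← integral_const_mul]
    refine integral_congr_ae (Filter.Eventually.of_forall fun x => ?_)
    simp only
    ring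
  rw [e, coherentPairing_mehlerOp hħ hr hr1 N w ((oscillator d ħ φ).memLp 2),
    coherentPairing_mehlerOp hħ hr hr1 N w hφ]
  simp only [coherentPairing_oscillator]
  set P := coherentPairing hħ w φ
  set P' := coherentPairingDeriv hħ w φ
  have hP : ∀ z, HasDerivAt P (P' z) z := fun z => hasDerivAt_coherentPairing hħ w hφ z
  have hPdiff : Differentiable ℂ P := fun z => (hP z).differentiableAt
  have hP'eq : P' = deriv P := funext fun z => (hP z).deriv.symm
  have hP'c : Continuous P' := by
    rw [hP'eq]
    exact (hPdiff.contDiff (n := 1)).continuous_deriv le_rfl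
  have hQ : ∀ z, HasDerivAt (fun z => P (z * Complex.I)) (P' (z * Complex.I) * Complex.I) z := by
    intro z
    have h := (hP (z * Complex.I)).comp z ((hasDerivAt_id z).mul_const Complex.I)
    exact h.congr_deriv (by rw [one_mul])
  have hQ'c : Continuous fun z => P' (z * Complex.I) * Complex.I := by fun_prop
  have heul := taylorCoeff_euler hr N hQ hQ'c
  have hc := continuous_circleMap 0 r
  have hPc : Continuous P := hPdiff.continuous
  have : ∀ z, (ħ : ℂ) * (z * Complex.I * P' (z * Complex.I) + d / 2 * P (z * Complex.I))
      = ħ * (z * (P' (z * Complex.I) * Complex.I)) + (ħ * (d / 2)) * P (z * Complex.I) := by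
    intro z; ring
  simp only [this]
  rw [taylorCoeff_add hr N (by fun_prop) (by fun_prop), taylorCoeff_const_mul,
    taylorCoeff_const_mul, heul, eigenvalue]
  push_cast
  ring

/-- The eigenprojection is the integral operator with kernel `mehlerCoeff`. -/
theorem eigenprojection_ae_eq {ħ : ℝ} (hħ : 0 < ħ) {r : ℝ} (hr : 0 < r) (hr1 : r < 1)
    (N : ℕ) (f : L2 d) :
    (eigenprojection d ħ (eigenvalue d ħ N) f : Conf d → ℂ) =ᵐ[volume] mehlerOp ħ r N f := by
  have hmem := memLp_mehlerOp hħ hr hr1 N (Lp.memLp f)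
  set T : L2 d := hmem.toLp _
  have hT : (T : Conf d → ℂ) =ᵐ[volume] mehlerOp ħ r N f := hmem.coeFn_toLp
  have hconj : ∀ {u : Conf d → ℂ}, MemLp u 2 → MemLp (fun x => (starRingEnd ℂ) (u x)) 2 :=
    fun hu => hu.star
  have hpair : ∀ u : Conf d → ℂ, MemLp u 2 →
      ∫ x, (starRingEnd ℂ) (u x) * T x = ∫ x, (starRingEnd ℂ) (mehlerOp ħ r N u x) * f x := by
    intro u hu
    have : ∫ x, (starRingEnd ℂ) (u x) * T x
        = ∫ x, (starRingEnd ℂ) (u x) * mehlerOp ħ r N f x := by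
      refine integral_congr_ae ?_
      filter_upwards [hT] with x hx
      rw [hx]
    rw [this, integral_mul_mehlerOp hħ hr hr1 N (hconj hu) (Lp.memLp f)]
    simp only [conj_mehlerOp hħ hr hr1]
  -- Membership of `T`, and orthogonality of `f - T` to the eigenspace below, characterise the
  -- orthogonal projection of `f`.
  have h1 : T ∈ eigenspace d ħ (eigenvalue d ħ N) := by
    intro φ
    rw [inner_toLp_eq, inner_toLp_eq, hpair _ ((oscillator d ħ φ).memLp 2), hpair _ (φ.memLp 2),
      ← integral_const_mul]
    refine integral_congr_ae ?_
    filter_upwards [mehlerOp_oscillator hħ hr hr1 N φ] with x hx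
    rw [hx, map_mul, Complex.conj_ofReal, mul_assoc]
  have h2 : ∀ ψ ∈ eigenspace d ħ (eigenvalue d ħ N), inner ℂ (f - T) ψ = 0 := by
    intro ψ hψ
    rw [← inner_conj_symm, inner_sub_right]
    have e1 : inner ℂ ψ T = ∫ x, (starRingEnd ℂ) (ψ x) * T x := by
      rw [L2.inner_def]; simp only [RCLike.inner_apply, mul_comm]
    have e2 : inner ℂ ψ f = ∫ x, (starRingEnd ℂ) (ψ x) * f x := by
      rw [L2.inner_def]; simp only [RCLike.inner_apply, mul_comm]
    rw [e1, e2, hpair _ (Lp.memLp ψ)]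
    have : ∫ x, (starRingEnd ℂ) (mehlerOp ħ r N ψ x) * f x
        = ∫ x, (starRingEnd ℂ) (ψ x) * f x := by
      refine integral_congr_ae ?_
      filter_upwards [mehlerOp_of_mem_eigenspace hħ hr hr1 N hψ] with x hx
      rw [hx]
    rw [this, sub_self, map_zero]
  have h3 : eigenprojection d ħ (eigenvalue d ħ N) f = T :=
    Submodule.eq_starProjection_of_mem_of_inner_eq_zero h1 h2
  rw [h3]
  exact hT

theorem isContinuousKernel_mehlerCoeff {ħ : ℝ} (hħ : 0 < ħ) {r : ℝ} (hr : 0 < r) (hr1 : r < 1)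
    (N : ℕ) :
    IsContinuousKernel (eigenprojection d ħ (eigenvalue d ħ N)) (mehlerCoeff ħ r N) :=
  ⟨continuous_mehlerCoeff hħ hr hr1 N, fun f => eigenprojection_ae_eq hħ hr hr1 N f⟩

/-! ### Uniqueness of the continuous kernel -/

/-- A continuous kernel is determined by the operator. -/
theorem IsContinuousKernel.unique {T : L2 d →L[ℂ] L2 d} {K₁ K₂ : Conf d → Conf d → ℂ}
    (h₁ : IsContinuousKernel T K₁) (h₂ : IsContinuousKernel T K₂) : K₁ = K₂ := by
  have hcont : ∀ {K : Conf d → Conf d → ℂ}, IsContinuousKernel T K → ∀ g : Conf d → ℝ,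
      Continuous g → HasCompactSupport g → Continuous fun x => ∫ y, K x y * (g y : ℂ) := by
    intro K hK g hg hgs
    have h := continuous_parametric_integral_of_continuous (μ := (volume : Measure (Conf d)))
      (f := fun x y => K x y * (g y : ℂ))
      (hK.1.mul (Complex.continuous_ofReal.comp (hg.comp continuous_snd))) hgs
    refine h.congr fun x => ?_
    refine setIntegral_eq_integral_of_forall_compl_eq_zero fun y hy => ?_
    rw [image_eq_zero_of_notMem_tsupport hy]
    simp
  have hcont' : ∀ {K : Conf d → Conf d → ℂ}, IsContinuousKernel T K → ∀ x, Continuous (K x) :=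
    fun hK x => hK.1.comp (by fun_prop : Continuous fun y : Conf d => (x, y))
  ext x y
  refine congrFun (Continuous.ae_eq_iff_eq volume (hcont' h₁ x) (hcont' h₂ x) |>.1 ?_) y
  refine ae_eq_of_integral_contDiff_smul_eq (hcont' h₁ x).locallyIntegrable
    (hcont' h₂ x).locallyIntegrable fun g hg hgs => ?_
  have hgc : Continuous fun y => (g y : ℂ) := Complex.continuous_ofReal.comp hg.continuous
  have hgs' : HasCompactSupport fun y => (g y : ℂ) := hgs.comp_left (g := Complex.ofReal) (by simp)
  have hmem : MemLp (fun y => (g y : ℂ)) 2 (volume : Measure (Conf d)) :=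
    hgc.memLp_of_hasCompactSupport hgs'
  have hT : ∀ {K : Conf d → Conf d → ℂ}, IsContinuousKernel T K →
      (T (hmem.toLp _) : Conf d → ℂ) =ᵐ[volume] fun x => ∫ y, K x y * (g y : ℂ) := by
    intro K hK
    refine (hK.2 (hmem.toLp _)).trans (Filter.Eventually.of_forall fun x => ?_)
    refine integral_congr_ae ?_
    filter_upwards [hmem.coeFn_toLp] with y hy
    rw [hy]
  -- For each test function both sides are continuous in `x`, so almost everywhere equality holds at
  -- every `x`; only then is `x` fixed and the test function varied.
  have heq := (Continuous.ae_eq_iff_eq volume (hcont h₁ g hg.continuous hgs)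
    (hcont h₂ g hg.continuous hgs)).1 ((hT h₁).symm.trans (hT h₂))
  have := congrFun heq x
  simpa only [Complex.real_smul, mul_comm] using this

/-- The radius `r` in (0, 1) is arbitrary; this freedom later places the contour where the estimates
need it. -/
theorem kernel_eigenprojection {ħ : ℝ} (hħ : 0 < ħ) {r : ℝ} (hr : 0 < r) (hr1 : r < 1) (N : ℕ) :
    kernel (eigenprojection d ħ (eigenvalue d ħ N)) = mehlerCoeff ħ r N := by
  have hex : ∃ K, IsContinuousKernel (eigenprojection d ħ (eigenvalue d ħ N)) K :=
    ⟨_, isContinuousKernel_mehlerCoeff hħ hr hr1 N⟩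
  rw [kernel, dif_pos hex]
  exact hex.choose_spec.unique (isContinuousKernel_mehlerCoeff hħ hr hr1 N)

/-! ### The Wigner transform of the Mehler kernel -/

/-- For `p` and `s` in the right half-plane the principal logarithms of `p * s` and `p / s` are the
sum and difference of those of `p` and `s`. The half-integer powers of `p` cancel and an integer
power of `s` remains: the Wigner generating function has no branch point. -/
theorem mul_cpow_mul_cpow_neg_half {k : ℝ} (hk : 0 < k) {p s : ℂ} (hp : 0 < p.re) (hs : 0 < s.re)
    (d : ℕ) :
    (k * (p * s)) ^ (-(d / 2 : ℂ)) * ((4 * k : ℝ) * (p / s)) ^ (d / 2 : ℂ) = 2 ^ d / s ^ d := by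
  have hp0 : p ≠ 0 := fun h => by simp [h] at hp
  have hs0 : s ≠ 0 := fun h => by simp [h] at hs
  have hap := abs_lt.1 (Complex.abs_arg_lt_pi_div_two_iff.2 (Or.inl hp))
  have has := abs_lt.1 (Complex.abs_arg_lt_pi_div_two_iff.2 (Or.inl hs))
  have hsne : s.arg ≠ Real.pi := by linarith [has.2, Real.pi_pos]
  have h1 : Complex.log (k * (p * s)) = Real.log k + (Complex.log p + Complex.log s) := by
    rw [Complex.log_ofReal_mul hk (mul_ne_zero hp0 hs0), Complex.log_mul hp0 hs0
      ⟨by linarith [hap.1, has.1], by linarith [hap.2, has.2]⟩]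
  have h2 : Complex.log ((4 * k : ℝ) * (p / s))
      = Real.log (4 * k) + (Complex.log p - Complex.log s) := by
    have harg : (s⁻¹).arg = -s.arg := by rw [Complex.arg_inv, if_neg hsne]
    rw [Complex.log_ofReal_mul (by positivity) (div_ne_zero hp0 hs0), div_eq_mul_inv,
      Complex.log_mul hp0 (inv_ne_zero hs0) (by
        rw [harg]; exact ⟨by linarith [hap.1, has.2], by linarith [hap.2, has.1]⟩),
      Complex.log_inv s hsne, sub_eq_add_neg]
  have hk0 : (k : ℂ) ≠ 0 := by exact_mod_cast hk.ne'
  have h4k0 : ((4 * k : ℝ) : ℂ) ≠ 0 := by exact_mod_cast (by positivity : 4 * k ≠ 0)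
  rw [Complex.cpow_def_of_ne_zero (mul_ne_zero hk0 (mul_ne_zero hp0 hs0)),
    Complex.cpow_def_of_ne_zero (mul_ne_zero h4k0 (div_ne_zero hp0 hs0)), ← Complex.exp_add,
    h1, h2]
  have h3 : Real.log (4 * k) = 2 * Real.log 2 + Real.log k := by
    rw [Real.log_mul (by norm_num) hk.ne']
    have : (4 : ℝ) = 2 ^ 2 := by norm_num
    rw [this, Real.log_pow]; push_cast; ring
  have h5 : Complex.exp ((Real.log 2 : ℝ) : ℂ) = 2 := by
    rw [← Complex.ofReal_exp, Real.exp_log two_pos]; norm_num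
  have e : ((Real.log k : ℂ) + (Complex.log p + Complex.log s)) * -(d / 2 : ℂ)
      + ((Real.log (4 * k) : ℝ) + (Complex.log p - Complex.log s)) * (d / 2 : ℂ)
      = d * ((Real.log 2 : ℝ) : ℂ) - d * Complex.log s := by
    rw [h3]; push_cast; ring
  rw [e, Complex.exp_sub, Complex.exp_nat_mul, Complex.exp_nat_mul, h5, Complex.exp_log hs0]

/-- The generating function of the Wigner distributions. -/
def wignerGen (d : ℕ) (X : ℝ) (z : ℂ) : ℂ :=
  2 ^ d / (1 + z) ^ d * Complex.exp (-X * ((1 - z) / (1 + z)))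

theorem mehler_midpoint (ħ : ℝ) (z : ℂ) (x v : Conf d) :
    mehler ħ z (x + (1 / 2 : ℝ) • v) (x - (1 / 2 : ℝ) • v)
      = mehlerFactor d ħ z * Complex.exp (-(1 / (4 * ħ)) *
        ((1 - z) / (1 + z) * (4 * ‖x‖ ^ 2 : ℝ) + (1 + z) / (1 - z) * (‖v‖ ^ 2 : ℝ))) := by
  have e1 : x + (1 / 2 : ℝ) • v + (x - (1 / 2 : ℝ) • v) = (2 : ℝ) • x := by
    rw [two_smul]; abel
  have e2 : x + (1 / 2 : ℝ) • v - (x - (1 / 2 : ℝ) • v) = v := by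
    have : x + (1 / 2 : ℝ) • v - (x - (1 / 2 : ℝ) • v) = ((1 / 2 : ℝ) + 1 / 2) • v := by
      rw [add_smul]; abel
    rw [this]; norm_num
  rw [mehler, e1, e2, norm_smul]
  norm_num [mul_pow]

/-- The Wigner transform of the Mehler kernel. -/
theorem integral_mehler_midpoint {ħ : ℝ} (hħ : 0 < ħ) {z : ℂ} (hz : ‖z‖ < 1) (x ξ : Conf d) :
    ∫ v : Conf d, mehler ħ z (x + (1 / 2 : ℝ) • v) (x - (1 / 2 : ℝ) • v)
        * Complex.exp (-(Complex.I / ħ) * (inner ℝ v ξ : ℝ))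
      = wignerGen d (2 * classicalH x ξ / ħ) z := by
  have hne : (ħ : ℂ) ≠ 0 := by exact_mod_cast hħ.ne'
  have h1 := one_add_ne_zero_of_norm_lt_one hz
  have h2 := one_sub_ne_zero_of_norm_lt_one hz
  set b : ℂ := (1 / (4 * ħ) : ℝ) * ((1 + z) / (1 - z)) with hbdef
  have hb : 0 < b.re := by
    rw [hbdef, Complex.re_ofReal_mul]
    have : 0 < (1 - ‖z‖) / (1 + ‖z‖) := by
      have := norm_nonneg z
      exact div_pos (by linarith) (by linarith)
    exact mul_pos (by positivity) (this.trans_le (le_re_cayley' rfl hz))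
  have hsplit : ∀ v : Conf d, mehler ħ z (x + (1 / 2 : ℝ) • v) (x - (1 / 2 : ℝ) • v)
        * Complex.exp (-(Complex.I / ħ) * (inner ℝ v ξ : ℝ))
      = mehlerFactor d ħ z * Complex.exp (-(1 / ħ) * ((1 - z) / (1 + z)) * (‖x‖ ^ 2 : ℝ))
        * Complex.exp (-b * (‖v‖ ^ 2 : ℝ) + (-(Complex.I / ħ)) * (inner ℝ ξ v : ℝ)
          + 0 * (inner ℝ (0 : Conf d) v : ℝ)) := by
    intro v
    rw [mehler_midpoint, mul_assoc, mul_assoc, ← Complex.exp_add, ← Complex.exp_add,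
      real_inner_comm ξ v]
    congr 2
    rw [hbdef]
    push_cast
    field_simp
    ring
  simp only [hsplit]
  rw [integral_const_mul, integral_cexp_quadratic_two hb]
  have hbase : (Real.pi / b : ℂ) = (4 * (Real.pi * ħ) : ℝ) * ((1 - z) / (1 + z)) := by
    rw [hbdef]; push_cast; field_simp
  have hbase' : (Real.pi * ħ * (1 - z ^ 2) : ℂ) = (Real.pi * ħ : ℝ) * ((1 - z) * (1 + z)) := by
    push_cast; ring
  have hre := abs_le.1 (Complex.abs_re_le_norm z)
  have hcancel := mul_cpow_mul_cpow_neg_half (k := Real.pi * ħ) (by positivity)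
    (p := 1 - z) (s := 1 + z) (by simp; linarith [hre.2]) (by simp; linarith [hre.1]) d
  rw [hbase, mul_mul_mul_comm, mehlerFactor, hbase', hcancel, ← Complex.exp_add, wignerGen]
  congr 2
  rw [classicalH, hbdef]
  have : Complex.I ^ 2 = -1 := Complex.I_sq
  push_cast
  field_simp
  linear_combination (‖ξ‖ : ℂ) ^ 2 * this

/-- The Wigner distribution of an eigenprojection as a Taylor coefficient. -/
theorem eigenWigner_eq {ħ : ℝ} (hħ : 0 < ħ) {r : ℝ} (hr : 0 < r) (hr1 : r < 1) (N : ℕ)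
    (x ξ : Conf d) :
    eigenWigner d ħ N x ξ
      = taylorCoeff r N (wignerGen d (2 * classicalH x ξ / ħ))
        / ((2 * Real.pi * ħ) ^ d : ℝ) := by
  rw [eigenWigner, wignerTransform, kernel_eigenprojection hħ hr hr1]
  congr 1
  obtain ⟨C, δ, hC, hδ, h⟩ := exists_norm_mehler_le hħ hr hr1 d
  have e : ∀ v : Conf d, mehlerCoeff ħ r N (x + (1 / 2 : ℝ) • v) (x - (1 / 2 : ℝ) • v)
        * Complex.exp (-(Complex.I / ħ) * (inner ℝ v ξ : ℝ))
      = taylorCoeff r N fun z => mehler ħ z (x + (1 / 2 : ℝ) • v) (x - (1 / 2 : ℝ) • v)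
        * Complex.exp (-(Complex.I / ħ) * (inner ℝ v ξ : ℝ)) := by
    intro v
    rw [mehlerCoeff, mul_comm, ← taylorCoeff_const_mul]
    simp only [mul_comm]
  simp only [e]
  rw [integral_taylorCoeff hr N (B := fun v => C * Real.exp (-(δ / 2) * ‖v‖ ^ 2))]
  · exact taylorCoeff_congr hr N fun z hz => integral_mehler_midpoint hħ (hz ▸ hr1) x ξ
  · refine Continuous.aestronglyMeasurable (Continuous.mul ?_ (by fun_prop))
    exact (continuous_mehler_circle hħ hr hr1 d).comp
      (f := fun p : Conf d × ℝ => ((x + (1 / 2 : ℝ) • p.1, x - (1 / 2 : ℝ) • p.1), p.2))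
      (by fun_prop)
  · exact (integrable_gaussian (by positivity)).const_mul _
  · intro z hz v
    have h3 : ‖Complex.exp (-(Complex.I / ħ) * (inner ℝ v ξ : ℝ))‖ = 1 := by
      have : (-(Complex.I / ħ) * (inner ℝ v ξ : ℝ) : ℂ)
          = ((-(inner ℝ v ξ) / ħ : ℝ) : ℂ) * Complex.I := by push_cast; ring
      rw [this, Complex.norm_exp_ofReal_mul_I]
    rw [norm_mul, h3, mul_one]
    refine (h z hz _ _).trans ?_
    rw [← Real.exp_add]
    gcongr
    -- The squared norms of x + v/2 and x - v/2 add up to 2‖x‖² + ‖v‖²/2, whence the rate δ/2.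
    have hpar := parallelogram_law_with_norm ℝ x ((1 / 2 : ℝ) • v)
    rw [norm_smul] at hpar
    norm_num at hpar
    have hx : 0 ≤ δ * ‖x‖ ^ 2 := by positivity
    have := congrArg (fun t => δ * t) hpar
    nlinarith

/-! ### The bulk Wigner distribution as a contour integral -/

theorem taylorCoeff_sum {r : ℝ} (hr : 0 < r) (m : ℕ) {Q : ℂ → ℂ}
    (hQ : Continuous fun θ => Q (circleMap 0 r θ)) :
    ∑ N ∈ Finset.range m, taylorCoeff r N Q = (2 * Real.pi : ℂ)⁻¹ *
      ∫ θ in (0 : ℝ)..2 * Real.pi, ∑ N ∈ Finset.range m,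
        Q (circleMap 0 r θ) / circleMap 0 r θ ^ N := by
  simp only [taylorCoeff]
  rw [← Finset.mul_sum, intervalIntegral.integral_finsetSum]
  exact fun N _ => (continuous_circle_div hr N hQ).intervalIntegrable _ _

theorem differentiableAt_wignerGen (d : ℕ) (X : ℝ) {z : ℂ} (hz : ‖z‖ < 1) :
    DifferentiableAt ℂ (wignerGen d X) z := by
  have h := one_add_ne_zero_of_norm_lt_one hz
  unfold wignerGen
  fun_prop (disch := first | exact h | exact pow_ne_zero _ h)

/-- Summing the first `m` Taylor coefficients. -/
theorem sum_taylorCoeff_eq {r : ℝ} (hr : 0 < r) (hr1 : r < 1) (m : ℕ) {Q : ℂ → ℂ}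
    (hQ : ∀ z, ‖z‖ < 1 → DifferentiableAt ℂ Q z) :
    ∑ N ∈ Finset.range m, taylorCoeff r N Q = (2 * Real.pi : ℂ)⁻¹ *
      ∫ θ in (0 : ℝ)..2 * Real.pi, Q (circleMap 0 r θ) * circleMap 0 r θ
        / ((1 - circleMap 0 r θ) * circleMap 0 r θ ^ m) := by
  have hlt : ∀ θ, ‖circleMap 0 r θ‖ < 1 := fun θ => by rw [norm_circleMap_zero' hr]; exact hr1
  have hc := continuous_circleMap 0 r
  have hQc : Continuous fun θ => Q (circleMap 0 r θ) := continuous_iff_continuousAt.2 fun θ =>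
    (hQ _ (hlt θ)).continuousAt.comp hc.continuousAt
  have hne : ∀ θ, 1 - circleMap 0 r θ ≠ 0 := fun θ => one_sub_ne_zero_of_norm_lt_one (hlt θ)
  have hsum : ∀ θ, ∑ N ∈ Finset.range m, Q (circleMap 0 r θ) / circleMap 0 r θ ^ N
      = Q (circleMap 0 r θ) * circleMap 0 r θ / ((1 - circleMap 0 r θ) * circleMap 0 r θ ^ m)
        - Q (circleMap 0 r θ) * circleMap 0 r θ / (1 - circleMap 0 r θ) := by
    intro θ
    have h0 := circleMap_ne_zero' hr θ
    have h1 := hne θ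
    set c := circleMap 0 r θ
    clear_value c
    induction m with
    | zero => simp
    | succ n ih =>
      rw [Finset.sum_range_succ, ih]
      field_simp
      ring
  -- The second term of the geometric sum is holomorphic inside the circle, so it drops out by
  -- Cauchy's theorem.
  have hzero : ∫ θ in (0 : ℝ)..2 * Real.pi,
      Q (circleMap 0 r θ) * circleMap 0 r θ / (1 - circleMap 0 r θ) = 0 := by
    have h := Complex.circleIntegral_eq_zero_of_differentiable_on_off_countable (c := 0) hr.le
      Set.countable_empty (f := fun z => Q z / (1 - z))
      (fun z hz => by
        have hz' : ‖z‖ < 1 := lt_of_le_of_lt (mem_closedBall_zero_iff.1 hz) hr1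
        exact ((hQ z hz').continuousAt.div (by fun_prop)
          (one_sub_ne_zero_of_norm_lt_one hz')).continuousWithinAt)
      (fun z hz => by
        have hz' : ‖z‖ < 1 := lt_trans (mem_ball_zero_iff.1 hz.1) hr1
        exact (hQ z hz').div (by fun_prop) (one_sub_ne_zero_of_norm_lt_one hz'))
    rw [circleIntegral] at h
    simp only [deriv_circleMap, smul_eq_mul] at h
    have e : ∀ θ, circleMap 0 r θ * Complex.I * (Q (circleMap 0 r θ) / (1 - circleMap 0 r θ))
        = Complex.I * (Q (circleMap 0 r θ) * circleMap 0 r θ / (1 - circleMap 0 r θ)) := by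
      intro θ; ring
    simp only [e] at h
    rw [intervalIntegral.integral_const_mul] at h
    exact (mul_eq_zero.1 h).resolve_left Complex.I_ne_zero
  rw [taylorCoeff_sum hr m hQc]
  simp only [hsum]
  rw [intervalIntegral.integral_sub, hzero, sub_zero]
  · exact Continuous.intervalIntegrable ((hQc.mul hc).div (by fun_prop)
      fun θ => mul_ne_zero (hne θ) (pow_ne_zero m (circleMap_ne_zero' hr θ))) _ _
  · exact Continuous.intervalIntegrable ((hQc.mul hc).div (by fun_prop) hne) _ _

/-- The integrand of the bulk Wigner distribution in the variable `w`, `z = exp(-2w)`. -/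
def bulkIntegrand (d : ℕ) (X Y : ℝ) (w : ℂ) : ℂ :=
  Complex.exp (-X * (Complex.sinh w / Complex.cosh w) + Y * w)
    / (Complex.sinh w * Complex.cosh w ^ d)

theorem circleMap_exp (b a : ℝ) :
    circleMap 0 (Real.exp (-2 * b)) (-2 * a) = Complex.exp (-2 * (b + a * Complex.I)) := by
  rw [circleMap_zero, Complex.ofReal_exp, ← Complex.exp_add]
  congr 1
  push_cast
  ring

/-- The Cayley factor becomes tanh w. In the exponent, 2m comes from z^(-m), d from (1 + z)^(-d),
and -1 from z/(1 - z). -/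
theorem wignerGen_exp (d m : ℕ) (X : ℝ) {w : ℂ} (hw : 0 < w.re) :
    wignerGen d X (Complex.exp (-2 * w)) * Complex.exp (-2 * w)
        / ((1 - Complex.exp (-2 * w)) * Complex.exp (-2 * w) ^ m)
      = bulkIntegrand d X (2 * m + d - 1) w / 2 := by
  have hz : ‖Complex.exp (-2 * w)‖ < 1 := by
    rw [Complex.norm_exp]
    simpa using hw
  have h1 := one_add_ne_zero_of_norm_lt_one hz
  have h2 := one_sub_ne_zero_of_norm_lt_one hz
  have hE : Complex.exp w ≠ 0 := Complex.exp_ne_zero w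
  have hEm : Complex.exp (-2 * w) = (Complex.exp w ^ 2)⁻¹ := by
    rw [← Complex.exp_nat_mul, ← Complex.exp_neg]; push_cast; ring_nf
  have hneg : Complex.exp (-w) = (Complex.exp w)⁻¹ := Complex.exp_neg w
  have hcosh : 1 + Complex.exp (-2 * w) = 2 * (Complex.exp w)⁻¹ * Complex.cosh w := by
    rw [Complex.cosh, hEm, hneg]; field_simp
  have hsinh : 1 - Complex.exp (-2 * w) = 2 * (Complex.exp w)⁻¹ * Complex.sinh w := by
    rw [Complex.sinh, hEm, hneg]; field_simp
  have hc : Complex.cosh w ≠ 0 := by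
    intro h; rw [hcosh, h, mul_zero] at h1; exact h1 rfl
  have hs : Complex.sinh w ≠ 0 := by
    intro h; rw [hsinh, h, mul_zero] at h2; exact h2 rfl
  have hY : Complex.exp (((2 * m + d - 1 : ℝ) : ℂ) * w)
      = Complex.exp w ^ (2 * m) * Complex.exp w ^ d * (Complex.exp w)⁻¹ := by
    rw [← Complex.exp_nat_mul, ← Complex.exp_nat_mul, ← Complex.exp_neg, ← Complex.exp_add,
      ← Complex.exp_add]
    congr 1; push_cast; ring
  rw [wignerGen, bulkIntegrand, hcosh, hsinh, Complex.exp_add, hY, hEm]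
  have : 2 * (Complex.exp w)⁻¹ * Complex.sinh w / (2 * (Complex.exp w)⁻¹ * Complex.cosh w)
      = Complex.sinh w / Complex.cosh w := by field_simp
  rw [this, mul_pow, mul_pow, inv_pow, inv_pow, pow_mul]
  field_simp

/-- E_N ≤ E means N ≤ E/ħ - d/2, so `m` is the floor plus one. If the right side is negative there
is no eigenvalue, `m` is 0, and 2E/ħ < d. -/
theorem exists_eigenvalue_count (d : ℕ) {ħ E : ℝ} (hħ : 0 < ħ) (hE : 0 < E) :
    ∃ m : ℕ, {N : ℕ | eigenvalue d ħ N ∈ Set.Icc 0 E} = ↑(Finset.range m) ∧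
      |(2 * m + d - 1 : ℝ) - 2 * E / ħ| ≤ d + 1 := by
  have hpos : ∀ N : ℕ, 0 ≤ eigenvalue d ħ N := fun N => by unfold eigenvalue; positivity
  have hle : ∀ N : ℕ, eigenvalue d ħ N ≤ E ↔ (N : ℝ) ≤ E / ħ - d / 2 := by
    intro N
    rw [eigenvalue, ← le_div_iff₀' hħ]
    constructor <;> intro h <;> linarith
  have hEħ : 0 < E / ħ := by positivity
  have e2 : 2 * E / ħ = 2 * (E / ħ) := by ring
  have hd : (0 : ℝ) ≤ d := Nat.cast_nonneg d
  rcases lt_or_ge (E / ħ - d / 2) 0 with h | h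
  · refine ⟨0, ?_, ?_⟩
    · ext N
      have : ¬ (N : ℝ) ≤ E / ħ - d / 2 := by
        have : (0 : ℝ) ≤ N := Nat.cast_nonneg N
        linarith
      simp [hle, this]
    · rw [e2, abs_le]; push_cast; constructor <;> linarith
  · refine ⟨⌊E / ħ - d / 2⌋₊ + 1, ?_, ?_⟩
    · ext N
      simp [hle, hpos, Nat.le_floor_iff h]
    · have h1 := Nat.floor_le h
      have h2 := Nat.lt_floor_add_one (E / ħ - d / 2)
      rw [e2, abs_le]; push_cast; constructor <;> linarith

/-- Integral representation of the bulk Wigner distribution. -/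
theorem exists_bulkWigner_eq (d : ℕ) {ħ E : ℝ} (hħ : 0 < ħ) (hE : 0 < E) (x ξ : Conf d) {b : ℝ}
    (hb : 0 < b) :
    ∃ Y : ℝ, |Y - 2 * E / ħ| ≤ d + 1 ∧
      bulkWigner d ħ 0 E x ξ = (((2 * Real.pi * ħ) ^ d)⁻¹ : ℝ) * ((2 * Real.pi : ℂ)⁻¹ *
        ∫ a in (-(Real.pi / 2))..(Real.pi / 2),
          bulkIntegrand d (2 * classicalH x ξ / ħ) Y (b + a * Complex.I)) := by
  obtain ⟨m, hm, hY⟩ := exists_eigenvalue_count d hħ hE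
  refine ⟨2 * m + d - 1, hY, ?_⟩
  set r := Real.exp (-2 * b)
  have hr : 0 < r := Real.exp_pos _
  have hr1 : r < 1 := Real.exp_lt_one_iff.2 (by linarith)
  set X := 2 * classicalH x ξ / ħ
  rw [bulkWigner, hm, finsum_mem_coe_finset]
  simp only [eigenWigner_eq hħ hr hr1]
  rw [← Finset.sum_div, sum_taylorCoeff_eq hr hr1 m fun z hz => differentiableAt_wignerGen d X hz]
  set f : ℝ → ℂ := fun θ => wignerGen d X (circleMap 0 r θ) * circleMap 0 r θ
        / ((1 - circleMap 0 r θ) * circleMap 0 r θ ^ m)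
  have hper : Function.Periodic f (2 * Real.pi) := fun θ => by
    simp only [f, periodic_circleMap 0 r θ]
  have h1 : ∫ θ in (0 : ℝ)..2 * Real.pi, f θ = ∫ θ in (-Real.pi)..Real.pi, f θ := by
    have := hper.intervalIntegral_add_eq 0 (-Real.pi)
    rw [zero_add] at this
    rw [this]; congr 1; ring
  have h2 : ∫ θ in (-Real.pi)..Real.pi, f θ
      = ∫ a in (-(Real.pi / 2))..(Real.pi / 2),
          bulkIntegrand d X (2 * m + d - 1) (b + a * Complex.I) := by
    -- As θ = -2a, an interval of length π in `a` covers the circle once; the reversed orientation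
    -- is undone by swapping the endpoints.
    have h3 := intervalIntegral.integral_comp_mul_left (a := -(Real.pi / 2)) (b := Real.pi / 2)
      f (c := -2) (by norm_num)
    have e1 : -2 * -(Real.pi / 2) = Real.pi := by ring
    have e2 : -2 * (Real.pi / 2) = -Real.pi := by ring
    rw [e1, e2, intervalIntegral.integral_symm (-Real.pi) Real.pi] at h3
    have h4 : ∫ θ in (-Real.pi)..Real.pi, f θ
        = 2 * ∫ a in (-(Real.pi / 2))..(Real.pi / 2), f (-2 * a) := by
      rw [h3, Complex.real_smul]; push_cast; ring
    rw [h4, ← intervalIntegral.integral_const_mul]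
    refine intervalIntegral.integral_congr fun a _ => ?_
    simp only [f, r, circleMap_exp]
    rw [wignerGen_exp d m X (by simpa using hb)]
    ring
  rw [h1, h2]
  push_cast
  rw [div_eq_inv_mul]

end

/-! ### The integrated Airy function -/

/-- The integrand of the integrated Airy function. -/
def airyIntegrand (s : ℝ) (v : ℂ) : ℂ := Complex.exp (v ^ 3 / 3 - s * v) / v

/-- The real part of (β + iτ)³/3 is β³/3 - βτ², which is Gaussian decay on every vertical line in
the right half-plane. -/
theorem norm_airyExp (s β τ : ℝ) :
    ‖Complex.exp ((β + τ * Complex.I) ^ 3 / 3 - s * (β + τ * Complex.I))‖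
      = Real.exp (β ^ 3 / 3 - s * β) * Real.exp (-β * τ ^ 2) := by
  rw [Complex.norm_exp, ← Real.exp_add]
  congr 1
  have h : ((β + τ * Complex.I) ^ 3 / 3 - s * (β + τ * Complex.I) : ℂ)
      = ((β ^ 3 / 3 - β * τ ^ 2 - s * β : ℝ) : ℂ)
        + ((β ^ 2 * τ - τ ^ 3 / 3 - s * τ : ℝ) : ℂ) * Complex.I := by
    have h2 : Complex.I ^ 2 = -1 := Complex.I_sq
    have h3 : Complex.I ^ 3 = -Complex.I := Complex.I_pow_three
    push_cast
    ring_nf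
    rw [h2, h3]
    ring
  rw [h, Complex.add_re, Complex.ofReal_re, Complex.re_ofReal_mul, Complex.I_re]
  ring

theorem le_norm_add_mul_I (β τ : ℝ) : β ≤ ‖(β + τ * Complex.I : ℂ)‖ := by
  have := Complex.re_le_norm (β + τ * Complex.I : ℂ)
  simpa using this

theorem add_mul_I_ne_zero {β : ℝ} (hβ : 0 < β) (τ : ℝ) : (β + τ * Complex.I : ℂ) ≠ 0 :=
  norm_pos_iff.1 (hβ.trans_le (le_norm_add_mul_I β τ))

theorem norm_airyIntegrand_le (s : ℝ) {β₀ β : ℝ} (hβ₀ : 0 < β₀) (hβ : β₀ ≤ β) (hβ1 : β ≤ 1)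
    (τ : ℝ) : ‖airyIntegrand s (β + τ * Complex.I)‖
      ≤ Real.exp (1 + |s|) / β₀ * Real.exp (-β₀ * τ ^ 2) := by
  have hpos : 0 < β := hβ₀.trans_le hβ
  rw [airyIntegrand, norm_div, norm_airyExp, div_mul_eq_mul_div]
  have h1 : β ^ 3 ≤ 1 := pow_le_one₀ hpos.le hβ1
  have h2 : -s * β ≤ |s| := by
    calc -s * β ≤ |s| * β := by gcongr; exact neg_le_abs s
      _ ≤ |s| * 1 := by gcongr
      _ = |s| := mul_one _
  gcongr
  · linarith
  · exact hβ.trans (le_norm_add_mul_I β τ)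

theorem continuous_airyIntegrand (s : ℝ) {β : ℝ} (hβ : 0 < β) :
    Continuous fun τ : ℝ => airyIntegrand s (β + τ * Complex.I) := by
  unfold airyIntegrand
  exact Continuous.div (by fun_prop) (by fun_prop) fun τ => add_mul_I_ne_zero hβ τ

theorem integrable_airyIntegrand (s : ℝ) {β : ℝ} (hβ : 0 < β) (hβ1 : β ≤ 1) :
    Integrable fun τ : ℝ => airyIntegrand s (β + τ * Complex.I) :=
  ((integrable_exp_neg_mul_sq hβ).const_mul _).mono'
    (continuous_airyIntegrand s hβ).aestronglyMeasurable
    (Filter.Eventually.of_forall fun τ => norm_airyIntegrand_le s hβ le_rfl hβ1 τ)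

/-- The contour of the integrated Airy function may be shifted towards the pole. -/
theorem integral_airyIntegrand_shift (s : ℝ) {β : ℝ} (hβ : 0 < β) (hβ1 : β ≤ 1) :
    ∫ τ : ℝ, airyIntegrand s ((1 : ℝ) + τ * Complex.I)
      = ∫ τ : ℝ, airyIntegrand s (β + τ * Complex.I) := by
  have hvert : ∀ γ : ℝ, 0 < γ → γ ≤ 1 → Filter.Tendsto
      (fun T : ℝ => ∫ τ in (-T)..T, airyIntegrand s (γ + τ * Complex.I)) Filter.atTop
      (nhds (∫ τ : ℝ, airyIntegrand s (γ + τ * Complex.I))) := fun γ h h1 =>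
    intervalIntegral_tendsto_integral (integrable_airyIntegrand s h h1)
      Filter.tendsto_neg_atTop_atBot Filter.tendsto_id
  have hexp : Filter.Tendsto (fun T : ℝ => Real.exp (1 + |s|) / β * Real.exp (-β * T ^ 2)
      * |1 - β|) Filter.atTop (nhds 0) := by
    have h1 : Filter.Tendsto (fun T : ℝ => -β * T ^ 2) Filter.atTop Filter.atBot :=
      (Filter.tendsto_pow_atTop two_ne_zero).const_mul_atTop_of_neg (by linarith)
    simpa using ((Real.tendsto_exp_atBot.comp h1).const_mul
      (Real.exp (1 + |s|) / β)).mul_const |1 - β|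
  -- `ε` stands for both heights T and -T of the horizontal edges; the bound sees only the square.
  have hhor : ∀ ε : ℝ → ℝ, (∀ T, ε T ^ 2 = T ^ 2) → Filter.Tendsto
      (fun T : ℝ => ∫ x in β..1, airyIntegrand s (x + ε T * Complex.I)) Filter.atTop
      (nhds 0) := by
    intro ε hε
    refine squeeze_zero_norm (fun T => ?_) hexp
    refine intervalIntegral.norm_integral_le_of_norm_le_const fun x hx => ?_
    rw [Set.uIoc_of_le hβ1] at hx
    have := norm_airyIntegrand_le s hβ hx.1.le hx.2 (ε T)
    rwa [hε T] at this
  have hrect : ∀ T : ℝ, Complex.I * (∫ τ in (-T)..T, airyIntegrand s ((1 : ℝ) + τ * Complex.I))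
      = Complex.I * (∫ τ in (-T)..T, airyIntegrand s (β + τ * Complex.I))
        + (∫ x in β..1, airyIntegrand s (x + T * Complex.I))
        - ∫ x in β..1, airyIntegrand s (x + (-T : ℝ) * Complex.I) := by
    intro T
    have h := Complex.integral_boundary_rect_eq_zero_of_differentiableOn (airyIntegrand s)
      (β + (-T : ℝ) * Complex.I) (1 + T * Complex.I) (fun v hv => by
        have hre : 0 < v.re := by
          have := hv.1
          simp only [Complex.add_re, Complex.ofReal_re, Complex.re_ofReal_mul, Complex.I_re,
            Complex.one_re, mul_zero, add_zero, Set.mem_preimage, Set.uIcc_of_le hβ1] at this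
          exact hβ.trans_le this.1
        have hv0 : v ≠ 0 := fun h => by simp [h] at hre
        unfold airyIntegrand
        exact (DifferentiableAt.div (by fun_prop) (by fun_prop) hv0).differentiableWithinAt)
    simp only [Complex.add_re, Complex.ofReal_re, Complex.re_ofReal_mul, Complex.I_re,
      Complex.one_re, mul_zero, add_zero, Complex.add_im, Complex.ofReal_im, Complex.im_ofReal_mul,
      Complex.I_im, Complex.one_im, mul_one, zero_add, smul_eq_mul] at h
    linear_combination h
  have hlim := ((((hvert β hβ hβ1).const_mul Complex.I).add (hhor (fun T => T) fun T => rfl)).sub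
    (hhor (fun T => -T) fun T => neg_sq T))
  have hlim1 := (hvert 1 one_pos le_rfl).const_mul Complex.I
  have := tendsto_nhds_unique (hlim1.congr hrect) hlim
  rw [add_zero, sub_zero] at this
  exact mul_left_cancel₀ Complex.I_ne_zero this

/-- The integrated Airy function as a contour integral. -/
def airyLine (β s : ℝ) : ℂ := (2 * Real.pi : ℂ)⁻¹ * ∫ τ : ℝ, airyIntegrand s (β + τ * Complex.I)

theorem conj_airyLine (β s : ℝ) : (starRingEnd ℂ) (airyLine β s) = airyLine β s := by
  have h : ∀ τ : ℝ, (starRingEnd ℂ) (airyIntegrand s (β + τ * Complex.I))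
      = airyIntegrand s (β + (-τ : ℝ) * Complex.I) := by
    intro τ
    have hv : (starRingEnd ℂ) (β + τ * Complex.I) = β + (-τ : ℝ) * Complex.I := by
      simp [Complex.conj_ofReal]
    rw [airyIntegrand, map_div₀, ← Complex.exp_conj, ← hv, airyIntegrand]
    simp [Complex.conj_ofReal, Complex.conj_ofNat]
  rw [airyLine, map_mul, ← integral_conj]
  simp only [h]
  rw [integral_neg_eq_self (fun τ : ℝ => airyIntegrand s (β + τ * Complex.I))]
  simp [Complex.conj_ofReal, Complex.conj_ofNat]

/-- On Re v = 1 the integral of exp(-t v) over t > 0 is 1/v, so Fubini produces the simple pole. The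
line then moves to Re v = β without crossing 0, and its integral is real, so taking real parts in
`airyAi` loses nothing. -/
theorem integral_airyAi (s : ℝ) {β : ℝ} (hβ : 0 < β) (hβ1 : β ≤ 1) :
    ((∫ t in Set.Ioi (0 : ℝ), airyAi (s + t) : ℝ) : ℂ) = airyLine β s := by
  set F : ℝ → ℝ → ℂ := fun t τ => Complex.exp ((((1 : ℝ) : ℂ) + τ * Complex.I) ^ 3 / 3
    - ((s + t : ℝ) : ℂ) * (((1 : ℝ) : ℂ) + τ * Complex.I))
  have hF : Integrable (Function.uncurry F)
      ((volume.restrict (Set.Ioi (0 : ℝ))).prod volume) := by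
    have h1 : Integrable (fun t : ℝ => Real.exp (1 / 3 - s) * Real.exp (-t))
        (volume.restrict (Set.Ioi (0 : ℝ))) :=
      (integrableOn_exp_neg_Ioi 0).const_mul _
    have h2 := h1.mul_prod (integrable_exp_neg_mul_sq one_pos)
    refine h2.mono' ?_ (Filter.Eventually.of_forall fun p => ?_)
    · refine Continuous.aestronglyMeasurable ?_
      simp only [F]
      fun_prop
    · simp only [F, Function.uncurry, norm_airyExp]
      rw [← Real.exp_add, ← Real.exp_add, ← Real.exp_add]
      refine le_of_eq ?_
      congr 1
      ring
  have hswap := integral_integral_swap hF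
  have hinner : ∀ τ : ℝ, ∫ t in Set.Ioi (0 : ℝ), F t τ
      = airyIntegrand s (((1 : ℝ) : ℂ) + τ * Complex.I) := by
    intro τ
    set v : ℂ := ((1 : ℝ) : ℂ) + τ * Complex.I with hv
    have hvre : (-v).re < 0 := by simp [hv]
    have h := integral_exp_mul_complex_Ioi hvre 0
    have hv0 : v ≠ 0 := add_mul_I_ne_zero one_pos τ
    have e : ∀ t : ℝ, F t τ = Complex.exp (v ^ 3 / 3 - s * v) * Complex.exp (-v * t) := by
      intro t
      rw [← Complex.exp_add]
      simp only [F, ← hv]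
      congr 1
      push_cast
      ring
    simp only [e]
    rw [integral_const_mul, h, airyIntegrand]
    simp
    rfl
  simp only [hinner] at hswap
  have hint : Integrable (fun t => ∫ τ, F t τ) (volume.restrict (Set.Ioi (0 : ℝ))) :=
    hF.integral_prod_left
  have hre : ∫ t in Set.Ioi (0 : ℝ), airyAi (s + t) = (airyLine 1 s).re := by
    have e : ∀ t, airyAi (s + t) = RCLike.re ((1 / (2 * Real.pi) : ℂ) * ∫ τ, F t τ) := by
      intro t
      simp only [airyAi, F, Complex.ofReal_one]
      rfl
    simp only [e]
    rw [integral_re (hint.const_mul _), integral_const_mul, hswap, airyLine, one_div]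
    rfl
  have hline : airyLine 1 s = airyLine β s := by
    rw [airyLine, airyLine, integral_airyIntegrand_shift s hβ hβ1]
  rw [hre, hline]
  exact Complex.conj_eq_iff_re.1 (conj_airyLine β s)

/-! ### Hyperbolic functions on a vertical line -/

theorem sinh_add_mul_I (b a : ℝ) : Complex.sinh (b + a * Complex.I)
    = (Real.sinh b * Real.cos a : ℝ) + (Real.cosh b * Real.sin a : ℝ) * Complex.I := by
  rw [Complex.sinh_add, Complex.cosh_mul_I, Complex.sinh_mul_I]
  push_cast
  ring

theorem cosh_add_mul_I (b a : ℝ) : Complex.cosh (b + a * Complex.I)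
    = (Real.cosh b * Real.cos a : ℝ) + (Real.sinh b * Real.sin a : ℝ) * Complex.I := by
  rw [Complex.cosh_add, Complex.cosh_mul_I, Complex.sinh_mul_I]
  push_cast
  ring

theorem norm_sinh_sq (b a : ℝ) :
    ‖Complex.sinh (b + a * Complex.I)‖ ^ 2 = Real.sinh b ^ 2 + Real.sin a ^ 2 := by
  rw [← Complex.normSq_eq_norm_sq, sinh_add_mul_I, Complex.normSq_add_mul_I]
  have h1 := Real.cosh_sq b
  have h2 := Real.sin_sq_add_cos_sq a
  nlinarith

theorem norm_cosh_sq (b a : ℝ) :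
    ‖Complex.cosh (b + a * Complex.I)‖ ^ 2 = Real.sinh b ^ 2 + Real.cos a ^ 2 := by
  rw [← Complex.normSq_eq_norm_sq, cosh_add_mul_I, Complex.normSq_add_mul_I]
  have h1 := Real.cosh_sq b
  have h2 := Real.sin_sq_add_cos_sq a
  nlinarith

theorem re_sinh_div_cosh (b a : ℝ) :
    (Complex.sinh (b + a * Complex.I) / Complex.cosh (b + a * Complex.I)).re
      = Real.sinh b * Real.cosh b / (Real.sinh b ^ 2 + Real.cos a ^ 2) := by
  rw [Complex.div_re, Complex.normSq_eq_norm_sq, norm_cosh_sq, sinh_add_mul_I, cosh_add_mul_I,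
    ← add_div]
  congr 1
  have h2 := Real.sin_sq_add_cos_sq a
  simp only [Complex.add_re, Complex.ofReal_re, Complex.re_ofReal_mul, Complex.I_re, mul_zero,
    add_zero, Complex.add_im, Complex.ofReal_im, Complex.im_ofReal_mul, Complex.I_im, mul_one,
    zero_add]
  linear_combination Real.sinh b * Real.cosh b * h2

/-- The difference has derivative x² - tanh² x, which is nonnegative because 0 ≤ tanh x ≤ x. -/
theorem self_sub_cube_le_tanh {b : ℝ} (hb : 0 ≤ b) :
    b - b ^ 3 / 3 ≤ Real.sinh b / Real.cosh b := by
  have hder : ∀ x : ℝ, HasDerivAt (fun x => Real.sinh x / Real.cosh x - (x - x ^ 3 / 3))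
      (1 - (Real.sinh x / Real.cosh x) ^ 2 - (1 - x ^ 2)) x := by
    intro x
    have hc := (Real.cosh_pos x).ne'
    have h1 := (Real.hasDerivAt_sinh x).div (Real.hasDerivAt_cosh x) hc
    have h2 := (hasDerivAt_id x).sub (((hasDerivAt_id x).pow 3).div_const 3)
    refine (h1.sub h2).congr_deriv ?_
    simp only [id]
    field_simp
    push_cast
    ring
  have hmono : MonotoneOn (fun x => Real.sinh x / Real.cosh x - (x - x ^ 3 / 3)) (Set.Ici 0) := by
    refine monotoneOn_of_deriv_nonneg (convex_Ici 0)
      (fun x _ => (hder x).continuousAt.continuousWithinAt)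
      (fun x _ => (hder x).differentiableAt.differentiableWithinAt) fun x hx => ?_
    rw [interior_Ici] at hx
    have hx0 : (0 : ℝ) ≤ x := le_of_lt hx
    rw [(hder x).deriv]
    have hle : Real.sinh x / Real.cosh x ≤ x := by
      rw [div_le_iff₀ (Real.cosh_pos x)]
      have hmono2 : MonotoneOn (fun x => x * Real.cosh x - Real.sinh x) (Set.Ici 0) := by
        have hd2 : ∀ y : ℝ, HasDerivAt (fun x => x * Real.cosh x - Real.sinh x)
            (y * Real.sinh y) y := fun y =>
          (((hasDerivAt_id y).mul (Real.hasDerivAt_cosh y)).sub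
            (Real.hasDerivAt_sinh y)).congr_deriv (by simp)
        refine monotoneOn_of_deriv_nonneg (convex_Ici 0)
          (fun y _ => (hd2 y).continuousAt.continuousWithinAt)
          (fun y _ => (hd2 y).differentiableAt.differentiableWithinAt) fun y hy => ?_
        rw [interior_Ici] at hy
        rw [(hd2 y).deriv]
        exact mul_nonneg (le_of_lt hy) (Real.sinh_nonneg_iff.2 (le_of_lt hy))
      have := hmono2 (Set.mem_Ici.2 le_rfl) (Set.mem_Ici.2 hx0) hx0
      simp at this
      linarith
    have h0 : 0 ≤ Real.sinh x / Real.cosh x :=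
      div_nonneg (Real.sinh_nonneg_iff.2 hx0) (Real.cosh_pos x).le
    nlinarith
  have := hmono (Set.mem_Ici.2 le_rfl) (Set.mem_Ici.2 hb) hb
  simp at this
  linarith

theorem quarter_sq_le_sin_sq {a : ℝ} (ha : |a| ≤ Real.pi / 2) : a ^ 2 / 4 ≤ Real.sin a ^ 2 := by
  have h1 := Real.mul_le_sin (abs_nonneg a) ha
  have h2 : (1 / 2) * |a| ≤ 2 / Real.pi * |a| := by
    refine mul_le_mul_of_nonneg_right ?_ (abs_nonneg a)
    rw [div_le_div_iff₀ two_pos Real.pi_pos]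
    linarith [Real.pi_le_four]
  have h3 : Real.sin |a| ^ 2 = Real.sin a ^ 2 := by
    rcases abs_cases a with h | h <;> rw [h.1]
    rw [Real.sin_neg, neg_sq]
  rw [← h3, ← sq_abs a]
  have h4 : 0 ≤ |a| := abs_nonneg a
  nlinarith

theorem half_le_cos {a : ℝ} (ha : |a| ≤ 1) : 1 / 2 ≤ Real.cos a := by
  rw [← Real.cos_abs, ← Real.cos_pi_div_three]
  have := Real.pi_gt_three
  exact Real.cos_le_cos_of_nonneg_of_le_pi (abs_nonneg a) (by linarith) (by linarith)

/-- On a strip around the real axis the hyperbolic tangent is well approximated by its Taylor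
polynomial. -/
theorem norm_tanh_sub_le {b a : ℝ} (ha : |a| ≤ 1) :
    ‖Complex.sinh (b + a * Complex.I) / Complex.cosh (b + a * Complex.I) - (b + a * Complex.I)
      + (b + a * Complex.I) ^ 3 / 3‖ ≤ 80 * ‖(b + a * Complex.I : ℂ)‖ ^ 5 := by
  set w : ℂ := b + a * Complex.I
  -- `S` is convex, contains 0 and keeps cosh away from zero, so the mean value inequality applies
  -- from the origin.
  set S : Set ℂ := {v | |v.im| ≤ 1} ∩ Metric.closedBall 0 ‖w‖
  have hS : Convex ℝ S := by
    refine Convex.inter ?_ (convex_closedBall 0 _)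
    have : {v : ℂ | |v.im| ≤ 1} = Complex.imCLM ⁻¹' Set.Icc (-1) 1 := by
      ext v; simp [abs_le]
    rw [this]
    exact (convex_Icc (-1 : ℝ) 1).linear_preimage Complex.imCLM.toLinearMap
  have hwS : w ∈ S := ⟨by simpa [w] using ha, by simp⟩
  have h0S : (0 : ℂ) ∈ S := ⟨by simp, by simp⟩
  have hcosh : ∀ v ∈ S, 1 / 2 ≤ ‖Complex.cosh v‖ := by
    intro v hv
    have h1 := norm_cosh_sq v.re v.im
    rw [Complex.re_add_im] at h1
    have h2 := half_le_cos hv.1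
    refine abs_le_of_sq_le_sq' ?_ (norm_nonneg _) |>.2
    rw [h1]
    nlinarith [sq_nonneg (Real.sinh v.re)]
  have hne : ∀ v ∈ S, Complex.cosh v ≠ 0 := fun v hv =>
    norm_pos_iff.1 (lt_of_lt_of_le (by norm_num) (hcosh v hv))
  set t : ℂ → ℂ := fun v => Complex.sinh v / Complex.cosh v
  have hcs : ∀ v, Complex.cosh v ^ 2 - Complex.sinh v ^ 2 = 1 := Complex.cosh_sq_sub_sinh_sq
  have ht : ∀ v ∈ S, HasDerivAt t (1 / Complex.cosh v ^ 2) v := by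
    intro v hv
    refine ((Complex.hasDerivAt_sinh v).div (Complex.hasDerivAt_cosh v) (hne v hv)).congr_deriv ?_
    congr 1
    rw [← hcs v]; ring
  have hid : ∀ v ∈ S, 1 / Complex.cosh v ^ 2 = 1 - t v ^ 2 := by
    intro v hv
    have := hne v hv
    simp only [t]
    field_simp
    exact (hcs v).symm
  have hball : ∀ v ∈ S, ‖v‖ ≤ ‖w‖ := fun v hv => mem_closedBall_zero_iff.1 hv.2
  have hsub : ∀ v ∈ S, ∀ u ∈ S ∩ Metric.closedBall 0 ‖v‖, u ∈ S ∧ ‖u‖ ≤ ‖v‖ := fun v _ u hu =>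
    ⟨hu.1, mem_closedBall_zero_iff.1 hu.2⟩
  have hconv : ∀ v : ℂ, Convex ℝ (S ∩ Metric.closedBall 0 ‖v‖) := fun v =>
    hS.inter (convex_closedBall 0 _)
  have hmv : ∀ v ∈ S, ∀ {f f' : ℂ → ℂ} {C : ℝ}, f 0 = 0 →
      (∀ u ∈ S, HasDerivAt f (f' u) u) → (∀ u ∈ S, ‖u‖ ≤ ‖v‖ → ‖f' u‖ ≤ C) →
      ‖f v‖ ≤ C * ‖v‖ := by
    intro v hv f f' C hf0 hf hC
    have := (hconv v).norm_image_sub_le_of_norm_hasDerivWithin_le (f := f) (f' := f') (C := C)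
      (fun u hu => (hf u hu.1).hasDerivWithinAt)
      (fun u hu => hC u hu.1 (hsub v hv u hu).2)
      (x := 0) (y := v) ⟨h0S, by simp⟩ ⟨hv, by simp⟩
    simpa [hf0] using this
  -- Bootstrap on tanh' = 1 - tanh²: each bound controls the next derivative, the last one being -(t
  -- - v)(t + v), whence 80 = 16 · 5.
  have b1 : ∀ v ∈ S, ‖t v‖ ≤ 4 * ‖v‖ := by
    intro v hv
    refine hmv v hv (by simp [t]) ht fun u hu _ => ?_
    rw [norm_div, norm_one, norm_pow, div_le_iff₀ (by have := hcosh u hu; positivity)]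
    nlinarith [hcosh u hu]
  have b2 : ∀ v ∈ S, ‖t v - v‖ ≤ 16 * ‖v‖ ^ 3 := by
    intro v hv
    have := hmv v hv (f := fun v => t v - v) (f' := fun v => -(t v ^ 2)) (C := 16 * ‖v‖ ^ 2)
      (by simp [t])
      (fun u hu => ((ht u hu).sub (hasDerivAt_id u)).congr_deriv (by rw [hid u hu]; ring))
      (fun u hu huv => by
        rw [norm_neg, norm_pow]
        calc ‖t u‖ ^ 2 ≤ (4 * ‖u‖) ^ 2 := by gcongr; exact b1 u hu
          _ ≤ (4 * ‖v‖) ^ 2 := by gcongr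
          _ = _ := by ring)
    exact this.trans (le_of_eq (by ring))
  have := hmv w hwS (f := fun v => t v - v + v ^ 3 / 3) (f' := fun v => -(t v - v) * (t v + v))
    (C := 80 * ‖w‖ ^ 4) (by simp [t])
    (fun u hu => (((ht u hu).sub (hasDerivAt_id u)).add
      (((hasDerivAt_id u).pow 3).div_const 3)).congr_deriv (by
        rw [hid u hu]; simp only [id]; push_cast; ring))
    (fun u hu huv => by
      rw [norm_mul, norm_neg]
      have h3 : ‖t u + u‖ ≤ 5 * ‖u‖ := (norm_add_le _ _).trans (by linarith [b1 u hu])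
      calc ‖t u - u‖ * ‖t u + u‖ ≤ 16 * ‖u‖ ^ 3 * (5 * ‖u‖) := by gcongr; exact b2 u hu
        _ = 80 * ‖u‖ ^ 4 := by ring
        _ ≤ 80 * ‖w‖ ^ 4 := by gcongr)
  exact this.trans (le_of_eq (by ring))

/-- An entire function vanishing to second order at the origin. -/
theorem exists_norm_le_mul_sq {f : ℂ → ℂ} (hf : Differentiable ℂ f) (h0 : f 0 = 0)
    (h1 : deriv f 0 = 0) (R : ℝ) :
    ∃ C : ℝ, 0 ≤ C ∧ ∀ w : ℂ, ‖w‖ ≤ R → ‖f w‖ ≤ C * ‖w‖ ^ 2 := by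
  have hds : ∀ {g : ℂ → ℂ}, Differentiable ℂ g → Differentiable ℂ (dslope g 0) := fun hg =>
    differentiableOn_univ.1 ((Complex.differentiableOn_dslope Filter.univ_mem).2
      hg.differentiableOn)
  set g := dslope f 0
  have hg0 : g 0 = 0 := by simp only [g, dslope_same, h1]
  obtain ⟨C, hC⟩ := (isCompact_closedBall (0 : ℂ) R).exists_bound_of_continuousOn
    (hds (hds hf)).continuous.continuousOn
  refine ⟨|C|, abs_nonneg C, fun w hw => ?_⟩
  have e1 : f w = w * g w := by
    have := sub_smul_dslope f 0 w
    simpa [h0] using this.symm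
  have e2 : g w = w * dslope g 0 w := by
    have := sub_smul_dslope g 0 w
    simpa [hg0] using this.symm
  have h3 := (hC w (mem_closedBall_zero_iff.2 hw)).trans (le_abs_self C)
  rw [e1, e2, norm_mul, norm_mul]
  calc ‖w‖ * (‖w‖ * ‖dslope g 0 w‖) ≤ ‖w‖ * (‖w‖ * |C|) := by gcongr
    _ = _ := by ring

theorem half_norm_le_norm_sinh {b a : ℝ} (hb : 0 ≤ b) (ha : |a| ≤ Real.pi / 2) :
    ‖(b + a * Complex.I : ℂ)‖ / 2 ≤ ‖Complex.sinh (b + a * Complex.I)‖ := by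
  refine abs_le_of_sq_le_sq' ?_ (norm_nonneg _) |>.2
  rw [norm_sinh_sq, div_pow, ← Complex.normSq_eq_norm_sq, Complex.normSq_add_mul_I]
  have h1 := quarter_sq_le_sin_sq ha
  have h2 : b ≤ Real.sinh b := Real.self_le_sinh_iff.2 hb
  have h3 : b ^ 2 ≤ Real.sinh b ^ 2 := by gcongr
  nlinarith [sq_nonneg b]

/-- The amplitude of the bulk integrand has a simple pole with residue one. -/
theorem exists_norm_amplitude_sub_le (d : ℕ) (B : ℝ) :
    ∃ C : ℝ, 0 ≤ C ∧ ∀ b a : ℝ, 0 < b → b ≤ B → |a| ≤ 1 →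
      ‖1 / (Complex.sinh (b + a * Complex.I) * Complex.cosh (b + a * Complex.I) ^ d)
        - 1 / (b + a * Complex.I)‖ ≤ C := by
  -- `f` vanishes to second order at 0, which cancels the double zero in the denominator of the
  -- difference of reciprocals.
  set f : ℂ → ℂ := fun w => Complex.sinh w * Complex.cosh w ^ d - w
  have hf : Differentiable ℂ f := by fun_prop
  have hder : HasDerivAt f 0 0 := by
    have h := ((Complex.hasDerivAt_sinh 0).mul ((Complex.hasDerivAt_cosh 0).pow d)).sub
      (hasDerivAt_id 0)
    exact h.congr_deriv (by simp)
  obtain ⟨C, hC, hCle⟩ := exists_norm_le_mul_sq hf (by simp [f]) hder.deriv (B + 1)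
  refine ⟨C * 2 * 2 ^ d, by positivity, fun b a hb hbB ha => ?_⟩
  set w : ℂ := b + a * Complex.I with hw
  have hw0 : w ≠ 0 := add_mul_I_ne_zero hb a
  have hwpos : 0 < ‖w‖ := norm_pos_iff.2 hw0
  have hpi : |a| ≤ Real.pi / 2 := ha.trans (by linarith [Real.pi_gt_three])
  have hsinh : ‖w‖ / 2 ≤ ‖Complex.sinh w‖ := half_norm_le_norm_sinh hb.le hpi
  have hcosh : 1 / 2 ≤ ‖Complex.cosh w‖ := by
    refine abs_le_of_sq_le_sq' ?_ (norm_nonneg _) |>.2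
    rw [norm_cosh_sq]
    nlinarith [sq_nonneg (Real.sinh b), half_le_cos ha]
  have hs0 : Complex.sinh w ≠ 0 := norm_pos_iff.1 (lt_of_lt_of_le (by positivity) hsinh)
  have hc0 : Complex.cosh w ≠ 0 := norm_pos_iff.1 (lt_of_lt_of_le (by norm_num) hcosh)
  have hwn : ‖w‖ ≤ B + 1 := by
    refine (norm_add_le _ _).trans ?_
    rw [norm_mul, Complex.norm_I, mul_one, Complex.norm_real, Complex.norm_real, Real.norm_eq_abs,
      Real.norm_eq_abs, abs_of_pos hb]
    linarith
  have e : 1 / (Complex.sinh w * Complex.cosh w ^ d) - 1 / w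
      = -f w / (w * (Complex.sinh w * Complex.cosh w ^ d)) := by
    simp only [f]
    have := pow_ne_zero d hc0
    field_simp
    ring
  rw [e, norm_div, norm_neg, norm_mul, norm_mul, norm_pow, div_le_iff₀ (by positivity)]
  calc ‖f w‖ ≤ C * ‖w‖ ^ 2 := hCle w hwn
    _ = C * 2 * 2 ^ d * (‖w‖ * (‖w‖ / 2 * (1 / 2) ^ d)) := by
      rw [div_pow, one_pow]; field_simp
    _ ≤ C * 2 * 2 ^ d * (‖w‖ * (‖Complex.sinh w‖ * ‖Complex.cosh w‖ ^ d)) := by gcongr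

theorem norm_exp_sub_exp_le {z₁ z₂ : ℂ} {m : ℝ} (h₁ : z₁.re ≤ m) (h₂ : z₂.re ≤ m) :
    ‖Complex.exp z₁ - Complex.exp z₂‖ ≤ Real.exp m * ‖z₁ - z₂‖ := by
  have hconv : Convex ℝ {z : ℂ | z.re ≤ m} := convex_halfSpace_re_le m
  refine hconv.norm_image_sub_le_of_norm_hasDerivWithin_le (f := Complex.exp) (f' := Complex.exp)
    (fun z _ => (Complex.hasDerivAt_exp z).hasDerivWithinAt) (fun z hz => ?_) h₂ h₁
  rw [Complex.norm_exp]
  exact Real.exp_le_exp.2 hz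

/-- The real part of tanh(b + ia) is tanh b plus tanh b sin² a / (sinh² b + cos² a). The first part
is at least b - b³/3; the second supplies all the decay in `a`. -/
theorem re_bulkExponent_le {b a X : ℝ} (Y : ℝ) (hb : 0 < b) (hX : 0 ≤ X) :
    (-X * (Complex.sinh (b + a * Complex.I) / Complex.cosh (b + a * Complex.I))
        + Y * (b + a * Complex.I) : ℂ).re
      ≤ (Y - X) * b + X * (b ^ 3 / 3)
        - X * (Real.sinh b / Real.cosh b) * Real.sin a ^ 2
          / (Real.sinh b ^ 2 + Real.cos a ^ 2) := by
  have hre : (-X * (Complex.sinh (b + a * Complex.I) / Complex.cosh (b + a * Complex.I))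
        + Y * (b + a * Complex.I) : ℂ).re
      = -X * (Real.sinh b * Real.cosh b / (Real.sinh b ^ 2 + Real.cos a ^ 2)) + Y * b := by
    rw [Complex.add_re, ← Complex.ofReal_neg, Complex.re_ofReal_mul, Complex.re_ofReal_mul,
      re_sinh_div_cosh]
    simp
  have hs : 0 < Real.sinh b := Real.sinh_pos_iff.2 hb
  have hc : 0 < Real.cosh b := Real.cosh_pos b
  have hP : 0 < Real.sinh b ^ 2 + Real.cos a ^ 2 := by positivity
  have hid : Real.sinh b * Real.cosh b / (Real.sinh b ^ 2 + Real.cos a ^ 2)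
      = Real.sinh b / Real.cosh b + (Real.sinh b / Real.cosh b) * Real.sin a ^ 2
        / (Real.sinh b ^ 2 + Real.cos a ^ 2) := by
    have h1 := Real.cosh_sq b
    have h2 := Real.sin_sq_add_cos_sq a
    field_simp
    rw [h1]
    linear_combination -h2
  have htanh := mul_le_mul_of_nonneg_left (self_sub_cube_le_tanh hb.le) hX
  have e : X * (Real.sinh b / Real.cosh b) * Real.sin a ^ 2 / (Real.sinh b ^ 2 + Real.cos a ^ 2)
      = X * ((Real.sinh b / Real.cosh b) * Real.sin a ^ 2
        / (Real.sinh b ^ 2 + Real.cos a ^ 2)) := by ring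
  rw [hre, hid, e]
  nlinarith

/-! ### Admissible parameters and the choice of contour -/

/-- The admissible parameters: `q³ = 2E/ħ`, `X = 2H/ħ`, and `Y` close to `q³`. -/
structure Admissible (q₀ κ K D q s X Y : ℝ) : Prop where
  q₀_pos : 0 < q₀
  κ_pos : 0 < κ
  K_nonneg : 0 ≤ K
  D_nonneg : 0 ≤ D
  q₀_le : q₀ ≤ q
  X_eq : X = q ^ 3 + s * q
  le_X : κ * q ^ 3 ≤ X
  X_le : X ≤ K * q ^ 3
  Y_le : |Y - q ^ 3| ≤ D

/-- The abscissa of the contour. -/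
def abscissa (q s : ℝ) : ℝ := 1 / (q * (1 + |s|))


theorem Admissible.q_pos {q₀ κ K D q s X Y : ℝ} (h : Admissible q₀ κ K D q s X Y) : 0 < q :=
  h.q₀_pos.trans_le h.q₀_le

theorem Admissible.X_nonneg {q₀ κ K D q s X Y : ℝ} (h : Admissible q₀ κ K D q s X Y) : 0 ≤ X := by
  have := h.q_pos
  have := h.κ_pos
  exact le_trans (by positivity) h.le_X

theorem one_le_one_add_abs (s : ℝ) : 1 ≤ 1 + |s| := by linarith [abs_nonneg s]

theorem abscissa_pos {q : ℝ} (hq : 0 < q) (s : ℝ) : 0 < abscissa q s := by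
  have := one_le_one_add_abs s
  unfold abscissa
  positivity

/-- In v = q w the contour is Re v = 1/(1 + |s|); both Re v and |s| Re v are at most 1, so (Re v)³/3
and s Re v stay bounded uniformly in `s`. -/
theorem mul_abscissa {q : ℝ} (hq : 0 < q) (s : ℝ) : q * abscissa q s = 1 / (1 + |s|) := by
  unfold abscissa
  have := one_le_one_add_abs s
  field_simp

theorem mul_abscissa_le_one {q : ℝ} (hq : 0 < q) (s : ℝ) : q * abscissa q s ≤ 1 := by
  rw [mul_abscissa hq]
  exact div_le_one_of_le₀ (one_le_one_add_abs s) (by linarith [one_le_one_add_abs s])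

theorem abs_mul_mul_abscissa_le_one {q : ℝ} (hq : 0 < q) (s : ℝ) :
    |s| * (q * abscissa q s) ≤ 1 := by
  rw [mul_abscissa hq, mul_one_div]
  exact div_le_one_of_le₀ (by linarith) (by linarith [one_le_one_add_abs s])

theorem Admissible.abscissa_le {q₀ κ K D q s X Y : ℝ} (h : Admissible q₀ κ K D q s X Y) :
    abscissa q s ≤ 1 / q₀ := by
  have h1 := mul_abscissa_le_one h.q_pos s
  have h2 := abscissa_pos h.q_pos s
  rw [le_div_iff₀ h.q₀_pos]
  nlinarith [h.q₀_le]

theorem cube_mul_abscissa {q : ℝ} (hq : 0 < q) (s : ℝ) :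
    q ^ 3 * abscissa q s = q ^ 2 / (1 + |s|) := by
  have := mul_abscissa hq s
  calc q ^ 3 * abscissa q s = q ^ 2 * (q * abscissa q s) := by ring
    _ = _ := by rw [this]; ring

/-- The decay rate q³b = q²/(1 + |s|) stays away from zero: |s| q = |X - q³| ≤ (K + 1) q³ forces |s|
≤ (K + 1) q². This is what controls the ends of the segment, where cosh may be small. -/
theorem Admissible.le_cube_mul_abscissa {q₀ κ K D q s X Y : ℝ}
    (h : Admissible q₀ κ K D q s X Y) :
    1 / (1 / q₀ ^ 2 + K + 1) ≤ q ^ 3 * abscissa q s := by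
  have hq := h.q_pos
  have hq0 := h.q₀_pos
  have hK := h.K_nonneg
  rw [cube_mul_abscissa hq, div_le_div_iff₀ (by positivity)
    (by linarith [one_le_one_add_abs s]), one_mul]
  have h1 : |s| * q ≤ (K + 1) * q ^ 3 := by
    have : |s| * q = |s * q| := by rw [abs_mul, abs_of_pos hq]
    have e : s * q = X - q ^ 3 := by rw [h.X_eq]; ring
    have hq3 : 0 < q ^ 3 := by positivity
    have hX := h.X_nonneg
    rw [this, e, abs_le]
    constructor
    · nlinarith
    · linarith [h.X_le]
  have h2 : |s| ≤ (K + 1) * q ^ 2 := by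
    have : |s| * q ≤ ((K + 1) * q ^ 2) * q := h1.trans (le_of_eq (by ring))
    exact le_of_mul_le_mul_right this hq
  have h3 : 1 ≤ q ^ 2 * (1 / q₀ ^ 2) := by
    rw [mul_one_div, le_div_iff₀ (by positivity), one_mul]
    gcongr
    exact h.q₀_le
  nlinarith

/-- Decay of the exponential in the bulk integrand along the contour. -/
theorem Admissible.re_bulkExponent_le {q₀ κ K D q s X Y : ℝ}
    (h : Admissible q₀ κ K D q s X Y) (a : ℝ) :
    (-X * (Complex.sinh (abscissa q s + a * Complex.I)
        / Complex.cosh (abscissa q s + a * Complex.I))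
        + Y * (abscissa q s + a * Complex.I) : ℂ).re
      ≤ D / q₀ + 1 + K / 3 - κ / Real.cosh (1 / q₀) * (q ^ 3 * abscissa q s) * Real.sin a ^ 2
          / ‖Complex.cosh (abscissa q s + a * Complex.I)‖ ^ 2 := by
  have hq := h.q_pos
  set b := abscissa q s
  have hb : 0 < b := abscissa_pos hq s
  have hle := WignerOscillator.re_bulkExponent_le (a := a) Y hb h.X_nonneg
  have hs : 0 < Real.sinh b := Real.sinh_pos_iff.2 hb
  have hP : 0 < Real.sinh b ^ 2 + Real.cos a ^ 2 := by positivity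
  have hK := h.K_nonneg
  have hκ := h.κ_pos
  have hqb : q * b ≤ 1 := mul_abscissa_le_one hq s
  -- The growth terms are bounded because b ≤ 1/q₀, |s| q b ≤ 1 and q b ≤ 1; only the decay term
  -- remains.
  have h1 : (Y - X) * b ≤ D / q₀ + 1 := by
    have e : (Y - X) * b = (Y - q ^ 3) * b + -s * (q * b) := by rw [h.X_eq]; ring
    have e1 : (Y - q ^ 3) * b ≤ D * (1 / q₀) :=
      mul_le_mul ((le_abs_self _).trans h.Y_le) h.abscissa_le hb.le h.D_nonneg
    have e2 : -s * (q * b) ≤ |s| * (q * b) := by gcongr; exact neg_le_abs s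
    have e3 := abs_mul_mul_abscissa_le_one hq s
    rw [e, div_eq_mul_one_div]
    linarith
  have h2 : X * (b ^ 3 / 3) ≤ K / 3 := by
    calc X * (b ^ 3 / 3) ≤ K * q ^ 3 * (b ^ 3 / 3) := by gcongr; exact h.X_le
      _ = K / 3 * (q * b) ^ 3 := by ring
      _ ≤ K / 3 * 1 ^ 3 := by gcongr
      _ = K / 3 := by ring
  have hcosh : Real.cosh b ≤ Real.cosh (1 / q₀) := by
    rw [Real.cosh_le_cosh, abs_of_pos hb, abs_of_pos (by have := h.q₀_pos; positivity)]
    exact h.abscissa_le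
  have h3 : κ / Real.cosh (1 / q₀) * (q ^ 3 * b) ≤ X * (Real.sinh b / Real.cosh b) := by
    have : b / Real.cosh (1 / q₀) ≤ Real.sinh b / Real.cosh b := by
      have hc := Real.cosh_pos b
      have := Real.self_le_sinh_iff.2 hb.le
      gcongr
    calc κ / Real.cosh (1 / q₀) * (q ^ 3 * b) = κ * q ^ 3 * (b / Real.cosh (1 / q₀)) := by ring
      _ ≤ X * (Real.sinh b / Real.cosh b) :=
        mul_le_mul h.le_X this (by have := Real.cosh_pos (1 / q₀); positivity) h.X_nonneg
  have h4 : κ / Real.cosh (1 / q₀) * (q ^ 3 * b) * Real.sin a ^ 2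
        / (Real.sinh b ^ 2 + Real.cos a ^ 2)
      ≤ X * (Real.sinh b / Real.cosh b) * Real.sin a ^ 2
        / (Real.sinh b ^ 2 + Real.cos a ^ 2) := by gcongr
  rw [norm_cosh_sq]
  linarith

/-! ### Comparison of the integrands near the pole -/

/-- The Airy integrand in the scale of the bulk integrand. -/
def airyRescaled (q s : ℝ) (w : ℂ) : ℂ := Complex.exp (q ^ 3 * (w ^ 3 / 3) - s * q * w) / w

theorem airyRescaled_eq {q : ℝ} (hq : 0 < q) (s : ℝ) (w : ℂ) :
    airyRescaled q s w = q * airyIntegrand s (q * w) := by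
  have : (q : ℂ) ≠ 0 := by exact_mod_cast hq.ne'
  rw [airyRescaled, airyIntegrand, mul_div_mul_left _ _ this |>.symm]
  rw [mul_div_assoc]
  congr 3
  ring

/-- With v = q w the decay is again governed by q³ b a²; the constant is 1/3 from (q b)³/3 plus 1
from |s| q b. -/
theorem re_airyExponent_le {q : ℝ} (hq : 0 < q) (s a : ℝ) :
    (q ^ 3 * ((abscissa q s + a * Complex.I) ^ 3 / 3) - s * q * (abscissa q s + a * Complex.I)
      : ℂ).re ≤ 4 / 3 - q ^ 3 * abscissa q s * a ^ 2 := by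
  set b := abscissa q s
  have hb : 0 < b := abscissa_pos hq s
  have h := norm_airyExp s (q * b) (q * a)
  rw [Complex.norm_exp, ← Real.exp_add, Real.exp_eq_exp] at h
  have e : (q ^ 3 * ((b + a * Complex.I) ^ 3 / 3) - s * q * (b + a * Complex.I) : ℂ)
      = (((q * b : ℝ) : ℂ) + ((q * a : ℝ) : ℂ) * Complex.I) ^ 3 / 3
        - s * (((q * b : ℝ) : ℂ) + ((q * a : ℝ) : ℂ) * Complex.I) := by
    push_cast; ring
  rw [e, h]
  have hqb : q * b ≤ 1 := mul_abscissa_le_one hq s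
  have h1 : (q * b) ^ 3 ≤ 1 := pow_le_one₀ (by positivity) hqb
  have h2 : -s * (q * b) ≤ |s| * (q * b) := by gcongr; exact neg_le_abs s
  have h3 := abs_mul_mul_abscissa_le_one hq s
  have h4 : -(q * b) * (q * a) ^ 2 = -(q ^ 3 * b * a ^ 2) := by ring
  linarith

theorem exists_one_add_sq_mul_exp_le {c : ℝ} (hc : 0 < c) :
    ∃ C : ℝ, 0 ≤ C ∧ ∀ y : ℝ, 0 ≤ y →
      (1 + y) ^ 2 * Real.exp (-(2 * c) * y) ≤ C * Real.exp (-c * y) := by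
  refine ⟨2 / c ^ 2 * Real.exp c, by positivity, fun y hy => ?_⟩
  have h := Real.pow_div_factorial_le_exp (x := c * (1 + y)) (by positivity) 2
  have h1 : (1 + y) ^ 2 ≤ 2 / c ^ 2 * Real.exp (c * (1 + y)) := by
    calc (1 + y) ^ 2 = 2 / c ^ 2 * ((c * (1 + y)) ^ 2 / (Nat.factorial 2)) := by
          simp [Nat.factorial]; field_simp
      _ ≤ _ := by gcongr
  calc (1 + y) ^ 2 * Real.exp (-(2 * c) * y)
      ≤ 2 / c ^ 2 * Real.exp (c * (1 + y)) * Real.exp (-(2 * c) * y) := by gcongr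
    _ = 2 / c ^ 2 * Real.exp c * Real.exp (-c * y) := by
      rw [mul_assoc, ← Real.exp_add, mul_assoc, ← Real.exp_add]; congr 2; ring

/-- The relation X = q³ + s q cancels the leading linear and cubic terms; what remains is the
fifth-order error of tanh, a cubic of coefficient s q/3 and the rounding error Y - q³. -/
theorem bulkExponent_sub_airyExponent_eq {q s X Y : ℝ} (hX : X = q ^ 3 + s * q) (t w : ℂ) :
    (-X * t + Y * w) - (q ^ 3 * (w ^ 3 / 3) - s * q * w)
      = -X * (t - w + w ^ 3 / 3) + s * q * (w ^ 3 / 3) + (Y - q ^ 3 : ℝ) * w := by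
  rw [hX]; push_cast; ring

/-- Difference of the phases of the bulk and Airy integrands near the origin. -/
theorem Admissible.norm_exponent_sub_le {q₀ κ K D q s X Y : ℝ}
    (h : Admissible q₀ κ K D q s X Y) {a : ℝ} (ha : |a| ≤ 1) (w : ℂ)
    (hw : w = abscissa q s + a * Complex.I) :
    ‖(-X * (Complex.sinh w / Complex.cosh w) + Y * w)
        - (q ^ 3 * (w ^ 3 / 3) - s * q * w)‖
      ≤ ‖w‖ * ((160 * K + D + 1) * ((1 + (1 + |s|) ^ 2 / q)
          * (1 + q ^ 3 * abscissa q s * a ^ 2) ^ 2)) := by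
  have hq := h.q_pos
  have hK := h.K_nonneg
  have hD := h.D_nonneg
  have hσ := one_le_one_add_abs s
  set σ := 1 + |s| with hσdef
  set b := abscissa q s with hbdef
  have hb : 0 < b := abscissa_pos hq s
  have hb' : b = 1 / (q * σ) := rfl
  set y := q ^ 3 * b * a ^ 2 with hy
  have hy0 : 0 ≤ y := by positivity
  have hyb : y = q ^ 2 / σ * a ^ 2 := by rw [hy, hbdef, cube_mul_abscissa hq]
  have hw2 : ‖w‖ ^ 2 = b ^ 2 + a ^ 2 := by
    rw [hw, ← Complex.normSq_eq_norm_sq, Complex.normSq_add_mul_I]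
  have hσ0 : 0 < σ := by linarith
  have ha2 : a ^ 2 = y * σ / q ^ 2 := by rw [hyb]; field_simp
  have hR : 0 ≤ σ ^ 2 / q := by positivity
  have hb2 : b ^ 2 ≤ σ / q ^ 2 := by
    rw [hb', div_pow, one_pow, mul_pow, div_le_div_iff₀ (by positivity) (by positivity)]
    have : 1 ≤ σ ^ 3 := one_le_pow₀ hσ
    have hq2 : 0 < q ^ 2 := by positivity
    nlinarith
  -- In units of the Gaussian variable y = q³ b a², both b² and a² are O(σ/q²). One factor ‖w‖ is
  -- kept apart in the bounds below, to cancel the pole.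
  have hw2le : ‖w‖ ^ 2 ≤ (1 + y) * (σ / q ^ 2) := by
    rw [hw2, ha2, add_mul, one_mul]
    have : y * σ / q ^ 2 = y * (σ / q ^ 2) := by ring
    linarith
  have hw4 : q ^ 3 * ‖w‖ ^ 4 ≤ σ ^ 2 / q * (1 + y) ^ 2 := by
    calc q ^ 3 * ‖w‖ ^ 4 = q ^ 3 * (‖w‖ ^ 2) ^ 2 := by ring
      _ ≤ q ^ 3 * ((1 + y) * (σ / q ^ 2)) ^ 2 := by gcongr
      _ = σ ^ 2 / q * (1 + y) ^ 2 := by field_simp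
  have hsw : |s| * q * ‖w‖ ^ 2 ≤ σ ^ 2 / q * (1 + y) ^ 2 := by
    calc |s| * q * ‖w‖ ^ 2 ≤ σ * q * ((1 + y) * (σ / q ^ 2)) := by
          gcongr; linarith
      _ = σ ^ 2 / q * (1 + y) := by field_simp
      _ ≤ σ ^ 2 / q * (1 + y) ^ 2 := by
          gcongr
          exact le_self_pow₀ (by linarith) two_ne_zero
  have htanh : ‖Complex.sinh w / Complex.cosh w - w + w ^ 3 / 3‖ ≤ 80 * ‖w‖ ^ 5 := by
    rw [hw]; exact norm_tanh_sub_le ha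
  rw [bulkExponent_sub_airyExponent_eq h.X_eq]
  have n1 : ‖-(X : ℂ) * (Complex.sinh w / Complex.cosh w - w + w ^ 3 / 3)‖
      ≤ ‖w‖ * (80 * K * (σ ^ 2 / q * (1 + y) ^ 2)) := by
    rw [norm_mul, norm_neg, Complex.norm_real, Real.norm_of_nonneg h.X_nonneg]
    calc X * ‖Complex.sinh w / Complex.cosh w - w + w ^ 3 / 3‖
        ≤ K * q ^ 3 * (80 * ‖w‖ ^ 5) := by
          gcongr
          exact h.X_le
      _ = ‖w‖ * (80 * K * (q ^ 3 * ‖w‖ ^ 4)) := by ring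
      _ ≤ _ := by gcongr
  have n2 : ‖(s : ℂ) * q * (w ^ 3 / 3)‖ ≤ ‖w‖ * (σ ^ 2 / q * (1 + y) ^ 2) := by
    rw [norm_mul, norm_mul, norm_div, norm_pow, Complex.norm_real, Complex.norm_real,
      Real.norm_of_nonneg hq.le, Real.norm_eq_abs, Complex.norm_ofNat]
    calc |s| * q * (‖w‖ ^ 3 / 3) = ‖w‖ * (|s| * q * ‖w‖ ^ 2) / 3 := by ring
      _ ≤ ‖w‖ * (|s| * q * ‖w‖ ^ 2) := div_le_self (by positivity) (by norm_num)
      _ ≤ _ := by gcongr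
  have n3 : ‖((Y - q ^ 3 : ℝ) : ℂ) * w‖ ≤ ‖w‖ * D := by
    rw [norm_mul, Complex.norm_real, Real.norm_eq_abs, mul_comm]
    gcongr
    exact h.Y_le
  refine (norm_add₃_le).trans ((add_le_add (add_le_add n1 n2) n3).trans ?_)
  rw [← mul_add, ← mul_add]
  gcongr
  have hZ : 1 ≤ (1 + y) ^ 2 := one_le_pow₀ (by linarith)
  have hZ2 : (1 + σ ^ 2 / q) * (1 + y) ^ 2 = (1 + y) ^ 2 + σ ^ 2 / q * (1 + y) ^ 2 := by ring
  rw [hZ2]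
  have hW : 0 ≤ σ ^ 2 / q * (1 + y) ^ 2 := by positivity
  nlinarith [mul_nonneg hK hW, mul_nonneg hD hW, mul_nonneg hK (by linarith : 0 ≤ (1 + y) ^ 2)]

theorem norm_coe_add_mul_I_ge_abs (b a : ℝ) : |a| ≤ ‖(b + a * Complex.I : ℂ)‖ := by
  have := Complex.abs_im_le_norm (b + a * Complex.I : ℂ)
  simpa using this

theorem norm_airyRescaled_le {q : ℝ} (hq : 0 < q) (s : ℝ) {a : ℝ} (ha : 1 ≤ |a|) :
    ‖airyRescaled q s (abscissa q s + a * Complex.I)‖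
      ≤ Real.exp (4 / 3) * Real.exp (-(q ^ 3 * abscissa q s * a ^ 2)) := by
  rw [airyRescaled, norm_div, ← Real.exp_add, Complex.norm_exp]
  have h1 : 1 ≤ ‖(abscissa q s + a * Complex.I : ℂ)‖ := ha.trans (norm_coe_add_mul_I_ge_abs _ _)
  refine (div_le_self (Real.exp_pos _).le h1).trans (Real.exp_le_exp.2 ?_)
  have := re_airyExponent_le hq s a
  linarith

/-- Comparison of the bulk and Airy integrands near the saddle. -/
theorem exists_norm_bulkIntegrand_sub_le_center (d : ℕ) {q₀ κ K D c : ℝ} (hc : 0 < c)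
    (hc1 : 2 * c ≤ 1) (hcκ : 2 * c ≤ κ / (4 * Real.cosh (1 / q₀) ^ 3)) :
    ∃ C : ℝ, 0 ≤ C ∧ ∀ q s X Y : ℝ, Admissible q₀ κ K D q s X Y → ∀ a : ℝ, |a| ≤ 1 →
      ‖bulkIntegrand d X Y (abscissa q s + a * Complex.I)
          - airyRescaled q s (abscissa q s + a * Complex.I)‖
        ≤ C * (1 + (1 + |s|) ^ 2 / q) * Real.exp (-c * (q ^ 3 * abscissa q s * a ^ 2)) := by
  obtain ⟨A, hA, hAle⟩ := exists_norm_amplitude_sub_le d (1 / q₀)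
  obtain ⟨G, hG, hGle⟩ := exists_one_add_sq_mul_exp_le hc
  set c₂ := |D / q₀ + 1 + K / 3| + 4 / 3
  refine ⟨Real.exp c₂ * (A + |160 * K + D + 1|) * G, by positivity, ?_⟩
  intro q s X Y h a ha
  have hq := h.q_pos
  have hch := Real.cosh_pos (1 / q₀)
  set b := abscissa q s with hbdef
  have hb : 0 < b := abscissa_pos hq s
  set w : ℂ := b + a * Complex.I with hw
  have hw0 : w ≠ 0 := add_mul_I_ne_zero hb a
  have hwpos : 0 < ‖w‖ := norm_pos_iff.2 hw0
  set y := q ^ 3 * b * a ^ 2 with hy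
  have hy0 : 0 ≤ y := by positivity
  have hpi : |a| ≤ Real.pi / 2 := ha.trans (by linarith [Real.pi_gt_three])
  have hre1 := h.re_bulkExponent_le a
  rw [← hbdef, ← hw] at hre1
  set eA : ℂ := -X * (Complex.sinh w / Complex.cosh w) + Y * w
  set eB : ℂ := q ^ 3 * (w ^ 3 / 3) - s * q * w
  have hcoshb : Real.cosh b ≤ Real.cosh (1 / q₀) := by
    rw [Real.cosh_le_cosh, abs_of_pos hb, abs_of_pos (by have := h.q₀_pos; positivity)]
    exact h.abscissa_le
  have hPle : ‖Complex.cosh w‖ ^ 2 ≤ Real.cosh (1 / q₀) ^ 2 := by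
    rw [hw, norm_cosh_sq]
    have := Real.cosh_sq b
    have h1 : Real.cosh b ^ 2 ≤ Real.cosh (1 / q₀) ^ 2 := by
      have := (Real.cosh_pos b).le
      gcongr
    nlinarith [Real.cos_sq_le_one a]
  have hPpos : 0 < ‖Complex.cosh w‖ ^ 2 := by
    rw [hw, norm_cosh_sq]
    have := Real.sinh_pos_iff.2 hb
    positivity
  -- Uses sin² a ≥ a²/4 and |cosh w| ≤ cosh(1/q₀). The rate 2c leaves a spare factor exp(-c y) to
  -- absorb (1 + y)².
  have hdecay : 2 * c * y ≤ κ / Real.cosh (1 / q₀) * (q ^ 3 * b) * Real.sin a ^ 2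
      / ‖Complex.cosh w‖ ^ 2 := by
    have hκ := h.κ_pos
    calc 2 * c * y ≤ κ / (4 * Real.cosh (1 / q₀) ^ 3) * y := by gcongr
      _ = κ / Real.cosh (1 / q₀) * (q ^ 3 * b) * (a ^ 2 / 4) / Real.cosh (1 / q₀) ^ 2 := by
        rw [hy]; field_simp
      _ ≤ _ := by
        gcongr
        exact quarter_sq_le_sin_sq hpi
  have hc₂ : D / q₀ + 1 + K / 3 ≤ c₂ := by
    have := le_abs_self (D / q₀ + 1 + K / 3)
    simp only [c₂]; linarith
  have hc₂' : 4 / 3 ≤ c₂ := by simp only [c₂]; linarith [abs_nonneg (D / q₀ + 1 + K / 3)]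
  have hreA : eA.re ≤ c₂ + -(2 * c) * y := by linarith
  have hreB : eB.re ≤ c₂ + -(2 * c) * y := by
    have := re_airyExponent_le hq s a
    rw [← hbdef, ← hw] at this
    have h2 : 2 * c * y ≤ 1 * y := by gcongr
    linarith
  have hamp := hAle b a hb h.abscissa_le ha
  rw [← hw] at hamp
  have hexp := h.norm_exponent_sub_le ha w hw
  set Z := (1 + (1 + |s|) ^ 2 / q) * (1 + y) ^ 2
  have hR : 0 ≤ (1 + |s|) ^ 2 / q := by positivity
  have hZ : 1 ≤ Z := one_le_mul_of_one_le_of_one_le (by linarith) (one_le_pow₀ (by linarith))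
  -- Amplitude error plus phase error; in the latter the factor ‖w‖ of the phase difference cancels
  -- 1/w.
  have hsplit : bulkIntegrand d X Y w - airyRescaled q s w
      = Complex.exp eA * (1 / (Complex.sinh w * Complex.cosh w ^ d) - 1 / w)
        + (Complex.exp eA - Complex.exp eB) / w := by
    simp only [bulkIntegrand, airyRescaled, eA, eB]
    ring
  rw [hsplit]
  have n1 : ‖Complex.exp eA * (1 / (Complex.sinh w * Complex.cosh w ^ d) - 1 / w)‖
      ≤ Real.exp (c₂ + -(2 * c) * y) * (A * Z) := by
    rw [norm_mul, Complex.norm_exp]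
    gcongr
    exact hamp.trans (le_mul_of_one_le_right hA hZ)
  have n2 : ‖(Complex.exp eA - Complex.exp eB) / w‖
      ≤ Real.exp (c₂ + -(2 * c) * y) * (|160 * K + D + 1| * Z) := by
    rw [norm_div, div_le_iff₀ hwpos]
    refine (norm_exp_sub_exp_le hreA hreB).trans ?_
    rw [mul_assoc]
    gcongr
    refine hexp.trans ?_
    rw [mul_comm]
    gcongr
    exact le_abs_self _
  calc _ ≤ Real.exp (c₂ + -(2 * c) * y) * (A * Z)
        + Real.exp (c₂ + -(2 * c) * y) * (|160 * K + D + 1| * Z) :=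
      (norm_add_le _ _).trans (add_le_add n1 n2)
    _ = Real.exp c₂ * (A + |160 * K + D + 1|) * (1 + (1 + |s|) ^ 2 / q)
        * ((1 + y) ^ 2 * Real.exp (-(2 * c) * y)) := by
      rw [Real.exp_add]; simp only [Z]; ring
    _ ≤ Real.exp c₂ * (A + |160 * K + D + 1|) * (1 + (1 + |s|) ^ 2 / q)
        * (G * Real.exp (-c * y)) := by
      exact mul_le_mul_of_nonneg_left (hGle y hy0) (by positivity)
    _ = _ := by ring

/-! ### The tails and the integrated comparison -/

/-- The bulk integrand away from the saddle. -/
theorem exists_norm_bulkIntegrand_le (d : ℕ) {q₀ κ K D c : ℝ} (hq₀ : 0 < q₀) (hκ : 0 < κ)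
    (hK : 0 ≤ K) (hcκ : c ≤ κ / (32 * Real.cosh (1 / q₀) ^ 3)) :
    ∃ C : ℝ, 0 ≤ C ∧ ∀ q s X Y : ℝ, Admissible q₀ κ K D q s X Y → ∀ a : ℝ, 1 ≤ |a| →
      |a| ≤ Real.pi / 2 →
      ‖bulkIntegrand d X Y (abscissa q s + a * Complex.I)‖
        ≤ C * Real.exp (-c * (q ^ 3 * abscissa q s * a ^ 2)) := by
  have hch := Real.cosh_pos (1 / q₀)
  set ch := Real.cosh (1 / q₀)
  set g₀ := κ / (8 * ch) * (1 / (1 / q₀ ^ 2 + K + 1))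
  have hg₀ : 0 < g₀ := by positivity
  refine ⟨2 * Real.exp (D / q₀ + 1 + K / 3) * (d.factorial * ch ^ d / g₀ ^ d), by positivity, ?_⟩
  intro q s X Y h a ha1 hpi
  have hq := h.q_pos
  set b := abscissa q s with hbdef
  have hb : 0 < b := abscissa_pos hq s
  set w : ℂ := b + a * Complex.I with hw
  have hre1 := h.re_bulkExponent_le a
  rw [← hbdef, ← hw] at hre1
  set P := ‖Complex.cosh w‖ with hP
  have hcoshb : Real.cosh b ≤ ch := by
    rw [Real.cosh_le_cosh, abs_of_pos hb, abs_of_pos (by positivity)]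
    exact h.abscissa_le
  have hPle : P ≤ ch := by
    refine abs_le_of_sq_le_sq' ?_ hch.le |>.2
    rw [hP, hw, norm_cosh_sq]
    have := Real.cosh_sq b
    have h1 : Real.cosh b ^ 2 ≤ ch ^ 2 := by
      have := (Real.cosh_pos b).le
      gcongr
    nlinarith [Real.cos_sq_le_one a]
  have hPpos2 : 0 < P ^ 2 := by
    rw [hP, hw, norm_cosh_sq]
    have := Real.sinh_pos_iff.2 hb
    positivity
  have hPpos : 0 < P := lt_of_le_of_ne (norm_nonneg _) fun h0 => by
    rw [← h0] at hPpos2; norm_num at hPpos2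
  set g := κ / (8 * ch) * (q ^ 3 * b) with hg
  have hgg : g₀ ≤ g := by
    simp only [g₀, g]
    gcongr
    exact h.le_cube_mul_abscissa
  have hgpos : 0 < g := hg₀.trans_le hgg
  have hsin : 1 / 4 ≤ Real.sin a ^ 2 := by
    have h1 := quarter_sq_le_sin_sq hpi
    have h2 : 1 ≤ a ^ 2 := by rw [← sq_abs]; exact one_le_pow₀ ha1
    linarith
  -- The decay is spent in two halves: one beats P^(-d), which is large near a = ±π/2 where cosh w
  -- is small, and the other gives the Gaussian, as a² ≤ 4 there.
  have hE : 2 * (g / P ^ 2) ≤ κ / ch * (q ^ 3 * b) * Real.sin a ^ 2 / P ^ 2 := by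
    calc 2 * (g / P ^ 2) = κ / ch * (q ^ 3 * b) * (1 / 4) / P ^ 2 := by
          rw [hg]; field_simp; ring
      _ ≤ _ := by gcongr
  have hf1 : Real.exp (-(g / P ^ 2)) ≤ d.factorial * (P ^ 2) ^ d / g₀ ^ d := by
    have h1 := Real.pow_div_factorial_le_exp (x := g / P ^ 2) (by positivity) d
    rw [Real.exp_neg]
    calc (Real.exp (g / P ^ 2))⁻¹ ≤ ((g / P ^ 2) ^ d / d.factorial)⁻¹ := by
          gcongr
      _ = d.factorial * (P ^ 2) ^ d / g ^ d := by
          rw [div_pow]; field_simp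
      _ ≤ d.factorial * (P ^ 2) ^ d / g₀ ^ d := by gcongr
  have ha2 : a ^ 2 ≤ 4 := by
    have h2 : |a| ≤ 2 := hpi.trans (by linarith [Real.pi_le_four])
    rw [← sq_abs]; nlinarith [abs_nonneg a]
  have hf2 : Real.exp (-(g / P ^ 2)) ≤ Real.exp (-c * (q ^ 3 * b * a ^ 2)) := by
    refine Real.exp_le_exp.2 ?_
    rw [neg_mul, neg_le_neg_iff]
    calc c * (q ^ 3 * b * a ^ 2) ≤ κ / (32 * ch ^ 3) * (q ^ 3 * b * 4) := by gcongr
      _ = g / ch ^ 2 := by rw [hg]; field_simp; ring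
      _ ≤ g / P ^ 2 := by gcongr
  have hsinh : 1 / 2 ≤ ‖Complex.sinh w‖ := by
    have h1 := half_norm_le_norm_sinh hb.le hpi
    have h2 : 1 ≤ ‖w‖ := ha1.trans (norm_coe_add_mul_I_ge_abs b a)
    rw [← hw] at h1
    linarith
  rw [bulkIntegrand, norm_div, norm_mul, norm_pow, Complex.norm_exp, ← hP]
  calc _ ≤ Real.exp (D / q₀ + 1 + K / 3 + (-(g / P ^ 2) + -(g / P ^ 2))) / (1 / 2 * P ^ d) := by
        gcongr
        linarith
    _ = 2 * Real.exp (D / q₀ + 1 + K / 3) * (Real.exp (-(g / P ^ 2)) / P ^ d)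
          * Real.exp (-(g / P ^ 2)) := by
        rw [Real.exp_add, Real.exp_add (-(g / P ^ 2))]
        generalize Real.exp (-(g / P ^ 2)) = t
        field_simp
    _ ≤ 2 * Real.exp (D / q₀ + 1 + K / 3) * (d.factorial * ch ^ d / g₀ ^ d)
          * Real.exp (-c * (q ^ 3 * b * a ^ 2)) := by
        refine mul_le_mul (mul_le_mul_of_nonneg_left ?_ (by positivity)) hf2
          (Real.exp_pos _).le (by positivity)
        rw [div_le_iff₀ (by positivity)]
        refine hf1.trans ?_
        calc (d.factorial : ℝ) * (P ^ 2) ^ d / g₀ ^ d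
            = d.factorial * P ^ d / g₀ ^ d * P ^ d := by ring
          _ ≤ d.factorial * ch ^ d / g₀ ^ d * P ^ d := by gcongr

theorem continuous_bulkIntegrand (d : ℕ) (X Y : ℝ) {b : ℝ} (hb : 0 < b) :
    Continuous fun a : ℝ => bulkIntegrand d X Y (b + a * Complex.I) := by
  have hs : ∀ a : ℝ, Complex.sinh (b + a * Complex.I) ≠ 0 := fun a h0 => by
    have h1 := norm_sinh_sq b a
    rw [h0, norm_zero] at h1
    have := Real.sinh_pos_iff.2 hb
    nlinarith [sq_nonneg (Real.sin a)]
  have hc : ∀ a : ℝ, Complex.cosh (b + a * Complex.I) ≠ 0 := fun a h0 => by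
    have h1 := norm_cosh_sq b a
    rw [h0, norm_zero] at h1
    have := Real.sinh_pos_iff.2 hb
    nlinarith [sq_nonneg (Real.cos a)]
  unfold bulkIntegrand
  have h1 : Continuous fun a : ℝ => (b + a * Complex.I : ℂ) := by fun_prop
  refine Continuous.div ?_ ?_ fun a => mul_ne_zero (hs a) (pow_ne_zero d (hc a))
  · exact Complex.continuous_exp.comp ((continuous_const.mul ((Complex.continuous_sinh.comp h1).div
      (Complex.continuous_cosh.comp h1) hc)).add (continuous_const.mul h1))
  · exact (Complex.continuous_sinh.comp h1).mul ((Complex.continuous_cosh.comp h1).pow d)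

/-- The rescaled Airy line integral. -/
theorem integral_airyRescaled {q : ℝ} (hq : 0 < q) (s : ℝ) :
    ∫ a : ℝ, airyRescaled q s (abscissa q s + a * Complex.I)
      = ∫ τ : ℝ, airyIntegrand s ((1 / (1 + |s|) : ℝ) + τ * Complex.I) := by
  have e : ∀ a : ℝ, airyRescaled q s (abscissa q s + a * Complex.I)
      = q * airyIntegrand s ((1 / (1 + |s|) : ℝ) + (q * a : ℝ) * Complex.I) := by
    intro a
    rw [airyRescaled_eq hq, ← mul_abscissa hq s]
    congr 2
    push_cast
    ring
  simp only [e]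
  rw [integral_const_mul, Measure.integral_comp_mul_left
    (fun τ : ℝ => airyIntegrand s ((1 / (1 + |s|) : ℝ) + τ * Complex.I)) q,
    abs_of_pos (inv_pos.2 hq), Complex.real_smul, ← mul_assoc]
  have : (q : ℂ) ≠ 0 := by exact_mod_cast hq.ne'
  rw [Complex.ofReal_inv, mul_inv_cancel₀ this, one_mul]

theorem integrable_airyRescaled {q : ℝ} (hq : 0 < q) (s : ℝ) :
    Integrable fun a : ℝ => airyRescaled q s (abscissa q s + a * Complex.I) := by
  have hσ := one_le_one_add_abs s
  have h := (integrable_airyIntegrand s (β := 1 / (1 + |s|)) (by positivity)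
    (div_le_one_of_le₀ hσ (by linarith))).comp_mul_left' hq.ne'
  refine (h.const_mul (q : ℂ)).congr (Filter.Eventually.of_forall fun a => ?_)
  simp only
  rw [airyRescaled_eq hq, ← mul_abscissa hq s]
  congr 2
  push_cast
  ring

/-- The bulk integral is close to the integrated Airy function. -/
theorem exists_norm_integral_bulkIntegrand_sub_le (d : ℕ) {q₀ κ K D : ℝ} (hq₀ : 0 < q₀)
    (hκ : 0 < κ) (hK : 0 ≤ K) :
    ∃ C : ℝ, 0 ≤ C ∧ ∀ q s X Y : ℝ, Admissible q₀ κ K D q s X Y →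
      ‖(∫ a in (-(Real.pi / 2))..(Real.pi / 2),
            bulkIntegrand d X Y (abscissa q s + a * Complex.I))
          - ∫ τ : ℝ, airyIntegrand s ((1 / (1 + |s|) : ℝ) + τ * Complex.I)‖
        ≤ C * ((1 + (1 + |s|) ^ 2 / q) * (√(1 + |s|) / q)) := by
  have hch := Real.cosh_pos (1 / q₀)
  -- The 1/2 comes from the Airy decay and the second entry from the tail estimate, which is
  -- stricter than the requirement of the bulk decay near the pole.
  set c := min (1 / 2) (κ / (32 * Real.cosh (1 / q₀) ^ 3)) with hcdef
  have hc : 0 < c := lt_min (by norm_num) (by positivity)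
  have hc2 : c ≤ κ / (32 * Real.cosh (1 / q₀) ^ 3) := min_le_right _ _
  have hc1 : c ≤ 1 / 2 := min_le_left _ _
  have hc3 : 2 * c ≤ κ / (4 * Real.cosh (1 / q₀) ^ 3) := by
    have e : κ / (4 * Real.cosh (1 / q₀) ^ 3) = 8 * (κ / (32 * Real.cosh (1 / q₀) ^ 3)) := by
      field_simp; norm_num
    rw [e]
    have : 0 ≤ κ / (32 * Real.cosh (1 / q₀) ^ 3) := by positivity
    linarith
  obtain ⟨C₁, hC₁, h₁⟩ := exists_norm_bulkIntegrand_sub_le_center d (q₀ := q₀) (κ := κ) (K := K)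
    (D := D) hc (by linarith) hc3
  obtain ⟨C₂, hC₂, h₂⟩ := exists_norm_bulkIntegrand_le d (D := D) hq₀ hκ hK hc2
  set C₃ := C₁ + (C₂ + Real.exp (4 / 3))
  refine ⟨C₃ * √(Real.pi / c), by positivity, ?_⟩
  intro q s X Y h
  have hq := h.q_pos
  have hσ := one_le_one_add_abs s
  set b := abscissa q s with hbdef
  have hb : 0 < b := abscissa_pos hq s
  set R := 1 + (1 + |s|) ^ 2 / q
  have hR : 1 ≤ R := by
    have : 0 ≤ (1 + |s|) ^ 2 / q := by positivity
    simp only [R]; linarith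
  set S : Set ℝ := Set.Ioc (-(Real.pi / 2)) (Real.pi / 2)
  have hS : MeasurableSet S := measurableSet_Ioc
  set f : ℝ → ℂ := fun a => bulkIntegrand d X Y (b + a * Complex.I)
  set u : ℝ → ℂ := fun a => airyRescaled q s (b + a * Complex.I)
  have hpos : -(Real.pi / 2) ≤ Real.pi / 2 := by linarith [Real.pi_pos]
  -- Extending the bulk integrand by zero lets one Gaussian bound on ℝ also cover the Airy tail
  -- outside the segment.
  have hf : Integrable (S.indicator f) :=
    (integrable_indicator_iff hS).2
      ((continuous_bulkIntegrand d X Y hb).integrableOn_Ioc)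
  have hu : Integrable u := integrable_airyRescaled hq s
  have hairy : ∀ a, 1 ≤ |a| → ‖u a‖ ≤ Real.exp (4 / 3) * Real.exp (-c * (q ^ 3 * b * a ^ 2)) := by
    intro a ha
    refine (norm_airyRescaled_le hq s ha).trans ?_
    gcongr
    have : 0 ≤ q ^ 3 * b * a ^ 2 := by positivity
    nlinarith
  have hpt : ∀ a : ℝ, ‖S.indicator f a - u a‖
      ≤ C₃ * R * Real.exp (-(c * (q ^ 3 * b)) * a ^ 2) := by
    intro a
    have e : -(c * (q ^ 3 * b)) * a ^ 2 = -c * (q ^ 3 * b * a ^ 2) := by ring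
    rw [e]
    set Ex := Real.exp (-c * (q ^ 3 * b * a ^ 2))
    have hEx : 0 < Ex := Real.exp_pos _
    have he : 0 < Real.exp (4 / 3) := Real.exp_pos _
    rcases le_or_gt |a| 1 with ha | ha
    · have haS : a ∈ S := by
        have h3 := Real.pi_gt_three
        have := abs_le.1 ha
        exact ⟨by linarith, by linarith⟩
      rw [Set.indicator_of_mem haS]
      refine (h₁ q s X Y h a ha).trans ?_
      have : C₁ ≤ C₃ := by simp only [C₃]; linarith
      gcongr
    · have hle : (C₂ + Real.exp (4 / 3)) * Ex ≤ C₃ * R * Ex := by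
        gcongr
        calc C₂ + Real.exp (4 / 3) ≤ C₃ := by simp only [C₃]; linarith
          _ ≤ C₃ * R := le_mul_of_one_le_right (by positivity) hR
      refine le_trans ?_ hle
      rw [add_mul]
      by_cases haS : a ∈ S
      · rw [Set.indicator_of_mem haS]
        exact (norm_sub_le _ _).trans (add_le_add
          (h₂ q s X Y h a ha.le (abs_le.2 ⟨haS.1.le, haS.2⟩)) (hairy a ha.le))
      · rw [Set.indicator_of_notMem haS, zero_sub, norm_neg]
        exact (hairy a ha.le).trans (by
          have : 0 ≤ C₂ * Ex := by positivity
          linarith)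
  have hμ : 0 < c * (q ^ 3 * b) := by positivity
  have hmain : ‖∫ a, (S.indicator f a - u a)‖
      ≤ ∫ a : ℝ, C₃ * R * Real.exp (-(c * (q ^ 3 * b)) * a ^ 2) :=
    norm_integral_le_of_norm_le ((integrable_exp_neg_mul_sq hμ).const_mul _)
      (Filter.Eventually.of_forall hpt)
  rw [integral_sub hf hu, integral_indicator hS, integral_airyRescaled hq s, integral_const_mul,
    integral_gaussian] at hmain
  rw [intervalIntegral.integral_of_le hpos]
  refine hmain.trans (le_of_eq ?_)
  -- The Gaussian has rate c q²/(1 + |s|), so its mass is a constant times √(1 + |s|)/q.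
  have hsq : √(Real.pi / (c * (q ^ 3 * b))) = √(Real.pi / c) * (√(1 + |s|) / q) := by
    rw [hbdef, cube_mul_abscissa hq]
    have e : Real.pi / (c * (q ^ 2 / (1 + |s|))) = Real.pi / c * ((1 + |s|) / q ^ 2) := by
      field_simp
    rw [e, Real.sqrt_mul (by positivity), Real.sqrt_div (by positivity : 0 ≤ 1 + |s|),
      Real.sqrt_sq hq.le]
  rw [hsq]
  ring

/-! ### Return to the parameters ħ, E and u -/

/-- The relative error, expressed through `r = ħ ^ (1 / 3)`. -/
theorem remainder_le {q₀ q r c U S : ℝ} (hq₀ : 0 < q₀) (hc : 0 < c) (hr : 0 < r) (hr1 : r ≤ 1)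
    (hqr : q₀ ≤ q * r) (hU : 0 ≤ U) (hS : 0 ≤ S) (hSU : S ≤ U / c) :
    (1 + (1 + S) ^ 2 / q) * (√(1 + S) / q)
      ≤ √(1 + 1 / c) / q₀ * (1 + 8 * (1 + 1 / c) ^ 2 / q₀)
        * (r * √(1 + U) + U ^ 2 * √U * r ^ 2) := by
  have hq : 0 < q := pos_of_mul_pos_left (hq₀.trans_le hqr) hr.le
  set A := 1 + 1 / c with hA
  have hApos : 0 < A := by positivity
  have hSA : 1 + S ≤ A * (1 + U) := by
    have : U / c = 1 / c * U := by ring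
    have : 0 ≤ 1 / c := by positivity
    rw [hA]; nlinarith
  have hqinv : 1 / q ≤ r / q₀ := by
    rw [div_le_div_iff₀ hq hq₀]; linarith
  have hsqrt : √(1 + S) ≤ √A * √(1 + U) := by
    rw [← Real.sqrt_mul hApos.le]; exact Real.sqrt_le_sqrt hSA
  -- For U ≤ 1 the first error term suffices, as r² ≤ r; for U > 1 the second does, as 1 + U ≤ 2U
  -- and √(1 + U) ≤ 2√U, whence 8.
  have hT : (1 + U) ^ 2 * √(1 + U) * r ^ 2 ≤ 8 * (r * √(1 + U) + U ^ 2 * √U * r ^ 2) := by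
    have h1 := Real.sqrt_nonneg (1 + U)
    have h2 := Real.sqrt_nonneg U
    rcases le_or_gt U 1 with h | h
    · calc (1 + U) ^ 2 * √(1 + U) * r ^ 2 ≤ (1 + 1) ^ 2 * √(1 + U) * (r * 1) := by
            rw [pow_two r]; gcongr
        _ ≤ 8 * (r * √(1 + U)) := by nlinarith [mul_nonneg hr.le h1]
        _ ≤ _ := by
            gcongr
            exact le_add_of_nonneg_right (by positivity)
    · have h3 : √(1 + U) ≤ 2 * √U := by
        rw [show (2 : ℝ) = √4 by rw [show (4 : ℝ) = 2 ^ 2 by norm_num, Real.sqrt_sq (by norm_num)],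
          ← Real.sqrt_mul (by norm_num)]
        exact Real.sqrt_le_sqrt (by linarith)
      calc (1 + U) ^ 2 * √(1 + U) * r ^ 2 ≤ (2 * U) ^ 2 * (2 * √U) * r ^ 2 := by
            gcongr; linarith
        _ = 8 * (U ^ 2 * √U * r ^ 2) := by ring
        _ ≤ _ := by
            gcongr
            exact le_add_of_nonneg_left (by positivity)
  calc (1 + (1 + S) ^ 2 / q) * (√(1 + S) / q)
      = (1 + (1 + S) ^ 2 * (1 / q)) * (√(1 + S) * (1 / q)) := by ring
    _ ≤ (1 + (A * (1 + U)) ^ 2 * (r / q₀)) * (√A * √(1 + U) * (r / q₀)) := by gcongr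
    _ = √A / q₀ * (r * √(1 + U) + A ^ 2 / q₀ * ((1 + U) ^ 2 * √(1 + U) * r ^ 2)) := by ring
    _ ≤ √A / q₀ * ((r * √(1 + U) + U ^ 2 * √U * r ^ 2)
          + A ^ 2 / q₀ * (8 * (r * √(1 + U) + U ^ 2 * √U * r ^ 2))) := by
        gcongr
        exact le_add_of_nonneg_right (by positivity)
    _ = _ := by ring

theorem rpow_third_pow_three {x : ℝ} (hx : 0 ≤ x) : (x ^ (1 / 3 : ℝ)) ^ 3 = x := by
  rw [← Real.rpow_natCast, ← Real.rpow_mul hx]; norm_num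

theorem rpow_two_thirds {x : ℝ} (hx : 0 ≤ x) : x ^ (2 / 3 : ℝ) = (x ^ (1 / 3 : ℝ)) ^ 2 := by
  rw [← Real.rpow_natCast, ← Real.rpow_mul hx]; norm_num

theorem rpow_five_halves {x : ℝ} (hx : 0 ≤ x) : x ^ (5 / 2 : ℝ) = x ^ 2 * √x := by
  rw [Real.sqrt_eq_rpow, ← Real.rpow_natCast x 2, ← Real.rpow_add_of_nonneg hx] <;> norm_num

/-- Points within the window `|u| < ħ ^ (-2 / 3)` around the energy shell are admissible, for the
large parameter `(2 * E / ħ) ^ (1 / 3)`. -/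
theorem admissible_of_energy {c ħ E u H D Y : ℝ} (hc : 0 < c) (hħ : 0 < ħ) (hħ1 : ħ ≤ 1)
    (hE : c ≤ E) (hH : c ≤ H) (hHE : H = E + u * (ħ / (2 * E)) ^ (2 / 3 : ℝ))
    (hu : |u| < ħ ^ (-(2 / 3) : ℝ)) (hD : 0 ≤ D) (hY : |Y - 2 * E / ħ| ≤ D) :
    Admissible ((2 * c) ^ (1 / 3 : ℝ)) (1 + 1 / (((2 * c) ^ (1 / 3 : ℝ)) ^ 2 * c))⁻¹
      (1 + 1 / (((2 * c) ^ (1 / 3 : ℝ)) ^ 2 * c)) D ((2 * E / ħ) ^ (1 / 3 : ℝ)) (u / E)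
      (2 * H / ħ) Y := by
  have hE0 : 0 < E := hc.trans_le hE
  have hZ : 0 < 2 * E / ħ := by positivity
  set q := (2 * E / ħ) ^ (1 / 3 : ℝ) with hq
  have hq3 : q ^ 3 = 2 * E / ħ := rpow_third_pow_three hZ.le
  have hqpos : 0 < q := Real.rpow_pos_of_pos hZ _
  set q₀ := (2 * c) ^ (1 / 3 : ℝ) with hq₀
  have hq₀pos : 0 < q₀ := Real.rpow_pos_of_pos (by positivity) _
  have hw : (ħ / (2 * E)) ^ (2 / 3 : ℝ) = 1 / q ^ 2 := by
    rw [← inv_div, Real.inv_rpow hZ.le, rpow_two_thirds hZ.le, ← hq, ← one_div]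
  have hqr : q₀ ≤ q * ħ ^ (1 / 3 : ℝ) := by
    rw [hq, ← Real.mul_rpow hZ.le hħ.le, div_mul_cancel₀ _ hħ.ne', hq₀]
    exact Real.rpow_le_rpow (by positivity) (by linarith) (by norm_num)
  -- The window |u| < ħ^(-2/3) enters here: |H - E| = |u|/q², and q ħ^(1/3) ≥ q₀.
  have hdiff : |H - E| ≤ 1 / q₀ ^ 2 := by
    have hr : 0 < ħ ^ (1 / 3 : ℝ) := Real.rpow_pos_of_pos hħ _
    rw [Real.rpow_neg hħ.le, rpow_two_thirds hħ.le] at hu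
    rw [hHE, hw, add_sub_cancel_left, abs_mul, abs_of_pos (by positivity : 0 < 1 / q ^ 2)]
    calc |u| * (1 / q ^ 2) ≤ ((ħ ^ (1 / 3 : ℝ)) ^ 2)⁻¹ * (1 / q ^ 2) := by gcongr
      _ = 1 / (q * ħ ^ (1 / 3 : ℝ)) ^ 2 := by field_simp
      _ ≤ 1 / q₀ ^ 2 := by gcongr
  have habs := abs_le.1 hdiff
  -- Applied to both `H` and `E`, this makes them comparable up to one factor, which is why the
  -- lower constant is the inverse of the upper one.
  have hbound : ∀ t : ℝ, c ≤ t → t + 1 / q₀ ^ 2 ≤ (1 + 1 / (q₀ ^ 2 * c)) * t := by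
    intro t ht
    have : 1 / q₀ ^ 2 = 1 / (q₀ ^ 2 * c) * c := by field_simp
    have : 1 / (q₀ ^ 2 * c) * c ≤ 1 / (q₀ ^ 2 * c) * t := by gcongr
    linarith
  refine ⟨hq₀pos, by positivity, by positivity, hD, ?_, ?_, ?_, ?_, ?_⟩
  · rw [hq, hq₀]
    refine Real.rpow_le_rpow (by positivity) ?_ (by norm_num)
    rw [le_div_iff₀ hħ]
    nlinarith
  · have e : u / E * q = u * (2 * E / ħ) / (E * q ^ 2) := by
      rw [← hq3]; field_simp
    rw [e, hq3, hHE, hw]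
    field_simp
  · rw [inv_mul_le_iff₀ (by positivity), hq3, ← mul_div_assoc]
    refine div_le_div_of_nonneg_right ?_ hħ.le
    have := hbound H hH
    linarith
  · rw [hq3, ← mul_div_assoc]
    refine div_le_div_of_nonneg_right ?_ hħ.le
    have := hbound E hE
    linarith
  · rwa [hq3]

end WignerOscillator

end

theorem theorem1p6 (d : ℕ) (hd : 1 ≤ d) (ε : ℝ) (hε : 0 < ε) (c : ℝ) (hc : 0 < c) :
    ∃ C : ℝ, ∀ (ħ E u : ℝ) (x ξ : EuclideanSpace ℝ (Fin d)),
      0 < ħ → ħ ≤ 1 → c ≤ E → c ≤ WignerOscillator.classicalH x ξ →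
      WignerOscillator.classicalH x ξ = E + u * (ħ / (2 * E)) ^ (2 / 3 : ℝ) →
      |u| < ħ ^ (-(2 / 3) : ℝ) →
      ‖WignerOscillator.bulkWigner d ħ 0 E x ξ
          - (((2 * Real.pi * ħ) ^ d)⁻¹
              * ∫ t in Set.Ioi (0 : ℝ), WignerOscillator.airyAi (u / E + t) : ℝ)‖
        ≤ ((2 * Real.pi * ħ) ^ d)⁻¹
            * (C * (ħ ^ (1 / 3 - ε) * (1 + |u|) ^ (1 / 2 : ℝ)
                + |u| ^ (5 / 2 : ℝ) * ħ ^ (2 / 3 - ε))) := by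
  open WignerOscillator in
  set q₀ := (2 * c) ^ (1 / 3 : ℝ) with hq₀
  have hq₀pos : 0 < q₀ := Real.rpow_pos_of_pos (by positivity) _
  set K := 1 + 1 / (q₀ ^ 2 * c) with hK
  have hKpos : 0 < K := by positivity
  obtain ⟨C₀, hC₀, hmain⟩ := exists_norm_integral_bulkIntegrand_sub_le d (D := (d : ℝ) + 1)
    hq₀pos (inv_pos.2 hKpos) hKpos.le
  set C₁ := √(1 + 1 / c) / q₀ * (1 + 8 * (1 + 1 / c) ^ 2 / q₀)
  have hC₁ : 0 ≤ C₁ := by positivity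
  refine ⟨(2 * Real.pi)⁻¹ * (C₀ * C₁), ?_⟩
  intro ħ E u x ξ hħ hħ1 hE hH hHE hu
  have hE0 : 0 < E := hc.trans_le hE
  have hZ : 0 < 2 * E / ħ := by positivity
  set q := (2 * E / ħ) ^ (1 / 3 : ℝ) with hq
  have hqpos : 0 < q := Real.rpow_pos_of_pos hZ _
  set s := u / E with hs
  -- The free abscissa of the contour formula is set to the one adapted to q and s = u/E.
  obtain ⟨Y, hY, hW⟩ := exists_bulkWigner_eq d hħ hE0 x ξ (abscissa_pos hqpos s)
  have hadm := admissible_of_energy hc hħ hħ1 hE hH hHE hu (by positivity) hY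
  have hσ := one_le_one_add_abs s
  have hA := integral_airyAi s (β := 1 / (1 + |s|)) (by positivity)
    (div_le_one_of_le₀ hσ (by linarith))
  rw [hW, Complex.ofReal_mul, hA, airyLine, ← mul_sub, ← mul_sub, norm_mul, norm_mul,
    Complex.norm_real, Real.norm_of_nonneg (by positivity)]
  have hpi : ‖(2 * Real.pi : ℂ)⁻¹‖ = (2 * Real.pi)⁻¹ := by
    rw [norm_inv, norm_mul, Complex.norm_real, Real.norm_of_nonneg Real.pi_pos.le]
    norm_num
  rw [hpi, mul_assoc (2 * Real.pi)⁻¹]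
  set r := ħ ^ (1 / 3 : ℝ) with hr
  have hrpos : 0 < r := Real.rpow_pos_of_pos hħ _
  have hr1 : r ≤ 1 := Real.rpow_le_one hħ.le hħ1 (by norm_num)
  have hqr : q₀ ≤ q * r := by
    rw [hq, hr, ← Real.mul_rpow hZ.le hħ.le, div_mul_cancel₀ _ hħ.ne', hq₀]
    exact Real.rpow_le_rpow (by positivity) (by linarith) (by norm_num)
  have hsu : |s| ≤ |u| / c := by
    rw [hs, abs_div, abs_of_pos hE0]
    gcongr
  have hrem := remainder_le hq₀pos hc hrpos hr1 hqr (abs_nonneg u) (abs_nonneg s) hsu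
  -- Since ħ ≤ 1, lowering the exponent by ε only enlarges the bound.
  have hr2 : r ^ 2 ≤ ħ ^ (2 / 3 - ε) := by
    rw [hr, ← rpow_two_thirds hħ.le]
    exact Real.rpow_le_rpow_of_exponent_ge hħ hħ1 (by linarith)
  have hr3 : r ≤ ħ ^ (1 / 3 - ε) :=
    Real.rpow_le_rpow_of_exponent_ge hħ hħ1 (by linarith)
  have hfin : r * √(1 + |u|) + |u| ^ 2 * √|u| * r ^ 2
      ≤ ħ ^ (1 / 3 - ε) * (1 + |u|) ^ (1 / 2 : ℝ) + |u| ^ (5 / 2 : ℝ) * ħ ^ (2 / 3 - ε) := by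
    rw [rpow_five_halves (abs_nonneg u), ← Real.sqrt_eq_rpow]
    gcongr
  gcongr ?_ * (?_ * ?_)
  calc _ ≤ C₀ * ((1 + (1 + |s|) ^ 2 / q) * (√(1 + |s|) / q)) := hmain q s _ Y hadm
    _ ≤ C₀ * (C₁ * (r * √(1 + |u|) + |u| ^ 2 * √|u| * r ^ 2)) := by gcongr
    _ ≤ C₀ * (C₁ * (ħ ^ (1 / 3 - ε) * (1 + |u|) ^ (1 / 2 : ℝ)
          + |u| ^ (5 / 2 : ℝ) * ħ ^ (2 / 3 - ε))) := by gcongr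
    _ = _ := by ring
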